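/- Let $s=s[0]\cdots s[n-1]$ be a nonempty string over an alphabet of machine words (nonnegative integers below $2^w$, compared in unit time), whose last letter is a terminator $\$$, smaller than all other letters of $s$. A suffix tree $T$ of $s$ is a compacted trie whose leaves spell exactly the suffixes $s[p..n-1]$, $0\le p<n$; its edge labels are stored as pointers to substrings of $s$, and the children of each node are stored as a linked list in arbitrary order. For a node $v$ let $\mathrm{str}(v)$ be the string written on the root--$v$ path. A node $u$ on the path from $v$ to the root (both ends included) is called left-branching (resp. right-branching) for $v$ if there is $p\in[0..n-1]$ such that $s[p..n-1]$ is lexicographically smaller (resp. greater) than $\mathrm{str}(v)$ and the longest common prefix of $s[p..n-1]$ and $\mathrm{str}(v)$ is $\mathrm{str}(u)$. **Lemma.** There are word-RAM programs (one for preprocessing, one for left queries and one for right queries) and a constant $C$, all independent of $s$, $T$ and $w$, such that the following holds for every such string $s$ of length $n$, every suffix tree $T$ of $s$, and every word size $w$ with $2^w\ge Cn$ whose words can hold the letters of $s$. Given $s$ and $T$ in memory, the preprocessing program builds in time at most $Cn$ a data structure, located in the first $Cn$ memory words. Given this data structure, a node $v$ of $T$ and an integer $d\ge 1$ that fits in a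 machine word, the left (resp. right) query program returns in time at most $C$, without changing the memory, the $d$th left-branching (resp. right-branching) node on the path from $v$ to the root, counted from $v$ towards the root, or reports that there are fewer than $d$ such nodes. -/

import Mathlib

/-! A word-RAM: registers and memory cells hold words `< 2 ^ w`, every operation has unit cost.
Programs are finite objects that do not depend on the word size or on the input. -/

namespace WordRAM

/-- The arithmetical, comparison and bitwise operations on machine words. -/
inductive Op where
  | add | sub | mul | div | mod | lt | eq | shl | shr | and | or | xor

/-- The result of an operation on `w`-bit words (arithmetic modulo `2 ^ w`; comparisons give
`0` or `1`). -/
def Op.apply (w : ℕ) : Op → ℕ → ℕ → ℕ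
  | .add, a, b => (a + b) % 2 ^ w
  | .sub, a, b => (a + (2 ^ w - b)) % 2 ^ w
  | .mul, a, b => (a * b) % 2 ^ w
  | .div, a, b => a / b
  | .mod, a, b => a % b
  | .lt, a, b => (if a < b then 1 else 0) % 2 ^ w
  | .eq, a, b => (if a = b then 1 else 0) % 2 ^ w
  | .shl, a, b => (a <<< b) % 2 ^ w
  | .shr, a, b => a >>> b
  | .and, a, b => a &&& b
  | .or, a, b => a ||| b
  | .xor, a, b => a ^^^ b

/-- Contents of the registers and of the random access memory. -/
structure State where
  reg : ℕ → ℕ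
  mem : ℕ → ℕ

/-- Expressions: literals, registers, indirect memory reads, and operations. -/
inductive Expr where
  | lit (k : ℕ)
  | reg (r : ℕ)
  | load (addr : Expr)
  | op (o : Op) (e₁ e₂ : Expr)

/-- The value of an expression in a state. -/
def Expr.eval (w : ℕ) (σ : State) : Expr → ℕ
  | .lit k => k % 2 ^ w
  | .reg r => σ.reg r
  | .load e => σ.mem (e.eval w σ)
  | .op o e₁ e₂ => o.apply w (e₁.eval w σ) (e₂.eval w σ)

/-- The time to evaluate an expression: one unit for each literal, register access, memory
access and operation. -/
def Expr.cost : Expr → ℕ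
  | .lit _ => 1
  | .reg _ => 1
  | .load e => e.cost + 1
  | .op _ e₁ e₂ => e₁.cost + e₂.cost + 1

/-- Programs. A test succeeds when the value of the expression is nonzero. -/
inductive Prog where
  | skip
  | assign (r : ℕ) (e : Expr)
  | store (addr e : Expr)
  | seq (p q : Prog)
  | ite (e : Expr) (p q : Prog)
  | loop (e : Expr) (p : Prog)

/-- `Runs w p σ t τ`: on `w`-bit words, the program `p` started in the state `σ` halts after
exactly `t` units of time in the state `τ`. -/
inductive Runs (w : ℕ) : Prog → State → ℕ → State → Prop
  | skip (σ : State) : Runs w .skip σ 1 σ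
  | assign (r : ℕ) (e : Expr) (σ : State) :
      Runs w (.assign r e) σ (e.cost + 1) ⟨Function.update σ.reg r (e.eval w σ), σ.mem⟩
  | store (a e : Expr) (σ : State) :
      Runs w (.store a e) σ (a.cost + e.cost + 1)
        ⟨σ.reg, Function.update σ.mem (a.eval w σ) (e.eval w σ)⟩
  | seq {p q : Prog} {σ ρ τ : State} {t u : ℕ} :
      Runs w p σ t ρ → Runs w q ρ u τ → Runs w (.seq p q) σ (t + u) τ
  | iteTrue {e : Expr} {p q : Prog} {σ τ : State} {t : ℕ} :
      e.eval w σ ≠ 0 → Runs w p σ t τ → Runs w (.ite e p q) σ (e.cost + 1 + t) τ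
  | iteFalse {e : Expr} {p q : Prog} {σ τ : State} {t : ℕ} :
      e.eval w σ = 0 → Runs w q σ t τ → Runs w (.ite e p q) σ (e.cost + 1 + t) τ
  | loopDone {e : Expr} {p : Prog} {σ : State} :
      e.eval w σ = 0 → Runs w (.loop e p) σ (e.cost + 1) σ
  | loopStep {e : Expr} {p : Prog} {σ ρ τ : State} {t u : ℕ} :
      e.eval w σ ≠ 0 → Runs w p σ t ρ → Runs w (.loop e p) ρ u τ →
      Runs w (.loop e p) σ (e.cost + 1 + t + u) τ

/-- Start of a computation: the given words occupy the cells `0, 1, 2, …` of the memory; all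
other cells and all registers are zero. -/
def initState (input : List ℕ) : State where
  reg := fun _ => 0
  mem := fun a => input.getD a 0

/-- Start of a query with two arguments on a given memory: the arguments are in the registers
`0` and `1`; all other registers are zero. -/
def queryState (mem : ℕ → ℕ) (x y : ℕ) : State where
  reg := fun r => if r = 0 then x else if r = 1 then y else 0
  mem := mem

/-- On the memory `mem`, the query program `q` with arguments `x`, `y` returns `z` (in register
`0`) in time at most `T`, leaving the memory unchanged. -/
def Answers (w : ℕ) (q : Prog) (mem : ℕ → ℕ) (x y T z : ℕ) : Prop :=
  ∃ t τ, Runs w q (queryState mem x y) t τ ∧ t ≤ T ∧ τ.mem = mem ∧ τ.reg 0 = z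

end WordRAM

/-- The longest common prefix of two strings. -/
def longestCommonPrefix : List ℕ → List ℕ → List ℕ
  | a :: x, b :: y => if a = b then a :: longestCommonPrefix x y else []
  | _, _ => []

/-- The last letter of the string is a terminator: it is smaller than all other letters. In
particular the string is nonempty. -/
def Terminated (s : List ℕ) : Prop :=
  ∃ (t : List ℕ) (c : ℕ), s = t ++ [c] ∧ ∀ a ∈ t, c < a

/-- A rooted tree on the nodes `0, …, size - 1` whose edges are labelled by substrings of `s`.
The label of the edge to `v` from its parent is stored as its starting position `start v` in `s`
and its length `len v` (zero for the root, which has no such edge). The children of a node are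
listed in an arbitrary order. -/
structure LabelledTree (s : List ℕ) where
  size : ℕ
  root : Fin size
  parent : Fin size → Fin size
  children : Fin size → List (Fin size)
  start : Fin size → ℕ
  len : Fin size → ℕ
  parent_root : parent root = root
  reaches_root : ∀ v, ∃ k, parent^[k] v = root
  nodup_children : ∀ v, (children v).Nodup
  mem_children : ∀ u v, u ∈ children v ↔ u ≠ root ∧ parent u = v
  label_le : ∀ v, start v + len v ≤ s.length
  len_root : len root = 0

namespace LabelledTree

variable {s : List ℕ} (T : LabelledTree s)

/-- The number of edges on the path from `v` to the root. -/
def depth (v : Fin T.size) : ℕ := Nat.find (T.reaches_root v)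

/-- The nodes on the path from `v` (included) to the root (included), in this order. -/
def path (v : Fin T.size) : List (Fin T.size) :=
  (List.range (T.depth v + 1)).map fun k => T.parent^[k] v

/-- The label of the edge that enters `v` (empty for the root). -/
def label (v : Fin T.size) : List ℕ := (s.drop (T.start v)).take (T.len v)

/-- The string written on the path from the root to `v`. -/
def str (v : Fin T.size) : List ℕ := ((T.path v).reverse.map T.label).flatten

end LabelledTree

/-- A suffix tree of `s`: a compacted trie of the nonempty suffixes of `s`, where these suffixes
are the strings of the leaves. -/
structure SuffixTree (s : List ℕ) extends LabelledTree s where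
  /-- labels of edges are nonempty -/
  label_ne_nil : ∀ v, v ≠ root → toLabelledTree.label v ≠ []
  /-- the labels of the edges to distinct children of a node start with distinct letters -/
  label_distinct : ∀ x, ∀ u ∈ children x, ∀ v ∈ children x, u ≠ v →
    (toLabelledTree.label u).head? ≠ (toLabelledTree.label v).head?
  /-- the trie is compacted: inner nodes other than the root have at least two children -/
  branching : ∀ v, v ≠ root → children v ≠ [] → 2 ≤ (children v).length
  /-- the strings of the leaves are exactly the nonempty suffixes of `s` -/
  leaves : ∀ t : List ℕ,
    (∃ v, children v = [] ∧ toLabelledTree.str v = t) ↔ ∃ p, p < s.length ∧ t = s.drop p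

namespace SuffixTree

variable {s : List ℕ} (T : SuffixTree s)

/-- `u` is a left-branching node on the path from `v` to the root (`<` on lists is the
lexicographical order). -/
def IsLeftBranching (v u : Fin T.size) : Prop :=
  u ∈ T.path v ∧ ∃ p, p < s.length ∧
    s.drop p < T.str v ∧ longestCommonPrefix (s.drop p) (T.str v) = T.str u

/-- `u` is a right-branching node on the path from `v` to the root. -/
def IsRightBranching (v u : Fin T.size) : Prop :=
  u ∈ T.path v ∧ ∃ p, p < s.length ∧
    T.str v < s.drop p ∧ longestCommonPrefix (s.drop p) (T.str v) = T.str u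

instance (v u : Fin T.size) : Decidable (T.IsLeftBranching v u) := by
  unfold IsLeftBranching; infer_instance

instance (v u : Fin T.size) : Decidable (T.IsRightBranching v u) := by
  unfold IsRightBranching; infer_instance

/-- The `d`-th (`d ≥ 1`) left-branching node on the path from `v` to the root, counted from `v`,
if there are at least `d` of them. -/
def nthLeftBranching (v : Fin T.size) (d : ℕ) : Option (Fin T.size) :=
  ((T.path v).filter fun u => T.IsLeftBranching v u)[d - 1]?

/-- The `d`-th (`d ≥ 1`) right-branching node on the path from `v` to the root, counted from `v`,
if there are at least `d` of them. -/
def nthRightBranching (v : Fin T.size) (d : ℕ) : Option (Fin T.size) :=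
  ((T.path v).filter fun u => T.IsRightBranching v u)[d - 1]?

/-- A node, or the absence of a node, as a number: nodes are represented by their indices and
the nil pointer by the number of nodes. -/
def pointer : Option (Fin T.size) → ℕ
  | some u => u
  | none => T.size

/-- The child that follows `v` in the list of the children of its parent. -/
def nextSibling (v : Fin T.size) : Option (Fin T.size) :=
  (((T.children (T.parent v)).dropWhile fun u => u ≠ v).tail).head?

/-- The string and its suffix tree as the input of a program: the length of the string, the
number of nodes, the root, the letters of the string, and then for all nodes the parent, the
first child, the next sibling, and the position and the length of the label. -/
def encode : List ℕ :=
  [s.length, T.size, (T.root : ℕ)] ++ s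
    ++ List.ofFn (fun v : Fin T.size => (T.parent v : ℕ))
    ++ List.ofFn (fun v : Fin T.size => T.pointer (T.children v).head?)
    ++ List.ofFn (fun v : Fin T.size => T.pointer (T.nextSibling v))
    ++ List.ofFn T.start
    ++ List.ofFn T.len

end SuffixTree

/-! Combinatorial core. Suppose a suffix leaves the path to `v` at a node `u`. Then it continues
along a child of `u` whose letter differs from the letter of the child `c` of `u` on the path, and
these two letters decide the lexicographic comparison. Call a node marked if it has a sibling with a
smaller (for right queries: larger) letter. The left-branching nodes of `v` are therefore exactly
the parents of the marked nodes on its path, in the same order. For right queries `v` itself is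
added if it is an inner node, because `str v` is then a proper prefix of some suffix
(`exists_branching_iff`, `filter_path_exists_child`). A node is marked iff it is not the extreme
child of its parent, which a linear scan over the nodes decides although the child lists are
unordered.

Reduction to a stack. During the Euler tour, push the current time when a marked node is entered and
pop when it is left. Just after `v` is entered the stack lists the marked nodes on its path
(`map_stackAt`). A query therefore asks for the element at a given height `j` of a past version of a
stack. Two facts about such a stack carry the data structure: an element has kept its height ever
since its push (`getElem?_stackAt_of_le`), and the height changes by at most one per time unit
(`length_stackAt_sub`).

Constant-time access in linear space. Time is cut into blocks of size `B` of order log n. Each event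
stores how many stack elements are older than its block and a `B`-bit mask of the pushes of the
block that are still on the stack; a table for selection in bit masks, of size `B * 2 ^ B = O(n)`,
answers queries that stay inside the block. The start of every block stores its top `2 * B` stack
elements. In addition, for every `2 ^ κ` that divides the block index `i`, it stores `3 * 2 ^ κ`
elements sampled at distance `B`. Each of the O(log n) levels takes space proportional to the number
of blocks, O(n) in total.

A query that leaves its block lets `κ` be the logarithm of the distance from the top to `j`, in
units of `B`, and rounds the block index down to a multiple of `2 ^ κ`. This goes back fewer time
units than it takes to push the elements above `j`, so the wanted element is already there
(`getElem?_jump`), and it is close enough to the top to be covered by the samples (`jump_index_lt`).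
The sample found is itself a push time, less than `B` above the wanted element (`jump_target`). From
that time the mask or the top `2 * B` elements of a block start finish the query
(`add_bitSelect_blockMask`, `near_index_lt`).

Programs are written in a language with interleaved arrays. Correctness, running time and the set of
changed registers and arrays are proved together as Hoare triples `Triple`; loop-free pieces are
handled by `wp`. -/

/-! ### Programs with arrays

A small language with registers and thirty-two arrays on top of the word-RAM. The arrays are
interleaved in the memory above the input. -/

namespace WordRAM

/-- The result of an operation on natural numbers, without overflow. -/
def Op.val : Op → ℕ → ℕ → ℕ
  | .add, a, b => a + b
  | .sub, a, b => a - b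
  | .mul, a, b => a * b
  | .div, a, b => a / b
  | .mod, a, b => a % b
  | .lt, a, b => if a < b then 1 else 0
  | .eq, a, b => if a = b then 1 else 0
  | .shl, a, b => a * 2 ^ b
  | .shr, a, b => a / 2 ^ b
  | .and, a, b => a &&& b
  | .or, a, b => a ||| b
  | .xor, a, b => a ^^^ b

/-- No overflow occurs when the operation is executed on words below `c`. -/
def Op.Ok (c : ℕ) : Op → ℕ → ℕ → Prop
  | .add, a, b => a + b < c
  | .sub, a, b => b ≤ a ∧ a < c
  | .mul, a, b => a * b < c
  | .shl, a, b => a * 2 ^ b < c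
  | _, _, _ => True

theorem Op.apply_eq_val {w : ℕ} (hw : 1 < 2 ^ w) (o : Op) (a b : ℕ) (h : o.Ok (2 ^ w) a b) :
    o.apply w a b = o.val a b := by
  cases o <;> simp only [Op.Ok, Op.apply, Op.val] at *
  case add => exact Nat.mod_eq_of_lt h
  case mul => exact Nat.mod_eq_of_lt h
  case sub =>
    obtain ⟨h1, h2⟩ := h
    have : a + (2 ^ w - b) = (a - b) + 2 ^ w := by omega
    rw [this, Nat.add_mod_right, Nat.mod_eq_of_lt (by omega)]
  case lt => split_ifs <;> simp [Nat.mod_eq_of_lt hw]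
  case eq => split_ifs <;> simp [Nat.mod_eq_of_lt hw]
  case shl => rw [Nat.shiftLeft_eq]; exact Nat.mod_eq_of_lt h
  case shr => exact Nat.shiftRight_eq_div_pow a b

/-- The word size, the input and the memory layout of a computation with arrays: the input
occupies the cells below `base`, and the arrays have length `size`. -/
structure Env where
  w : ℕ
  base : ℕ
  size : ℕ
  inp : ℕ → ℕ
  base_eq : base = 3 + inp 0 + 5 * inp 1
  size_pos : 0 < size
  le_pow : base + 32 * size ≤ 2 ^ w

/-- The number of machine words. -/
def Env.cap (E : Env) : ℕ := 2 ^ E.w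

theorem Env.lt_pow (E : Env) : 32 < 2 ^ E.w := by
  have := E.le_pow; have := E.size_pos; have := E.base_eq; omega

/-- Contents of the registers and the arrays. -/
structure HState where
  reg : ℕ → ℕ
  arr : ℕ → ℕ → ℕ

def HState.setReg (σ : HState) (r v : ℕ) : HState := ⟨Function.update σ.reg r v, σ.arr⟩

def HState.setArr (σ : HState) (i x v : ℕ) : HState :=
  ⟨σ.reg, fun j y => if j = i ∧ y = x then v else σ.arr j y⟩

/-- The machine state that represents a state with arrays. -/
def Env.toState (E : Env) (σ : HState) : State where
  reg := σ.reg
  mem := fun a => if a < E.base then E.inp a else σ.arr ((a - E.base) % 32) ((a - E.base) / 32)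

/-- Expressions: literals, registers, cells of the input, array elements, operations. -/
inductive HExpr where
  | lit (k : ℕ)
  | reg (r : ℕ)
  | inp (e : HExpr)
  | arr (i : ℕ) (e : HExpr)
  | op (o : Op) (e₁ e₂ : HExpr)

namespace HExpr

def val (E : Env) (σ : HState) : HExpr → ℕ
  | lit k => k
  | reg r => σ.reg r
  | inp e => E.inp (e.val E σ)
  | arr i e => σ.arr i (e.val E σ)
  | op o e₁ e₂ => o.val (e₁.val E σ) (e₂.val E σ)

/-- All accesses are in bounds and no overflow occurs. -/
def Ok (E : Env) (σ : HState) : HExpr → Prop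
  | lit k => k < E.cap
  | reg _ => True
  | inp e => e.Ok E σ ∧ e.val E σ < E.base
  | arr i e => i < 32 ∧ e.Ok E σ ∧ e.val E σ < E.size
  | op o e₁ e₂ => e₁.Ok E σ ∧ e₂.Ok E σ ∧ o.Ok E.cap (e₁.val E σ) (e₂.val E σ)

/-- The address of an array element. -/
def address (i : ℕ) (e : Expr) : Expr :=
  .op .add (.op .add (.op .add (.op .add (.lit 3) (.load (.lit 0)))
    (.op .mul (.lit 5) (.load (.lit 1)))) (.lit i)) (.op .mul (.lit 32) e)

def compile : HExpr → Expr
  | lit k => .lit k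
  | reg r => .reg r
  | inp e => .load e.compile
  | arr i e => .load (address i e.compile)
  | op o e₁ e₂ => .op o e₁.compile e₂.compile

/-- The cells 0 and 1 of the input determine `base`, so the address is computable by a fixed
expression. The bound `le_pow` keeps every intermediate value below `2 ^ w`, so no reduction has an
effect. -/
theorem eval_address (E : Env) (σ : HState) (i : ℕ) (e : Expr) (x : ℕ)
    (he : e.eval E.w (E.toState σ) = x) (hi : i < 32) (hx : x < E.size) :
    (address i e).eval E.w (E.toState σ) = E.base + i + 32 * x := by
  have h1 := E.le_pow
  have h2 := E.base_eq
  have h3 := E.lt_pow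
  have m0 : (E.toState σ).mem 0 = E.inp 0 := by simp [Env.toState, h2]
  have m1 : (E.toState σ).mem 1 = E.inp 1 := by
    have : 1 < E.base := by omega
    simp [Env.toState, this]
  simp only [address, Expr.eval, he, Op.apply, Nat.zero_mod, m0]
  rw [Nat.mod_eq_of_lt (a := 1) (by omega), m1, Nat.mod_eq_of_lt (a := 3) (by omega),
    Nat.mod_eq_of_lt (a := 5) (by omega), Nat.mod_eq_of_lt (a := 32) (by omega),
    Nat.mod_eq_of_lt (a := i) (by omega), Nat.mod_eq_of_lt (a := 3 + E.inp 0) (by omega),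
    Nat.mod_eq_of_lt (a := 5 * E.inp 1) (by omega),
    Nat.mod_eq_of_lt (a := 3 + E.inp 0 + 5 * E.inp 1) (by omega),
    Nat.mod_eq_of_lt (a := 3 + E.inp 0 + 5 * E.inp 1 + i) (by omega),
    Nat.mod_eq_of_lt (a := 32 * x) (by omega), Nat.mod_eq_of_lt (by omega)]
  omega

theorem eval_compile (E : Env) (σ : HState) (e : HExpr) (h : e.Ok E σ) :
    e.compile.eval E.w (E.toState σ) = e.val E σ := by
  induction e with
  | lit k => exact Nat.mod_eq_of_lt h
  | reg r => rfl
  | inp e ih =>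
    simp only [compile, Expr.eval, ih h.1, val]
    simp [Env.toState, h.2]
  | arr i e ih =>
    simp only [compile, Expr.eval, val]
    rw [eval_address E σ i _ _ (ih h.2.1) h.1 h.2.2]
    have hi : i < 32 := h.1
    simp only [Env.toState]
    rw [if_neg (by omega), show (E.base + i + 32 * val E σ e - E.base) % 32 = i by omega,
      show (E.base + i + 32 * val E σ e - E.base) / 32 = val E σ e by omega]
  | op o e₁ e₂ ih₁ ih₂ =>
    simp only [compile, Expr.eval, val, ih₁ h.1, ih₂ h.2.1]
    exact Op.apply_eq_val (by have := E.lt_pow; omega) _ _ _ h.2.2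

def cost (e : HExpr) : ℕ := e.compile.cost

end HExpr

inductive HProg where
  | skip
  | assign (r : ℕ) (e : HExpr)
  | store (i : ℕ) (x e : HExpr)
  | seq (p q : HProg)
  | ite (e : HExpr) (p q : HProg)
  | loop (e : HExpr) (p : HProg)

/-! ### Hoare triples with running times -/

namespace HProg

def compile : HProg → Prog
  | skip => .skip
  | assign r e => .assign r e.compile
  | store i x e => .store (HExpr.address i x.compile) e.compile
  | seq p q => .seq p.compile q.compile
  | ite e p q => .ite e.compile p.compile q.compile
  | loop e p => .loop e.compile p.compile

/-- The arrays vanish out of bounds. -/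
def Supported (E : Env) (σ : HState) : Prop := ∀ i x, E.size ≤ x → σ.arr i x = 0

/-- The registers to which a program assigns. -/
def regs : HProg → List ℕ
  | skip => []
  | assign r _ => [r]
  | store _ _ _ => []
  | seq p q => p.regs ++ q.regs
  | ite _ p q => p.regs ++ q.regs
  | loop _ p => p.regs

/-- The arrays to which a program writes. -/
def arrs : HProg → List ℕ
  | skip => []
  | assign _ _ => []
  | store i _ _ => [i]
  | seq p q => p.arrs ++ q.arrs
  | ite _ p q => p.arrs ++ q.arrs
  | loop _ p => p.arrs

/-- Only registers and arrays that the program may change are different in the two states. -/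
def Frame (p : HProg) (σ τ : HState) : Prop :=
  (∀ r ∉ p.regs, τ.reg r = σ.reg r) ∧ ∀ i ∉ p.arrs, τ.arr i = σ.arr i

theorem Frame.refl (p : HProg) (σ : HState) : Frame p σ σ := ⟨fun _ _ => rfl, fun _ _ => rfl⟩

theorem Frame.trans {p : HProg} {σ τ ρ : HState} (h : Frame p σ τ) (h' : Frame p τ ρ) :
    Frame p σ ρ :=
  ⟨fun r hr => (h'.1 r hr).trans (h.1 r hr), fun i hi => (h'.2 i hi).trans (h.2 i hi)⟩

theorem Frame.mono {p q : HProg} {σ τ : HState} (h : Frame p σ τ) (hr : p.regs ⊆ q.regs)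
    (ha : p.arrs ⊆ q.arrs) : Frame q σ τ :=
  ⟨fun r hr' => h.1 r fun hp => hr' (hr hp), fun i hi => h.2 i fun hp => hi (ha hp)⟩

/-- Started in the state `σ`, the program `p` halts in time at most `t` in a state with the
property `Q`. -/
def Triple (E : Env) (p : HProg) (σ : HState) (t : ℕ) (Q : HState → Prop) : Prop :=
  Supported E σ → ∃ t' ≤ t, ∃ τ, Supported E τ ∧ Frame p σ τ ∧ Q τ ∧
    Runs E.w p.compile (E.toState σ) t' (E.toState τ)

/-- The weakest precondition of a program without loops. -/
def wp (E : Env) : HProg → (HState → Prop) → HState → Prop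
  | skip, Q, σ => Q σ
  | assign r e, Q, σ => e.Ok E σ ∧ Q (σ.setReg r (e.val E σ))
  | store i x e, Q, σ => i < 32 ∧ x.Ok E σ ∧ e.Ok E σ ∧ x.val E σ < E.size ∧
      Q (σ.setArr i (x.val E σ) (e.val E σ))
  | seq p q, Q, σ => p.wp E (q.wp E Q) σ
  | ite e p q, Q, σ => e.Ok E σ ∧ (e.val E σ ≠ 0 → p.wp E Q σ) ∧ (e.val E σ = 0 → q.wp E Q σ)
  | loop _ _, _, _ => False

/-- An upper bound on the time of a program without loops. -/
def time : HProg → ℕ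
  | skip => 1
  | assign _ e => e.cost + 1
  | store i x e => (HExpr.address i x.compile).cost + e.cost + 1
  | seq p q => p.time + q.time
  | ite e p q => e.cost + 1 + max p.time q.time
  | loop _ _ => 0

theorem Triple.mono {E : Env} {p : HProg} {σ : HState} {t u : ℕ} {P Q : HState → Prop}
    (h : Triple E p σ t P) (htu : t ≤ u) (hPQ : ∀ τ, Frame p σ τ → P τ → Q τ) :
    Triple E p σ u Q := by
  intro hs
  obtain ⟨t', ht, τ, h1, hf, h2, h3⟩ := h hs
  exact ⟨t', ht.trans htu, τ, h1, hf, hPQ _ hf h2, h3⟩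

theorem Triple.seq {E : Env} {p q : HProg} {σ : HState} {t u : ℕ} {P Q : HState → Prop}
    (hp : Triple E p σ t P) (hq : ∀ τ, Frame p σ τ → P τ → Triple E q τ u Q) :
    Triple E (p.seq q) σ (t + u) Q := by
  intro hs
  obtain ⟨t', ht, τ, h1, hf, h2, h3⟩ := hp hs
  obtain ⟨u', hu, ρ, k1, kf, k2, k3⟩ := hq τ hf h2 h1
  exact ⟨t' + u', by omega, ρ, k1,
    (hf.mono (q := p.seq q) (by simp [regs]) (by simp [arrs])).trans
      (kf.mono (by simp [regs]) (by simp [arrs])), k2, .seq h3 k3⟩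

theorem Triple.ite {E : Env} {e : HExpr} {p q : HProg} {σ : HState} {t : ℕ} {Q : HState → Prop}
    (he : e.Ok E σ) (hp : e.val E σ ≠ 0 → Triple E p σ t Q)
    (hq : e.val E σ = 0 → Triple E q σ t Q) :
    Triple E (.ite e p q) σ (e.cost + 1 + t) Q := by
  intro hs
  have hev := HExpr.eval_compile E σ e he
  by_cases h : e.val E σ = 0
  · obtain ⟨t', ht, τ, h1, hf, h2, h3⟩ := hq h hs
    exact ⟨e.cost + 1 + t', by omega, τ, h1, hf.mono (by simp [regs]) (by simp [arrs]), h2,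
      .iteFalse (by rw [hev, h]) h3⟩
  · obtain ⟨t', ht, τ, h1, hf, h2, h3⟩ := hp h hs
    exact ⟨e.cost + 1 + t', by omega, τ, h1, hf.mono (by simp [regs]) (by simp [arrs]), h2,
      .iteTrue (by rw [hev]; exact h) h3⟩

/-- Structural induction; loops are excluded because their `wp` is `False`. The only case with
content is a store, where the interleaved layout must be shown to change a single array element. -/
theorem triple_of_wp {E : Env} {p : HProg} {σ : HState} {Q : HState → Prop}
    (h : p.wp E Q σ) : Triple E p σ p.time Q := by
  induction p generalizing σ Q with
  | skip => exact fun hs => ⟨1, le_rfl, σ, hs, .refl _ _, h, .skip _⟩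
  | assign r e =>
    intro hs
    refine ⟨_, le_rfl, σ.setReg r (e.val E σ), ?_, ⟨fun r' hr' => ?_, fun _ _ => rfl⟩, h.2, ?_⟩
    · exact hs
    · exact Function.update_of_ne (by simpa [regs] using hr') _ _
    · have := Runs.assign (w := E.w) r e.compile (E.toState σ)
      rw [HExpr.eval_compile E σ e h.1] at this
      exact this
  | store i x e =>
    intro hs
    obtain ⟨hi, hx, he, hlt, hQ⟩ := h
    refine ⟨_, le_rfl, σ.setArr i (x.val E σ) (e.val E σ), ?_, ⟨fun _ _ => rfl, fun j hj => ?_⟩, hQ, ?_⟩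
    · intro j y hy
      change (if j = i ∧ y = x.val E σ then e.val E σ else σ.arr j y) = 0
      rw [if_neg (by omega)]
      exact hs j y hy
    · funext y
      have hj' : ¬ j = i := by simpa [arrs] using hj
      simp [HState.setArr, hj']
    · have := Runs.store (w := E.w) (HExpr.address i x.compile) e.compile (E.toState σ)
      rw [HExpr.eval_compile E σ e he,
        HExpr.eval_address E σ i _ _ (HExpr.eval_compile E σ x hx) hi hlt] at this
      have key : E.toState (σ.setArr i (x.val E σ) (e.val E σ)) = ⟨(E.toState σ).reg,
          Function.update (E.toState σ).mem (E.base + i + 32 * x.val E σ) (e.val E σ)⟩ := ?_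
      · rw [key]; exact this
      refine congrArg (State.mk _) (funext fun a => ?_)
      -- As `i < 32`, the address `base + i + 32 * x` determines `i` and `x` by remainder and
      -- quotient, so no other array element shares the cell.
      simp only [Env.toState, HState.setArr]
      by_cases ha : a < E.base
      · rw [if_pos ha, Function.update_apply, if_neg (by omega), if_pos ha]
      · rw [if_neg ha, Function.update_apply, if_neg ha]
        by_cases hax : a = E.base + i + 32 * x.val E σ
        · rw [if_pos hax, if_pos (by omega)]
        · rw [if_neg hax, if_neg (by omega)]
  | seq p q ihp ihq => exact (ihp h).seq fun τ _ hτ => ihq hτ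
  | ite e p q ihp ihq =>
    exact Triple.ite h.1 (fun h' => (ihp (h.2.1 h')).mono (le_max_left _ _) fun _ _ => id)
      (fun h' => (ihq (h.2.2 h')).mono (le_max_right _ _) fun _ _ => id)
  | loop e p _ => exact h.elim

theorem triple_of_wp_le {E : Env} {p : HProg} {σ : HState} {Q : HState → Prop} {t : ℕ}
    (ht : p.time ≤ t) (h : p.wp E Q σ) : Triple E p σ t Q :=
  (triple_of_wp h).mono ht fun _ _ => id

/-- A loop with `N` iterations, the `k`-th of which takes time `c k`. -/
theorem triple_loop {E : Env} {e : HExpr} {p : HProg} (N : ℕ) (c : ℕ → ℕ)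
    (I : ℕ → HState → Prop) {σ : HState}
    (hstep : ∀ k < N, ∀ τ, Frame p σ τ → I k τ →
      e.Ok E τ ∧ e.val E τ ≠ 0 ∧ Triple E p τ (c k) (I (k + 1)))
    (hend : ∀ τ, Frame p σ τ → I N τ → e.Ok E τ ∧ e.val E τ = 0)
    (h0 : I 0 σ) :
    Triple E (p.loop e) σ (∑ k ∈ Finset.range N, (e.cost + 1 + c k) + (e.cost + 1)) (I N) := by
  -- Induction on the number `j` of remaining iterations, since `Runs` unfolds a loop from its
  -- front.
  suffices H : ∀ j ≤ N, ∀ τ, Frame p σ τ → I (N - j) τ → Triple E (p.loop e) τ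
      (∑ k ∈ Finset.Ico (N - j) N, (e.cost + 1 + c k) + (e.cost + 1)) (I N) by
    have := H N le_rfl σ (.refl _ _) (by simpa using h0)
    simpa using this
  intro j
  induction j with
  | zero =>
    intro _ σ hf hσ hs
    obtain ⟨h1, h2⟩ := hend σ hf hσ
    refine ⟨e.cost + 1, by simp, σ, hs, .refl _ _, hσ, ?_⟩
    exact .loopDone (by rw [HExpr.eval_compile E σ e h1, h2])
  | succ j ih =>
    intro hj σ hf hσ hs
    obtain ⟨h1, h2, h3⟩ := hstep (N - (j + 1)) (by omega) σ hf hσ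
    obtain ⟨t, ht, τ, hτ, hf', hI, hr⟩ := h3 hs
    have hNj : N - (j + 1) + 1 = N - j := by omega
    rw [hNj] at hI
    obtain ⟨u, hu, ρ, hρ, hf'', hI', hr'⟩ := ih (by omega) τ (hf.trans hf') hI hτ
    refine ⟨e.cost + 1 + t + u, ?_, ρ, hρ, Frame.trans (p := p.loop e) hf' hf'', hI', ?_⟩
    · rw [Finset.sum_eq_sum_Ico_succ_bot (by omega), hNj]
      omega
    · exact .loopStep (by rw [HExpr.eval_compile E σ e h1]; exact h2) hr hr'

/-- A loop with `N` iterations, each of which takes time at most `c`. -/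
theorem triple_loop_const {E : Env} {e : HExpr} {p : HProg} (N c : ℕ)
    (I : ℕ → HState → Prop) {σ : HState}
    (hstep : ∀ k < N, ∀ τ, Frame p σ τ → I k τ →
      e.Ok E τ ∧ e.val E τ ≠ 0 ∧ Triple E p τ c (I (k + 1)))
    (hend : ∀ τ, Frame p σ τ → I N τ → e.Ok E τ ∧ e.val E τ = 0)
    (h0 : I 0 σ) :
    Triple E (p.loop e) σ ((N + 1) * (e.cost + 1 + c)) (I N) := by
  refine (triple_loop N (fun _ => c) I hstep hend h0).mono ?_ fun _ _ => id
  simp only [Finset.sum_const, Finset.card_range, smul_eq_mul]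
  nlinarith

end HProg

/-! ### Rewriting rules for states and expressions -/

namespace HState

@[simp] theorem setReg_reg (σ : HState) (r v r' : ℕ) :
    (σ.setReg r v).reg r' = if r' = r then v else σ.reg r' := Function.update_apply _ _ _ _

@[simp] theorem setReg_arr (σ : HState) (r v : ℕ) : (σ.setReg r v).arr = σ.arr := rfl

@[simp] theorem setArr_reg (σ : HState) (i x v : ℕ) : (σ.setArr i x v).reg = σ.reg := rfl

@[simp] theorem setArr_arr (σ : HState) (i x v j y : ℕ) :
    (σ.setArr i x v).arr j y = if j = i ∧ y = x then v else σ.arr j y := rfl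

end HState

namespace HExpr

instance (k : ℕ) : OfNat HExpr k := ⟨lit k⟩
instance : Add HExpr := ⟨op .add⟩
instance : Sub HExpr := ⟨op .sub⟩
instance : Mul HExpr := ⟨op .mul⟩
instance : Div HExpr := ⟨op .div⟩
instance : Mod HExpr := ⟨op .mod⟩

variable (E : Env) (σ : HState) (a b : HExpr) (k : ℕ)

@[simp] theorem val_ofNat : val E σ ofNat(k) = ofNat(k) := rfl
@[simp] theorem val_reg : val E σ (reg k) = σ.reg k := rfl
@[simp] theorem val_inp : val E σ (inp a) = E.inp (a.val E σ) := rfl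
@[simp] theorem val_arr : val E σ (arr k a) = σ.arr k (a.val E σ) := rfl
@[simp] theorem val_add : val E σ (a + b) = a.val E σ + b.val E σ := rfl
@[simp] theorem val_sub : val E σ (a - b) = a.val E σ - b.val E σ := rfl
@[simp] theorem val_mul : val E σ (a * b) = a.val E σ * b.val E σ := rfl
@[simp] theorem val_div : val E σ (a / b) = a.val E σ / b.val E σ := rfl
@[simp] theorem val_mod : val E σ (a % b) = a.val E σ % b.val E σ := rfl
@[simp] theorem val_lt :
    val E σ (op .lt a b) = if a.val E σ < b.val E σ then 1 else 0 := rfl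
@[simp] theorem val_eq :
    val E σ (op .eq a b) = if a.val E σ = b.val E σ then 1 else 0 := rfl
@[simp] theorem val_shl : val E σ (op .shl a b) = a.val E σ * 2 ^ b.val E σ := rfl
@[simp] theorem val_shr : val E σ (op .shr a b) = a.val E σ / 2 ^ b.val E σ := rfl

@[simp] theorem ok_ofNat : Ok E σ ofNat(k) ↔ ofNat(k) < E.cap := Iff.rfl
@[simp] theorem ok_reg : Ok E σ (reg k) := trivial
@[simp] theorem ok_inp : Ok E σ (inp a) ↔ a.Ok E σ ∧ a.val E σ < E.base := Iff.rfl
@[simp] theorem ok_arr : Ok E σ (arr k a) ↔ k < 32 ∧ a.Ok E σ ∧ a.val E σ < E.size := Iff.rfl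
@[simp] theorem ok_add : Ok E σ (a + b) ↔
    a.Ok E σ ∧ b.Ok E σ ∧ a.val E σ + b.val E σ < E.cap := Iff.rfl
@[simp] theorem ok_sub : Ok E σ (a - b) ↔
    a.Ok E σ ∧ b.Ok E σ ∧ b.val E σ ≤ a.val E σ ∧ a.val E σ < E.cap := Iff.rfl
@[simp] theorem ok_mul : Ok E σ (a * b) ↔
    a.Ok E σ ∧ b.Ok E σ ∧ a.val E σ * b.val E σ < E.cap := Iff.rfl
@[simp] theorem ok_div : Ok E σ (a / b) ↔ a.Ok E σ ∧ b.Ok E σ :=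
  ⟨fun h => ⟨h.1, h.2.1⟩, fun h => ⟨h.1, h.2, trivial⟩⟩
@[simp] theorem ok_mod : Ok E σ (a % b) ↔ a.Ok E σ ∧ b.Ok E σ :=
  ⟨fun h => ⟨h.1, h.2.1⟩, fun h => ⟨h.1, h.2, trivial⟩⟩
@[simp] theorem ok_lt : Ok E σ (op .lt a b) ↔ a.Ok E σ ∧ b.Ok E σ :=
  ⟨fun h => ⟨h.1, h.2.1⟩, fun h => ⟨h.1, h.2, trivial⟩⟩
@[simp] theorem ok_eq : Ok E σ (op .eq a b) ↔ a.Ok E σ ∧ b.Ok E σ :=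
  ⟨fun h => ⟨h.1, h.2.1⟩, fun h => ⟨h.1, h.2, trivial⟩⟩
@[simp] theorem ok_shl : Ok E σ (op .shl a b) ↔
    a.Ok E σ ∧ b.Ok E σ ∧ a.val E σ * 2 ^ b.val E σ < E.cap := Iff.rfl
@[simp] theorem ok_shr : Ok E σ (op .shr a b) ↔ a.Ok E σ ∧ b.Ok E σ :=
  ⟨fun h => ⟨h.1, h.2.1⟩, fun h => ⟨h.1, h.2, trivial⟩⟩

end HExpr

end WordRAM

/-! ### Paths and strings in suffix trees -/

namespace LabelledTree

variable {s : List ℕ} (T : LabelledTree s)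

theorem depth_root : T.depth T.root = 0 := by
  simp [depth, Nat.find_eq_zero]

theorem depth_of_ne_root {v : Fin T.size} (hv : v ≠ T.root) :
    T.depth v = T.depth (T.parent v) + 1 := by
  unfold depth
  rw [Nat.find_comp_succ (T.reaches_root v) (T.reaches_root (T.parent v)) (by simpa using hv)]
  rfl

theorem path_root : T.path T.root = [T.root] := by
  simp [path, depth_root]

theorem path_of_ne_root {v : Fin T.size} (hv : v ≠ T.root) :
    T.path v = v :: T.path (T.parent v) := by
  unfold path
  rw [T.depth_of_ne_root hv, List.range_succ_eq_map]
  simp [List.map_map, Function.comp_def]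

/-- Induction along the paths from the root. -/
theorem induction_parent {P : Fin T.size → Prop} (hroot : P T.root)
    (hstep : ∀ v, v ≠ T.root → P (T.parent v) → P v) (v : Fin T.size) : P v := by
  induction hd : T.depth v generalizing v with
  | zero =>
    by_cases hv : v = T.root
    · exact hv ▸ hroot
    · rw [T.depth_of_ne_root hv] at hd; omega
  | succ d ih =>
    by_cases hv : v = T.root
    · exact hv ▸ hroot
    · exact hstep v hv (ih _ (by rw [T.depth_of_ne_root hv] at hd; omega))

theorem self_mem_path (v : Fin T.size) : v ∈ T.path v := by
  by_cases hv : v = T.root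
  · simp [hv, path_root]
  · simp [T.path_of_ne_root hv]

theorem root_mem_path (v : Fin T.size) : T.root ∈ T.path v := by
  induction v using T.induction_parent with
  | hroot => exact T.self_mem_path _
  | hstep v hv ih => rw [T.path_of_ne_root hv]; exact List.mem_cons_of_mem _ ih

theorem mem_path_of_parent {u v : Fin T.size} (h : u ∈ T.path (T.parent v)) : u ∈ T.path v := by
  by_cases hv : v = T.root
  · subst hv; rwa [T.parent_root] at h
  · rw [T.path_of_ne_root hv]; exact List.mem_cons_of_mem _ h

theorem mem_path_trans {u v x : Fin T.size} (h : u ∈ T.path v) (h' : v ∈ T.path x) :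
    u ∈ T.path x := by
  induction x using T.induction_parent with
  | hroot =>
    rw [T.path_root, List.mem_singleton] at h'
    rwa [h'] at h
  | hstep x hx ih =>
    rw [T.path_of_ne_root hx, List.mem_cons] at h'
    rcases h' with rfl | h'
    · exact h
    · exact T.mem_path_of_parent (ih h')

theorem depth_le_of_mem_path {u v : Fin T.size} (h : u ∈ T.path v) :
    T.depth u ≤ T.depth v ∧ (T.depth u = T.depth v → u = v) := by
  induction v using T.induction_parent with
  | hroot =>
    rw [T.path_root, List.mem_singleton] at h
    simp [h]
  | hstep v hv ih =>
    rw [T.path_of_ne_root hv, List.mem_cons] at h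
    rcases h with rfl | h
    · simp
    · have := ih h
      have := T.depth_of_ne_root hv
      omega

theorem exists_child_of_mem_path {u v : Fin T.size} (h : u ∈ T.path v) (huv : u ≠ v) :
    ∃ c ∈ T.path v, c ≠ T.root ∧ T.parent c = u := by
  induction v using T.induction_parent with
  | hroot =>
    rw [T.path_root, List.mem_singleton] at h
    exact absurd h huv
  | hstep v hv ih =>
    rw [T.path_of_ne_root hv, List.mem_cons] at h
    rcases h with rfl | h
    · exact absurd rfl huv
    · by_cases hp : u = T.parent v
      · exact ⟨v, T.self_mem_path v, hv, hp.symm⟩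
      · obtain ⟨c, hc, hc'⟩ := ih h hp
        exact ⟨c, T.mem_path_of_parent hc, hc'⟩

theorem parent_mem_path {c v : Fin T.size} (h : c ∈ T.path v) : T.parent c ∈ T.path v := by
  have : T.parent c ∈ T.path c := T.mem_path_of_parent (T.self_mem_path _)
  exact T.mem_path_trans this h

/-- Siblings have equal depth, and a path contains only one node of each depth. -/
theorem eq_of_mem_path_of_parent_eq {c c' v : Fin T.size} (h : c ∈ T.path v) (h' : c' ∈ T.path v)
    (hc : c ≠ T.root) (hc' : c' ≠ T.root) (hp : T.parent c = T.parent c') : c = c' := by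
  have d1 := T.depth_of_ne_root hc
  have d2 := T.depth_of_ne_root hc'
  rw [hp, ← d2] at d1
  induction v using T.induction_parent with
  | hroot =>
    rw [T.path_root, List.mem_singleton] at h
    exact absurd h hc
  | hstep v hv ih =>
    have dv := T.depth_of_ne_root hv
    rw [T.path_of_ne_root hv, List.mem_cons] at h h'
    rcases h with rfl | h <;> rcases h' with rfl | h'
    · rfl
    · have := T.depth_le_of_mem_path h'
      omega
    · have := T.depth_le_of_mem_path h
      omega
    · exact ih h h'

/-- Two nodes are comparable, or their paths diverge at two distinct siblings. -/
theorem comparable_or_diverge (x y : Fin T.size) :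
    x ∈ T.path y ∨ y ∈ T.path x ∨ ∃ c c', c ≠ c' ∧ c ≠ T.root ∧ c' ≠ T.root ∧
      T.parent c = T.parent c' ∧ c ∈ T.path x ∧ c' ∈ T.path y := by
  induction x using T.induction_parent with
  | hroot => exact .inl (T.root_mem_path y)
  | hstep x hx ih =>
    rcases ih with h | h | ⟨c, c', h1, h2, h3, h4, h5, h6⟩
    · by_cases hy : T.parent x = y
      · exact .inr (.inl (hy ▸ T.mem_path_of_parent (T.self_mem_path _)))
      · obtain ⟨c, hc, hc1, hc2⟩ := T.exists_child_of_mem_path h hy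
        by_cases hcx : x = c
        · exact .inl (hcx ▸ hc)
        · exact .inr (.inr ⟨x, c, hcx, hx, hc1, hc2.symm, T.self_mem_path x, hc⟩)
    · exact .inr (.inl (T.mem_path_of_parent h))
    · exact .inr (.inr ⟨c, c', h1, h2, h3, h4, T.mem_path_of_parent h5, h6⟩)

theorem str_of_ne_root {v : Fin T.size} (hv : v ≠ T.root) :
    T.str v = T.str (T.parent v) ++ T.label v := by
  simp [str, T.path_of_ne_root hv]

theorem str_prefix_of_mem_path {u v : Fin T.size} (h : u ∈ T.path v) : T.str u <+: T.str v := by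
  induction v using T.induction_parent with
  | hroot =>
    rw [T.path_root, List.mem_singleton] at h
    rw [h]
  | hstep v hv ih =>
    rw [T.path_of_ne_root hv, List.mem_cons] at h
    rcases h with rfl | h
    · exact List.prefix_rfl
    · rw [T.str_of_ne_root hv]
      exact (ih h).trans (List.prefix_append _ _)

/-- The first letter of the label of the edge that enters a node. -/
def letter (v : Fin T.size) : ℕ := s.getD (T.start v) 0

theorem isLeaf_iff {v : Fin T.size} :
    T.children v = [] ↔ ∀ c, c ≠ T.root → T.parent c ≠ v := by
  rw [List.eq_nil_iff_forall_not_mem]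
  simp only [T.mem_children]
  tauto

/-- A deepest node below `v` has no children. -/
theorem exists_leaf (v : Fin T.size) : ∃ l, T.children l = [] ∧ v ∈ T.path l := by
  obtain ⟨l, hl, hmax⟩ := Finset.exists_max_image (Finset.univ.filter fun l => v ∈ T.path l)
    T.depth ⟨v, by simp [T.self_mem_path]⟩
  simp only [Finset.mem_filter, Finset.mem_univ, true_and] at hl hmax
  refine ⟨l, T.isLeaf_iff.2 fun c hc hcl => ?_, hl⟩
  have h1 := T.depth_of_ne_root hc
  have h2 := hmax c (T.mem_path_of_parent (hcl ▸ hl))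
  rw [hcl] at h1
  omega

theorem eq_of_leaf_mem_path {l v : Fin T.size} (hl : T.children l = []) (h : l ∈ T.path v) :
    l = v := by
  by_contra hne
  obtain ⟨c, _, hc, hp⟩ := T.exists_child_of_mem_path h hne
  exact T.isLeaf_iff.1 hl c hc hp

end LabelledTree

/-! ### Common prefixes and the lexicographic order -/

theorem longestCommonPrefix_self_append (x y : List ℕ) :
    longestCommonPrefix (x ++ y) x = x := by
  induction x with
  | nil => cases y <;> rfl
  | cons a x ih => simp [longestCommonPrefix, ih]

theorem longestCommonPrefix_diverge {a b : ℕ} (hab : a ≠ b) (x y z : List ℕ) :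
    longestCommonPrefix (x ++ a :: y) (x ++ b :: z) = x := by
  induction x with
  | nil => simp [longestCommonPrefix, hab]
  | cons c x ih => simp [longestCommonPrefix, ih]

theorem List.append_lt_append_diverge {a b : ℕ} (hab : a ≠ b) (x y z : List ℕ) :
    x ++ a :: y < x ++ b :: z ↔ a < b := by
  induction x with
  | nil => simp [List.cons_lt_cons_iff, hab]
  | cons c x ih => simpa [List.cons_lt_cons_iff] using ih

theorem List.not_lt_of_prefix {x y : List ℕ} (h : x <+: y) : ¬ y < x := by
  obtain ⟨z, rfl⟩ := h
  induction x with
  | nil => simp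
  | cons c x ih => simpa [List.cons_lt_cons_iff] using ih

theorem List.lt_of_prefix {x y : List ℕ} (h : x <+: y) (hne : x ≠ y) : x < y := by
  rcases lt_trichotomy x y with h' | h' | h'
  · exact h'
  · exact absurd h' hne
  · exact absurd h' (List.not_lt_of_prefix h)

/-! ### Branching nodes are parents of marked nodes -/

namespace SuffixTree

variable {s : List ℕ} (T : SuffixTree s)

theorem label_eq_cons {v : Fin T.size} (hv : v ≠ T.root) :
    ∃ l, T.label v = T.letter v :: l := by
  have h := T.label_ne_nil v hv
  have hl := T.label_le v
  have h1 : T.start v < s.length ∧ T.len v ≠ 0 := by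
    constructor
    · by_contra hc
      exact h (by simp [LabelledTree.label, List.drop_eq_nil_of_le (not_lt.1 hc)])
    · intro hc
      exact h (by simp [LabelledTree.label, hc])
  obtain ⟨k, hk⟩ := Nat.exists_eq_succ_of_ne_zero h1.2
  refine ⟨(s.drop (T.start v + 1)).take k, ?_⟩
  rw [LabelledTree.label, hk, LabelledTree.letter, List.drop_eq_getElem_cons h1.1,
    List.getD_eq_getElem _ _ h1.1, List.take_succ_cons]

theorem start_lt {v : Fin T.size} (hv : v ≠ T.root) : T.start v < s.length := by
  have h := T.label_ne_nil v hv
  by_contra hc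
  exact h (by simp [LabelledTree.label, List.drop_eq_nil_of_le (not_lt.1 hc)])

theorem letter_ne {u v : Fin T.size} (hu : u ≠ T.root) (hv : v ≠ T.root)
    (hp : T.parent u = T.parent v) (huv : u ≠ v) : T.letter u ≠ T.letter v := by
  have := T.label_distinct (T.parent v) u ((T.mem_children _ _).2 ⟨hu, hp⟩) v
    ((T.mem_children _ _).2 ⟨hv, rfl⟩) huv
  obtain ⟨l, hl⟩ := T.label_eq_cons hu
  obtain ⟨l', hl'⟩ := T.label_eq_cons hv
  simpa [hl, hl'] using this

theorem str_length_lt {u v : Fin T.size} (h : u ∈ T.path v) (huv : u ≠ v) :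
    (T.str u).length < (T.str v).length := by
  obtain ⟨c, hc, hcr, rfl⟩ := T.exists_child_of_mem_path h huv
  have h1 := (T.str_prefix_of_mem_path hc).length_le
  rw [T.str_of_ne_root hcr, List.length_append] at h1
  have := List.length_pos_iff.2 (T.label_ne_nil c hcr)
  omega

theorem str_injOn_path {u u' v : Fin T.size} (h : u ∈ T.path v) (h' : u' ∈ T.path v)
    (he : T.str u = T.str u') : u = u' := by
  by_contra hne
  have key : u ∈ T.path u' ∨ u' ∈ T.path u := by
    rcases T.comparable_or_diverge u u' with h1 | h1 | ⟨c, c', hcc, hc, hc', hp, hcu, hcu'⟩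
    · exact .inl h1
    · exact .inr h1
    · exact absurd (T.eq_of_mem_path_of_parent_eq (T.mem_path_trans hcu h)
        (T.mem_path_trans hcu' h') hc hc' hp) hcc
  rcases key with h1 | h1
  · have := T.str_length_lt h1 hne
    rw [he] at this; omega
  · have := T.str_length_lt h1 (Ne.symm hne)
    rw [he] at this; omega

/-- This splits `str v` at the parent of `c` and exposes the next letter, the form in which the
lemmas on diverging strings apply. -/
theorem exists_str_eq {c v : Fin T.size} (hc : c ≠ T.root) (h : c ∈ T.path v) :
    ∃ l, T.str v = T.str (T.parent c) ++ T.letter c :: l := by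
  obtain ⟨l, hl⟩ := T.label_eq_cons hc
  obtain ⟨r, hr⟩ := T.str_prefix_of_mem_path h
  rw [T.str_of_ne_root hc, hl] at hr
  exact ⟨l ++ r, by simp [← hr]⟩

/-- Lengths increase strictly along a path, and incomparable nodes pass through distinct siblings,
whose letters differ. -/
theorem str_injective {x y : Fin T.size} (h : T.str x = T.str y) : x = y := by
  rcases T.comparable_or_diverge x y with h1 | h1 | ⟨c, c', hcc, hc, hc', hp, hcu, hcu'⟩
  · exact T.str_injOn_path h1 (T.self_mem_path y) h
  · exact T.str_injOn_path (T.self_mem_path x) h1 h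
  · obtain ⟨l, hl⟩ := T.exists_str_eq hc hcu
    obtain ⟨l', hl'⟩ := T.exists_str_eq hc' hcu'
    rw [hl, hl', hp] at h
    have := (List.cons.inj (List.append_cancel_left h)).1
    exact absurd this (T.letter_ne hc hc' hp hcc)

/-- `a` comes before `b` in the given direction (left: `false`, right: `true`). -/
def Before (dir : Bool) (a b : ℕ) : Prop := if dir then b < a else a < b

/-- The node has a sibling on its left (right) side. -/
def Marked (dir : Bool) (c : Fin T.size) : Prop :=
  c ≠ T.root ∧ ∃ c', c' ≠ T.root ∧ T.parent c' = T.parent c ∧ Before dir (T.letter c') (T.letter c)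

open Classical in
noncomputable instance (dir : Bool) : DecidablePred (T.Marked dir) := fun _ => propDecidable _

theorem not_before_self (dir : Bool) (a : ℕ) : ¬ Before dir a a := by
  cases dir <;> simp [Before]

/-- Compare `v` with the leaf `l` of the suffix. If their paths diverge, the siblings at the
divergence give the common prefix and the order. If `v` lies above `l`, then `str v` is a prefix of
the suffix, which is then not smaller, and the common prefix is `str v`: this is the extra disjunct
for `dir = true`. A leaf `l` on the path of `v` can only be `v` itself, and a string is neither
smaller nor greater than itself. Conversely, any leaf below the sibling (or below `v`) supplies the
suffix. -/
theorem exists_branching_iff (dir : Bool) (v u : Fin T.size) :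
    (∃ p, p < s.length ∧ (if dir then T.str v < s.drop p else s.drop p < T.str v) ∧
      longestCommonPrefix (s.drop p) (T.str v) = T.str u) ∧ u ∈ T.path v ↔
    (dir = true ∧ u = v ∧ T.children v ≠ []) ∨ ∃ c ∈ T.path v, T.Marked dir c ∧ T.parent c = u := by
  constructor
  · rintro ⟨⟨p, hp, hlt, hlcp⟩, hu⟩
    obtain ⟨l, hl, hlp⟩ := (T.leaves (s.drop p)).2 ⟨p, hp, rfl⟩
    rw [← hlp] at hlt hlcp
    rcases T.comparable_or_diverge l v with h1 | h1 | ⟨c, c', hcc, hc, hc', hpc, hcu, hcu'⟩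
    · have := T.eq_of_leaf_mem_path hl h1
      subst this
      exfalso
      revert hlt
      cases dir <;> simp
    · cases dir with
      | false => exact absurd (by simpa using hlt) (List.not_lt_of_prefix (T.str_prefix_of_mem_path h1))
      | true =>
        left
        obtain ⟨r, hr⟩ := T.str_prefix_of_mem_path h1
        rw [← hr, longestCommonPrefix_self_append] at hlcp
        refine ⟨rfl, (T.str_injective hlcp).symm, fun hv => ?_⟩
        have := T.eq_of_leaf_mem_path hv h1
        subst this
        simp at hlt
    · right
      obtain ⟨r, hr⟩ := T.exists_str_eq hc hcu
      obtain ⟨r', hr'⟩ := T.exists_str_eq hc' hcu'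
      have hne := T.letter_ne hc hc' hpc hcc
      rw [hr, hr', hpc, longestCommonPrefix_diverge hne] at hlcp
      rw [hr, hr', hpc, List.append_lt_append_diverge hne, List.append_lt_append_diverge hne.symm]
        at hlt
      exact ⟨c', hcu', ⟨hc', c, hc, hpc, hlt⟩, T.str_injective hlcp⟩
  · rintro (⟨rfl, rfl, hv⟩ | ⟨c, hc, ⟨hcr, c', hcr', hp, hlt⟩, rfl⟩)
    · obtain ⟨l, hl, hul⟩ := T.exists_leaf u
      obtain ⟨p, hp, hlp⟩ := (T.leaves (T.str l)).1 ⟨l, hl, rfl⟩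
      refine ⟨⟨p, hp, ?_, ?_⟩, T.self_mem_path u⟩
      · rw [← hlp]
        refine List.lt_of_prefix (T.str_prefix_of_mem_path hul) fun he => ?_
        exact hv (T.str_injective he ▸ hl)
      · obtain ⟨r, hr⟩ := T.str_prefix_of_mem_path hul
        rw [← hlp, ← hr, longestCommonPrefix_self_append]
    · obtain ⟨l, hl, hul⟩ := T.exists_leaf c'
      obtain ⟨p, hpl, hlp⟩ := (T.leaves (T.str l)).1 ⟨l, hl, rfl⟩
      obtain ⟨r, hr⟩ := T.exists_str_eq hcr hc
      obtain ⟨r', hr'⟩ := T.exists_str_eq hcr' hul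
      have hne : T.letter c' ≠ T.letter c := by
        intro h
        rw [h] at hlt
        exact not_before_self _ _ hlt
      refine ⟨⟨p, hpl, ?_, ?_⟩, T.parent_mem_path hc⟩
      · rw [← hlp, hr, hr', hp, List.append_lt_append_diverge hne,
          List.append_lt_append_diverge hne.symm]
        exact hlt
      · rw [← hlp, hr, hr', hp, longestCommonPrefix_diverge hne]

end SuffixTree

namespace LabelledTree

variable {s : List ℕ} (T : LabelledTree s)

theorem not_mem_path_parent {v : Fin T.size} (hv : v ≠ T.root) : v ∉ T.path (T.parent v) := by
  intro h
  have h1 := T.depth_le_of_mem_path h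
  have h2 := T.depth_of_ne_root hv
  omega

theorem exists_path_eq_cons (v : Fin T.size) : ∃ l, T.path v = v :: l ∧ v ∉ l := by
  by_cases hv : v = T.root
  · exact ⟨[], by simp [hv, T.path_root]⟩
  · exact ⟨_, T.path_of_ne_root hv, T.not_mem_path_parent hv⟩

theorem parent_ne_of_mem_path {c v : Fin T.size} (h : c ∈ T.path v) (hc : c ≠ T.root) :
    T.parent c ≠ v := by
  rintro rfl
  exact T.not_mem_path_parent hc h

-- A node has at most one child on a path, so the selected parents correspond one to one, in order,
-- to the children with property `P`. Going one node down the path adds `v` as a possible child and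
-- can only add `parent v`, which is the head of the remaining path.
open Classical in
theorem filter_path_exists_child (P : Fin T.size → Prop) (hP : ∀ c, P c → c ≠ T.root)
    (v : Fin T.size) :
    (T.path v).filter (fun u => ∃ c ∈ T.path v, P c ∧ T.parent c = u) =
      ((T.path v).filter fun c => P c).map T.parent := by
  induction v using T.induction_parent with
  | hroot =>
    have : ¬ P T.root := fun h => hP _ h rfl
    simp [T.path_root, this]
  | hstep v hv ih =>
    rw [T.path_of_ne_root hv]
    rw [List.filter_cons_of_neg]
    · obtain ⟨l, hl, hvl⟩ := T.exists_path_eq_cons (T.parent v)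
      -- The lowest node of a path has no child on that path, so the head of `path (parent v)` was
      -- not selected before `v` was added.
      have h0 : ¬ ∃ c ∈ T.path (T.parent v), P c ∧ T.parent c = T.parent v := by
        rintro ⟨c, hc, hPc, hcp⟩
        exact T.parent_ne_of_mem_path hc (hP c hPc) hcp
      have hrest : l.filter (fun u => ∃ c ∈ v :: T.path (T.parent v), P c ∧ T.parent c = u) =
          l.filter (fun u => ∃ c ∈ T.path (T.parent v), P c ∧ T.parent c = u) := by
        refine List.filter_congr fun u hu => ?_
        have hne : T.parent v ≠ u := by rintro rfl; exact hvl hu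
        simp [hne]
      rw [List.filter_cons]
      have ih' := ih
      conv at ih' => lhs; rw [hl]
      rw [List.filter_cons_of_neg (by simpa [hl] using h0), ← hl] at ih'
      conv_lhs => rw [hl]
      rw [List.filter_cons, ← hl, hrest, ih']
      by_cases hPv : P v
      · simp [hPv]
      · have h1 : ¬ ∃ c ∈ v :: T.path (T.parent v), P c ∧ T.parent c = T.parent v := by
          rintro ⟨c, hc, hPc, hcp⟩
          rcases List.mem_cons.1 hc with rfl | hc
          · exact hPv hPc
          · exact h0 ⟨c, hc, hPc, hcp⟩
        simp [hPv]
        intro x hx hx2 hx3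
        exact absurd ⟨x, hx, hx2, hx3⟩ h0
    · rw [decide_eq_true_eq]
      rintro ⟨c, hc, hPc, hcp⟩
      rw [← T.path_of_ne_root hv] at hc
      exact T.parent_ne_of_mem_path hc (hP c hPc) hcp

end LabelledTree

namespace SuffixTree

variable {s : List ℕ} (T : SuffixTree s)

/-- The nodes with a sibling on the given side on the path from the root to `v`. -/
noncomputable def markedPath (dir : Bool) (v : Fin T.size) : List (Fin T.size) :=
  ((T.path v).filter fun c => T.Marked dir c).reverse

theorem filter_isLeftBranching (v : Fin T.size) :
    (T.path v).filter (fun u => T.IsLeftBranching v u) =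
      (T.markedPath false v).reverse.map T.parent := by
  rw [markedPath, List.reverse_reverse]
  convert T.filter_path_exists_child (T.Marked false) (fun c h => h.1) v using 1
  refine List.filter_congr fun u _ => ?_
  rw [decide_eq_decide]
  have := T.exists_branching_iff false v u
  simp only [Bool.false_eq_true, if_false, false_and, false_or] at this
  rw [← this, IsLeftBranching, and_comm]

/-- If `v` is an inner node, it is the first right-branching node on its own path, so the answers
are shifted by one. -/
theorem filter_isRightBranching (v : Fin T.size) :
    (T.path v).filter (fun u => T.IsRightBranching v u) =
      (if T.children v = [] then [] else [v]) ++ (T.markedPath true v).reverse.map T.parent := by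
  classical
  rw [markedPath, List.reverse_reverse]
  have h1 := T.filter_path_exists_child (T.Marked true) (fun c h => h.1) v
  have h2 : (T.path v).filter (fun u => T.IsRightBranching v u) = (T.path v).filter (fun u =>
      (u = v ∧ T.children v ≠ []) ∨ ∃ c ∈ T.path v, T.Marked true c ∧ T.parent c = u) := by
    refine List.filter_congr fun u _ => ?_
    rw [decide_eq_decide]
    have := T.exists_branching_iff true v u
    simp only [if_true, true_and] at this
    rw [← this, IsRightBranching, and_comm]
  rw [h2]
  obtain ⟨l, hl, hvl⟩ := T.exists_path_eq_cons v
  have h0 : ¬ ∃ c ∈ T.path v, T.Marked true c ∧ T.parent c = v := by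
    rintro ⟨c, hc, hPc, hcp⟩
    exact T.parent_ne_of_mem_path hc hPc.1 hcp
  have hrest : l.filter (fun u => (u = v ∧ T.children v ≠ []) ∨
      ∃ c ∈ T.path v, T.Marked true c ∧ T.parent c = u) =
      l.filter (fun u => ∃ c ∈ T.path v, T.Marked true c ∧ T.parent c = u) := by
    refine List.filter_congr fun u hu => ?_
    have hne : u ≠ v := by rintro rfl; exact hvl hu
    simp [hne]
  have hall : ∀ q : Fin T.size → Bool, (T.path v).filter q = (v :: l).filter q := by
    intro q; rw [hl]
  have h1' : l.filter (fun u => ∃ c ∈ T.path v, T.Marked true c ∧ T.parent c = u) =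
      (T.path v).filter (fun u => ∃ c ∈ T.path v, T.Marked true c ∧ T.parent c = u) := by
    rw [hall, List.filter_cons_of_neg]
    simpa using h0
  have hd : (T.path v).filter (fun c => decide (T.Marked true c)) =
      (T.path v).filter (fun c => @decide (T.Marked true c) (Classical.propDecidable _)) :=
    List.filter_congr fun u _ => decide_eq_decide.2 Iff.rfl
  rw [hd, hall, List.filter_cons, hrest, h1', h1]
  by_cases hv : T.children v = []
  · rw [if_pos hv, if_neg, List.nil_append]
    rw [decide_eq_true_eq]
    rintro (h | h)
    · exact h.2 hv
    · exact h0 h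
  · rw [if_neg hv, if_pos (by rw [decide_eq_true_eq]; exact .inl ⟨rfl, hv⟩)]
    rfl

/-! ### A linear bound on the number of nodes -/

theorem card_leaves_le : (Finset.univ.filter fun v => T.children v = []).card ≤ s.length := by
  have h : ∀ v : Fin T.size, ∃ p, T.children v = [] → p < s.length ∧ T.str v = s.drop p := by
    intro v
    by_cases hv : T.children v = []
    · obtain ⟨p, hp⟩ := (T.leaves (T.str v)).1 ⟨v, hv, rfl⟩
      exact ⟨p, fun _ => hp⟩
    · exact ⟨0, fun h => absurd h hv⟩
  choose f hf using h
  rw [← Finset.card_range s.length]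
  refine Finset.card_le_card_of_injOn f ?_ ?_
  · intro v hv
    simp only [Finset.coe_filter, Finset.mem_univ, true_and, Set.mem_ofPred_eq] at hv
    simpa using (hf v hv).1
  · intro v hv u hu huv
    simp only [Finset.coe_filter, Finset.mem_univ, true_and, Set.mem_ofPred_eq] at hv hu
    exact T.str_injective (by rw [(hf v hv).2, (hf u hu).2, huv])

/-- Every node except the root is counted once, at its parent. -/
theorem sum_length_children : ∑ v, (T.children v).length + 1 = T.size := by
  have h1 : ∀ v, (T.children v).length =
      ((Finset.univ.erase T.root).filter fun c => T.parent c = v).card := by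
    intro v
    rw [← List.toFinset_card_of_nodup (T.nodup_children v)]
    congr 1
    ext c
    simp [T.mem_children]
  simp only [h1]
  rw [← Finset.card_eq_sum_card_fiberwise (fun _ _ => Finset.mem_univ _)]
  rw [Finset.card_erase_of_mem (Finset.mem_univ _), Finset.card_univ, Fintype.card_fin]
  have := T.root.pos
  omega

/-- A suffix tree has at most twice as many nodes as the string has letters. -/
theorem size_le : T.size ≤ 2 * s.length := by
  -- A leaf is charged 2 and the root 1, because the root may have a single child. Summation gives
  -- `2m ≤ (m - 1) + 2 * leaves + 1`.
  have h1 : ∀ v, 2 ≤ (T.children v).length + (2 * (if T.children v = [] then 1 else 0) +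
      if v = T.root then 1 else 0) := by
    intro v
    by_cases hv : T.children v = []
    · simp [hv]
    · by_cases hr : v = T.root
      · have := List.length_pos_iff.2 hv
        simp [hr] at *; omega
      · have := T.branching v hr hv
        omega
  have h2 := Finset.sum_le_sum (s := Finset.univ) fun v _ => h1 v
  rw [Finset.sum_add_distrib, Finset.sum_add_distrib, ← Finset.mul_sum] at h2
  have h3 := T.card_leaves_le
  rw [Finset.card_filter] at h3
  have h4 := T.sum_length_children
  simp only [Finset.sum_const, Finset.card_univ, Fintype.card_fin, smul_eq_mul,
    Finset.sum_ite_eq', Finset.mem_univ, if_true] at h2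
  omega

end SuffixTree

/-! ### The Euler tour of a tree -/

namespace LabelledTree

variable {s : List ℕ} (T : LabelledTree s)

/-- The child that follows `v` in the list of the children of its parent. -/
def followingSibling (v : Fin T.size) : Option (Fin T.size) :=
  (((T.children (T.parent v)).dropWhile fun u => u ≠ v).tail).head?

/-- The Euler tour enters (`false`) and leaves (`true`) the nodes; this is one step of it. -/
def tourStep (x : Fin T.size × Bool) : Fin T.size × Bool :=
  if x.2 then
    match T.followingSibling x.1 with
    | some c => (c, false)
    | none => (T.parent x.1, true)
  else
    match (T.children x.1).head? with
    | some c => (c, false)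
    | none => (x.1, true)

/-- The `k`-th event of the Euler tour. -/
def event (k : ℕ) : Fin T.size × Bool := T.tourStep^[k] (T.root, false)

theorem event_succ (k : ℕ) : T.event (k + 1) = T.tourStep (T.event k) :=
  Function.iterate_succ_apply' _ _ _

/-- The Euler tour of a subtree as a list, with a bound on the height. -/
def tour : ℕ → Fin T.size → List (Fin T.size × Bool)
  | 0, u => [(u, false), (u, true)]
  | f + 1, u => (u, false) :: ((T.children u).flatMap (tour f) ++ [(u, true)])

theorem head?_tour (f : ℕ) (u : Fin T.size) : (T.tour f u).head? = some (u, false) := by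
  cases f <;> simp [tour]

theorem getLast?_tour (f : ℕ) (u : Fin T.size) : (T.tour f u).getLast? = some (u, true) := by
  cases f
  · simp [tour]
  · rw [tour, ← List.cons_append, List.getLast?_append]; simp

theorem nextSibling_eq {c p : Fin T.size} {l l' : List (Fin T.size)}
    (h : T.children p = l ++ c :: l') : T.followingSibling c = l'.head? := by
  have hp : T.parent c = p := ((T.mem_children c p).1 (by simp [h])).2
  have hn := T.nodup_children p
  rw [h] at hn
  have hcl : ∀ u ∈ l, u ≠ c := by
    rintro u hu rfl
    exact (List.nodup_append.1 hn).2.2 u hu u (by simp) rfl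
  rw [followingSibling, hp, h, List.dropWhile_append_of_pos (by simpa using hcl)]
  simp

/-- The tour of a child ends with leaving it; the next step enters the following sibling or, after
the last child, leaves the parent. The prefix `l` holds the children already treated, which
identifies the following sibling. -/
theorem isChain_flatMap_tour (f : ℕ) (p : Fin T.size)
    (hf : ∀ c ∈ T.children p, (T.tour f c).IsChain fun a b => T.tourStep a = b)
    (l' : List (Fin T.size)) : ∀ l, T.children p = l ++ l' →
    (l'.flatMap (T.tour f) ++ [(p, true)]).IsChain fun a b => T.tourStep a = b := by
  induction l' with
  | nil => intro l _; simp
  | cons c l' ih =>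
    intro l h
    have hc : c ∈ T.children p := by simp [h]
    rw [List.flatMap_cons, List.append_assoc, List.isChain_append]
    refine ⟨hf c hc, ih (l ++ [c]) (by simp [h]), ?_⟩
    intro x hx y hy
    rw [T.getLast?_tour, Option.mem_some_iff] at hx
    subst hx
    have hn := T.nextSibling_eq h
    cases l' with
    | nil =>
      simp only [List.flatMap_nil, List.nil_append, List.head?_cons, Option.mem_some_iff] at hy
      subst hy
      simp [tourStep, hn, ((T.mem_children c p).1 hc).2]
    | cons c' l' =>
      rw [List.flatMap_cons, List.append_assoc, List.head?_append, T.head?_tour] at hy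
      simp only [Option.mem_some_iff, Option.some_or] at hy
      subst hy
      simp [tourStep, hn]

/-- A bound on the depths of the nodes. -/
def height : ℕ := Finset.univ.sup T.depth

theorem depth_le_height (v : Fin T.size) : T.depth v ≤ T.height :=
  Finset.le_sup (f := T.depth) (Finset.mem_univ v)

/-- The recursion bound `f` suffices as long as it reaches down to the height of the tree; when it
is exhausted, the node is a leaf. -/
theorem isChain_tour (f : ℕ) (u : Fin T.size) (hf : T.height ≤ T.depth u + f) :
    (T.tour f u).IsChain fun a b => T.tourStep a = b := by
  induction f generalizing u with
  | zero =>
    have : T.children u = [] := by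
      rw [T.isLeaf_iff]
      rintro c hc rfl
      have := T.depth_le_height c
      have := T.depth_of_ne_root hc
      omega
    simp [tour, tourStep, this]
  | succ f ih =>
    have hc : ∀ c ∈ T.children u, (T.tour f c).IsChain fun a b => T.tourStep a = b := by
      intro c hc
      obtain ⟨hcr, rfl⟩ := (T.mem_children _ _).1 hc
      exact ih c (by rw [T.depth_of_ne_root hcr]; omega)
    rw [tour, List.isChain_cons]
    refine ⟨?_, T.isChain_flatMap_tour f u hc _ [] rfl⟩
    intro y hy
    cases h : T.children u with
    | nil =>
      simp [h] at hy
      simp [tourStep, h, hy]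
    | cons c l =>
      rw [h, List.flatMap_cons, List.append_assoc, List.head?_append, T.head?_tour] at hy
      simp only [Option.mem_some_iff, Option.some_or] at hy
      simp [tourStep, h, hy]

theorem mem_tour (f : ℕ) (u : Fin T.size) (hf : T.height ≤ T.depth u + f) (v : Fin T.size)
    (b : Bool) : (v, b) ∈ T.tour f u ↔ u ∈ T.path v := by
  induction f generalizing u with
  | zero =>
    have h1 : (v, b) ∈ T.tour 0 u ↔ v = u := by cases b <;> simp [tour]
    rw [h1]
    refine ⟨fun h => h ▸ T.self_mem_path v, fun h => ?_⟩
    by_contra hne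
    have h2 := T.depth_le_of_mem_path h
    have h3 := T.depth_le_height v
    exact hne (h2.2 (by omega)).symm
  | succ f ih =>
    have h1 : (v, b) ∈ T.tour (f + 1) u ↔ v = u ∨ ∃ c ∈ T.children u, (v, b) ∈ T.tour f c := by
      cases b <;> simp [tour, or_comm]
    rw [h1]
    have h2 : ∀ c ∈ T.children u, ((v, b) ∈ T.tour f c ↔ c ∈ T.path v) := by
      intro c hc
      obtain ⟨hcr, rfl⟩ := (T.mem_children _ _).1 hc
      exact ih c (by rw [T.depth_of_ne_root hcr]; omega)
    constructor
    · rintro (rfl | ⟨c, hc, hv⟩)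
      · exact T.self_mem_path v
      · have := T.parent_mem_path ((h2 c hc).1 hv)
        rwa [((T.mem_children _ _).1 hc).2] at this
    · intro h
      by_cases hvu : u = v
      · exact .inl hvu.symm
      · obtain ⟨c, hc, hcr, hp⟩ := T.exists_child_of_mem_path h hvu
        have hcu := (T.mem_children c u).2 ⟨hcr, hp⟩
        exact .inr ⟨c, hcu, (h2 c hcu).2 hc⟩

theorem nodup_tour (f : ℕ) (u : Fin T.size) (hf : T.height ≤ T.depth u + f) :
    (T.tour f u).Nodup := by
  induction f generalizing u with
  | zero => simp [tour]
  | succ f ih =>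
    have hd : ∀ c ∈ T.children u, T.height ≤ T.depth c + f := by
      intro c hc
      obtain ⟨hcr, rfl⟩ := (T.mem_children _ _).1 hc
      rw [T.depth_of_ne_root hcr]; omega
    have hu : ∀ b, (u, b) ∉ (T.children u).flatMap (T.tour f) := by
      intro b hb
      obtain ⟨c, hc, hb⟩ := List.mem_flatMap.1 hb
      have h1 := T.depth_le_of_mem_path ((T.mem_tour f c (hd c hc) u b).1 hb)
      obtain ⟨hcr, rfl⟩ := (T.mem_children _ _).1 hc
      have := T.depth_of_ne_root hcr
      omega
    have h1 : ((T.children u).flatMap (T.tour f)).Nodup := by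
      rw [List.nodup_flatMap]
      refine ⟨fun c hc => ih c (hd c hc), ?_⟩
      refine (T.nodup_children u).imp_of_mem fun {c c'} hc hc' hne => ?_
      rintro ⟨v, b⟩ hv hv'
      have e1 := (T.mem_tour f c (hd c hc) v b).1 hv
      have e2 := (T.mem_tour f c' (hd c' hc') v b).1 hv'
      obtain ⟨hc, hp⟩ := (T.mem_children _ _).1 hc
      obtain ⟨hc', hp'⟩ := (T.mem_children _ _).1 hc'
      exact hne (T.eq_of_mem_path_of_parent_eq e1 e2 hc hc' (hp.trans hp'.symm))
    rw [tour, List.nodup_cons, List.nodup_append]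
    refine ⟨by simpa using hu false, h1, by simp, ?_⟩
    rintro a ha b hb rfl
    rw [List.mem_singleton] at hb
    exact hu true (hb ▸ ha)

/-- The Euler tour of the whole tree. -/
def fullTour : List (Fin T.size × Bool) := T.tour T.height T.root

theorem mem_fullTour (x : Fin T.size × Bool) : x ∈ T.fullTour :=
  (T.mem_tour _ _ (by omega) x.1 x.2).2 (T.root_mem_path _)

theorem nodup_fullTour : T.fullTour.Nodup := T.nodup_tour _ _ (by omega)

theorem length_fullTour : T.fullTour.length = 2 * T.size := by
  rw [← List.toFinset_card_of_nodup T.nodup_fullTour,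
    (Finset.eq_univ_iff_forall.2 fun x => List.mem_toFinset.2 (T.mem_fullTour x)),
    Finset.card_univ, Fintype.card_prod, Fintype.card_fin, Fintype.card_bool, mul_comm]

/-- The iteration of `tourStep` and the recursive list start alike and follow the same steps. This
transfers to `event` that every node is entered and left exactly once. -/
theorem getElem_fullTour (k : ℕ) (hk : k < T.fullTour.length) : T.fullTour[k] = T.event k := by
  induction k with
  | zero =>
    have := T.head?_tour T.height T.root
    rw [List.head?_eq_getElem?, List.getElem?_eq_some_iff] at this
    obtain ⟨_, h⟩ := this
    exact h
  | succ k ih =>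
    have := List.isChain_iff_getElem.1 (T.isChain_tour T.height T.root (by omega)) k hk
    rw [T.event_succ, ← ih (by omega)]
    exact this.symm

theorem event_injOn {k l : ℕ} (hk : k < 2 * T.size) (hl : l < 2 * T.size)
    (h : T.event k = T.event l) : k = l := by
  rw [← length_fullTour] at hk hl
  rw [← T.getElem_fullTour k hk, ← T.getElem_fullTour l hl] at h
  exact (List.Nodup.getElem_inj_iff T.nodup_fullTour).1 h

theorem exists_event_eq (x : Fin T.size × Bool) : ∃ k < 2 * T.size, T.event k = x := by
  obtain ⟨k, hk, h⟩ := List.getElem_of_mem (T.mem_fullTour x)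
  exact ⟨k, by rwa [length_fullTour] at hk, by rw [← h, T.getElem_fullTour k hk]⟩

end LabelledTree

/-! ### Random access to the past contents of a stack -/

/-- The contents (bottom first) of a stack at time `k`; in the unit of time that starts at `k`
the number `k` is pushed if `ev k = some false`, and a number is popped if `ev k = some true`. -/
def stackAt (ev : ℕ → Option Bool) : ℕ → List ℕ
  | 0 => []
  | k + 1 =>
    match ev k with
    | some false => stackAt ev k ++ [k]
    | some true => (stackAt ev k).dropLast
    | none => stackAt ev k

section stackAt

variable (ev : ℕ → Option Bool)

theorem stackAt_push {k : ℕ} (h : ev k = some false) :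
    stackAt ev (k + 1) = stackAt ev k ++ [k] := by simp [stackAt, h]

theorem stackAt_pop {k : ℕ} (h : ev k = some true) :
    stackAt ev (k + 1) = (stackAt ev k).dropLast := by simp [stackAt, h]

theorem stackAt_none {k : ℕ} (h : ev k = none) : stackAt ev (k + 1) = stackAt ev k := by
  simp [stackAt, h]

theorem lt_of_mem_stackAt {k t : ℕ} (h : t ∈ stackAt ev k) : t < k := by
  induction k with
  | zero => simp [stackAt] at h
  | succ k ih =>
    rcases hk : ev k with _ | _ | _
    · rw [stackAt_none ev hk] at h; have := ih h; omega
    · rw [stackAt_push ev hk, List.mem_append, List.mem_singleton] at h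
      rcases h with h | h
      · have := ih h; omega
      · omega
    · rw [stackAt_pop ev hk] at h
      have := ih (List.mem_of_mem_dropLast h); omega

theorem pairwise_stackAt (k : ℕ) : (stackAt ev k).Pairwise (· < ·) := by
  induction k with
  | zero => simp [stackAt]
  | succ k ih =>
    rcases hk : ev k with _ | _ | _
    · rwa [stackAt_none ev hk]
    · rw [stackAt_push ev hk, List.pairwise_append]
      refine ⟨ih, by simp, fun a ha b hb => ?_⟩
      rw [List.mem_singleton.1 hb]
      exact lt_of_mem_stackAt ev ha
    · rw [stackAt_pop ev hk]
      exact ih.sublist (List.dropLast_sublist _)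

theorem length_stackAt_succ (k : ℕ) :
    (stackAt ev (k + 1)).length ≤ (stackAt ev k).length + 1 ∧
      (stackAt ev k).length ≤ (stackAt ev (k + 1)).length + 1 := by
  rcases hk : ev k with _ | _ | _
  · rw [stackAt_none ev hk]; omega
  · rw [stackAt_push ev hk, List.length_append, List.length_singleton]; omega
  · rw [stackAt_pop ev hk, List.length_dropLast]; omega

/-- The height is a 1-Lipschitz function of time. This is what bounds the distances of all jumps. -/
theorem length_stackAt_add (k l : ℕ) :
    (stackAt ev (k + l)).length ≤ (stackAt ev k).length + l ∧
      (stackAt ev k).length ≤ (stackAt ev (k + l)).length + l := by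
  induction l with
  | zero => simp
  | succ l ih =>
    have := length_stackAt_succ ev (k + l)
    rw [← add_assoc]; omega

theorem length_stackAt_le (k : ℕ) : (stackAt ev k).length ≤ k := by
  have := length_stackAt_add ev 0 k
  simp only [zero_add] at this
  have h0 : (stackAt ev 0).length = 0 := rfl
  omega

theorem length_stackAt_sub {k l : ℕ} (h : k ≤ l) :
    (stackAt ev l).length ≤ (stackAt ev k).length + (l - k) ∧
      (stackAt ev k).length ≤ (stackAt ev l).length + (l - k) := by
  have := length_stackAt_add ev k (l - k)
  rwa [Nat.add_sub_cancel' h] at this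

/-- An element of the stack has been there, at the same height, since it was pushed. -/
theorem getElem?_stackAt_of_le {k j t : ℕ} (h : (stackAt ev k)[j]? = some t) {k' : ℕ}
    (h1 : t < k') (h2 : k' ≤ k) : (stackAt ev k')[j]? = some t := by
  induction k with
  | zero => simp [stackAt] at h
  | succ k ih =>
    rcases Nat.lt_or_ge k k' with hk' | hk'
    · rwa [show k' = k + 1 by omega]
    rcases hk : ev k with _ | _ | _
    · rw [stackAt_none ev hk] at h
      exact ih h hk'
    · rw [stackAt_push ev hk, List.getElem?_append] at h
      split_ifs at h with hj
      · exact ih h hk'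
      · have := List.mem_of_getElem? h
        rw [List.mem_singleton] at this
        omega
    · rw [stackAt_pop ev hk, List.getElem?_dropLast] at h
      split_ifs at h with hj
      exact ih h hk'

theorem lt_of_getElem?_stackAt {k j t : ℕ} (h : (stackAt ev k)[j]? = some t) : t < k :=
  lt_of_mem_stackAt ev (List.mem_of_getElem? h)

/-- At time `t + 1` the element `t` is already at height `j`, and only a push at time `t` can have
put it there. -/
theorem stackAt_of_getElem? {k j t : ℕ} (h : (stackAt ev k)[j]? = some t) :
    ev t = some false ∧ (stackAt ev t).length = j := by
  have h1 := getElem?_stackAt_of_le ev h (Nat.lt_succ_self t) (lt_of_getElem?_stackAt ev h)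
  rcases hk : ev t with _ | _ | _
  · rw [stackAt_none ev hk] at h1
    have := lt_of_getElem?_stackAt ev h1; omega
  · refine ⟨rfl, ?_⟩
    rw [stackAt_push ev hk, List.getElem?_append] at h1
    split_ifs at h1 with hj
    · have := lt_of_getElem?_stackAt ev h1; omega
    · have := (List.getElem?_eq_some_iff.1 h1).1
      simp at this
      omega
  · rw [stackAt_pop ev hk, List.getElem?_dropLast] at h1
    split_ifs at h1
    have := lt_of_getElem?_stackAt ev h1; omega

theorem length_stackAt_succ_of_getElem? {k j t : ℕ} (h : (stackAt ev k)[j]? = some t) :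
    (stackAt ev (t + 1)).length = j + 1 := by
  obtain ⟨h1, h2⟩ := stackAt_of_getElem? ev h
  rw [stackAt_push ev h1, List.length_append, h2]; rfl

/-- The stack is sorted by push time, so older elements are exactly the lower ones. -/
theorem getElem?_stackAt_lt_iff {k i j t u : ℕ} (hi : (stackAt ev k)[i]? = some t)
    (hj : (stackAt ev k)[j]? = some u) : t < u ↔ i < j := by
  obtain ⟨hi1, rfl⟩ := List.getElem?_eq_some_iff.1 hi
  obtain ⟨hj1, rfl⟩ := List.getElem?_eq_some_iff.1 hj
  have h := List.pairwise_iff_getElem.1 (pairwise_stackAt ev k)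
  constructor
  · intro hlt
    by_contra hij
    rcases (not_lt.1 hij).lt_or_eq with h' | h'
    · have := h j i hj1 hi1 h'; omega
    · subst h'; omega
  · exact h i j hi1 hj1

end stackAt

/-! ### Bit masks and selection -/

/-- The number of elements less than `b`. -/
def lowCount (b : ℕ) (l : List ℕ) : ℕ := (l.filter (· < b)).length

/-- The set of the elements that are at least `b`, relative to `b`, as a bit mask. -/
def highMask (b : ℕ) (l : List ℕ) : ℕ := ((l.filter (b ≤ ·)).map fun t => 2 ^ (t - b)).sum

theorem filter_append_filter {b : ℕ} {l : List ℕ} (h : l.Pairwise (· < ·)) :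
    l.filter (· < b) ++ l.filter (b ≤ ·) = l := by
  induction l with
  | nil => rfl
  | cons a l ih =>
    rw [List.pairwise_cons] at h
    by_cases ha : a < b
    · have : ¬ b ≤ a := by omega
      simp only [List.filter_cons, ha, this, decide_true, decide_false, if_true,
        Bool.false_eq_true, if_false, List.cons_append]
      rw [ih h.2]
    · have h1 : l.filter (· < b) = [] := by
        rw [List.filter_eq_nil_iff]
        intro c hc
        have := h.1 c hc
        simp; omega
      have h2 : l.filter (b ≤ ·) = l := by
        rw [List.filter_eq_self]
        intro c hc
        have := h.1 c hc
        simp; omega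
      have : b ≤ a := by omega
      simp [ha, this, h1, h2]

theorem lowCount_le_length (b : ℕ) (l : List ℕ) : lowCount b l ≤ l.length :=
  List.length_filter_le _ _

theorem lt_lowCount_iff {b : ℕ} {l : List ℕ} (h : l.Pairwise (· < ·)) {j t : ℕ}
    (hj : l[j]? = some t) : j < lowCount b l ↔ t < b := by
  rw [← filter_append_filter (b := b) h, List.getElem?_append] at hj
  split_ifs at hj with hlt
  · have := List.mem_of_getElem? hj
    rw [List.mem_filter] at this
    simpa [lowCount, hlt] using this.2
  · have := List.mem_of_getElem? hj
    rw [List.mem_filter] at this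
    have h2 : b ≤ t := by simpa using this.2
    have h3 : ¬ j < lowCount b l := hlt
    omega

/-- The position of the `r`-th one (counted from zero) in the binary expansion of `m`. -/
def bitSelect (m r : ℕ) : ℕ :=
  if h : m = 0 then 0
  else if m % 2 = 1 then
    if r = 0 then 0 else bitSelect (m / 2) (r - 1) + 1
  else bitSelect (m / 2) r + 1
termination_by m
decreasing_by all_goals omega

theorem bitSelect_le (m r : ℕ) : bitSelect m r ≤ m := by
  induction m using Nat.strongRecOn generalizing r with
  | _ m ih =>
    rw [bitSelect]
    split_ifs with h1 h2 h3
    · omega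
    · omega
    · have := ih (m / 2) (by omega) (r - 1); omega
    · have := ih (m / 2) (by omega) r; omega

/-- Halving an even mask lowers all its elements by one; if the lowest bit is set, it is element
number zero and is dropped. The induction runs over a bound `Q` on the elements, which decreases
with each halving. -/
theorem bitSelect_sum {l : List ℕ} (h : l.Pairwise (· < ·)) {r t : ℕ} (hr : l[r]? = some t) :
    bitSelect (l.map (2 ^ ·)).sum r = t := by
  obtain ⟨Q, hQ⟩ : ∃ Q, ∀ t ∈ l, t < Q := ⟨l.sum + 1, fun t ht => by
    have := List.le_sum_of_mem ht; omega⟩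
  induction Q generalizing l r t with
  | zero => exact absurd (hQ t (List.mem_of_getElem? hr)) (by omega)
  | succ Q ih =>
    have key : ∀ l : List ℕ, (∀ t ∈ l, 0 < t) →
        (l.map (2 ^ ·)).sum = 2 * ((l.map (· - 1)).map (2 ^ ·)).sum := by
      intro l hl
      induction l with
      | nil => simp
      | cons a l ih =>
        have ha := hl a (by simp)
        simp only [List.map_cons, List.sum_cons]
        rw [ih fun t ht => hl t (by simp [ht]), Nat.mul_add, ← pow_succ', Nat.sub_add_cancel ha]
    have hsort : ∀ l : List ℕ, (∀ t ∈ l, 0 < t) → l.Pairwise (· < ·) →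
        (l.map (· - 1)).Pairwise (· < ·) := by
      intro l hl hp
      rw [List.pairwise_map]
      refine hp.imp_of_mem fun {a b} ha hb hab => ?_
      have := hl a ha
      omega
    have hlt : ∀ l : List ℕ, (∀ t ∈ l, 0 < t) → (∀ t ∈ l, t < Q + 1) →
        ∀ t ∈ l.map (· - 1), t < Q := by
      intro l hl hq t ht
      obtain ⟨u, hu, rfl⟩ := List.mem_map.1 ht
      have := hl u hu; have := hq u hu; omega
    cases l with
    | nil => simp at hr
    | cons a l =>
      rw [List.pairwise_cons] at h
      have hl0 : ∀ u ∈ l, 0 < u := fun u hu => by have := h.1 u hu; omega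
      by_cases ha : a = 0
      · subst ha
        have e : ((0 :: l).map (2 ^ ·)).sum = 1 + 2 * ((l.map (· - 1)).map (2 ^ ·)).sum := by
          rw [List.map_cons, List.sum_cons, key l hl0, pow_zero]
        rw [e, bitSelect, dif_neg (by omega), if_pos (by omega)]
        cases r with
        | zero => simpa using hr
        | succ r =>
          rw [if_neg (by omega), show (1 + 2 * ((l.map (· - 1)).map (2 ^ ·)).sum) / 2 =
            ((l.map (· - 1)).map (2 ^ ·)).sum by omega, Nat.add_sub_cancel]
          rw [List.getElem?_cons_succ] at hr
          have h0 := hl0 t (List.mem_of_getElem? hr)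
          rw [ih (t := t - 1) (hsort l hl0 h.2) (by rw [List.getElem?_map, hr]; rfl)
            (hlt l hl0 fun u hu => hQ u (by simp [hu]))]
          omega
      · have hl0' : ∀ u ∈ a :: l, 0 < u := by
          intro u hu
          rcases List.mem_cons.1 hu with rfl | hu
          · omega
          · exact hl0 u hu
        have h0 := hl0' t (List.mem_of_getElem? hr)
        have hpos : 0 < (((a :: l).map (· - 1)).map (2 ^ ·)).sum := by
          simp only [List.map_cons, List.sum_cons]
          have := Nat.two_pow_pos (a - 1)
          omega
        rw [key _ hl0', bitSelect, dif_neg (by omega), if_neg (by omega),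
          Nat.mul_div_cancel_left _ two_pos,
          ih (t := t - 1) (hsort _ hl0' (List.pairwise_cons.2 h))
            (by rw [List.getElem?_map, hr]; rfl) (hlt _ hl0' hQ)]
        omega

theorem bitSelect_highMask {b : ℕ} {l : List ℕ} (h : l.Pairwise (· < ·)) {j t : ℕ}
    (hj : l[j]? = some t) (hlow : lowCount b l ≤ j) :
    b + bitSelect (highMask b l) (j - lowCount b l) = t := by
  have hj' := hj
  rw [← filter_append_filter (b := b) h, List.getElem?_append,
    if_neg (by simpa [lowCount] using hlow)] at hj'
  have hbt : b ≤ t := by simpa using (List.mem_filter.1 (List.mem_of_getElem? hj')).2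
  have e : highMask b l = (((l.filter (b ≤ ·)).map (· - b)).map (2 ^ ·)).sum := by
    rw [highMask, List.map_map]; rfl
  rw [e, bitSelect_sum (t := t - b)]
  · omega
  · rw [List.pairwise_map]
    refine (h.filter _).imp_of_mem fun {x y} hx hy hxy => ?_
    have h1 : b ≤ x := by simpa using (List.mem_filter.1 hx).2
    omega
  · rw [List.getElem?_map]
    change Option.map _ ((l.filter (b ≤ ·))[j - (l.filter (· < b)).length]?) = _
    rw [hj']; rfl

/-- The mask is a sum of distinct powers of two with exponents below `B`. -/
theorem highMask_lt {b B : ℕ} {l : List ℕ} (h : l.Pairwise (· < ·)) (hl : ∀ t ∈ l, t < b + B) :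
    highMask b l < 2 ^ B := by
  have h1 : highMask b l = ∑ t ∈ (l.filter (b ≤ ·)).toFinset, 2 ^ (t - b) := by
    rw [highMask, List.sum_toFinset _ ((h.filter _).imp fun h => ne_of_lt h)]
  have h2 : ∑ t ∈ (l.filter (b ≤ ·)).toFinset, 2 ^ (t - b) =
      ∑ i ∈ (l.filter (b ≤ ·)).toFinset.image (· - b), 2 ^ i := by
    rw [Finset.sum_image]
    intro x hx y hy hxy
    simp only [List.coe_toFinset, Set.mem_ofPred_eq, List.mem_filter, decide_eq_true_eq] at hx hy
    simp only at hxy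
    omega
  rw [h1, h2]
  refine lt_of_le_of_lt (Finset.sum_le_sum_of_subset (t := Finset.range B) ?_) ?_
  · intro i hi
    simp only [Finset.mem_image, List.mem_toFinset, List.mem_filter, decide_eq_true_eq] at hi
    obtain ⟨t, ⟨ht, hbt⟩, rfl⟩ := hi
    have := hl t ht
    simp; omega
  · exact Nat.geomSum_lt (m := 2) le_rfl (fun k hk => Finset.mem_range.1 hk)

theorem lowCount_append_singleton {b t : ℕ} (l : List ℕ) (h : b ≤ t) :
    lowCount b (l ++ [t]) = lowCount b l := by
  simp [lowCount, List.filter_append, h]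

theorem highMask_append_singleton {b t : ℕ} (l : List ℕ) (h : b ≤ t) :
    highMask b (l ++ [t]) = highMask b l + 2 ^ (t - b) := by
  simp [highMask, List.filter_append, h]

theorem lowCount_append_singleton_of_lt {b t : ℕ} (l : List ℕ) (h : t < b) :
    lowCount b (l ++ [t]) = lowCount b l + 1 := by
  simp [lowCount, List.filter_append, h]

theorem highMask_append_singleton_of_lt {b t : ℕ} (l : List ℕ) (h : t < b) :
    highMask b (l ++ [t]) = highMask b l := by
  simp [highMask, List.filter_append, h]

/-! ### Correctness of the jumps -/

section query

variable (ev : ℕ → Option Bool)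

/-- The number of elements that were on the stack at the start of the current block. -/
def blockLow (B t : ℕ) : ℕ := lowCount (t - t % B) (stackAt ev (t + 1))

/-- The times in the current block whose elements are on the stack. -/
def blockMask (B t : ℕ) : ℕ := highMask (t - t % B) (stackAt ev (t + 1))

/-- The height of the stack at the start of the `i`-th block. -/
def headLength (B i : ℕ) : ℕ := (stackAt ev (i * B)).length

theorem block_start (B t : ℕ) : t - t % B = t / B * B := by
  have := Nat.div_add_mod' t B
  omega

theorem add_bitSelect_blockMask {B t j τ : ℕ} (h : (stackAt ev (t + 1))[j]? = some τ)
    (hj : blockLow ev B t ≤ j) :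
    t - t % B + bitSelect (blockMask ev B t) (j - blockLow ev B t) = τ :=
  bitSelect_highMask (pairwise_stackAt ev _) h hj

/-- An element counted in `blockLow` is older than the block, hence it sat at the same height when
the block started. -/
theorem getElem?_head_of_lt {B t j τ : ℕ} (h : (stackAt ev (t + 1))[j]? = some τ)
    (hj : j < blockLow ev B t) : (stackAt ev (t / B * B))[j]? = some τ := by
  have h1 := (lt_lowCount_iff (pairwise_stackAt ev _) h).1 hj
  rw [block_start] at h1
  exact getElem?_stackAt_of_le ev h h1 (by have := Nat.div_mul_le_self t B; omega)

/-- The start of the block to which a long jump from the start of block `i` goes. -/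
def jumpBlock (i κ : ℕ) : ℕ := i / 2 ^ κ * 2 ^ κ

theorem jumpBlock_le (i κ : ℕ) : jumpBlock i κ ≤ i := Nat.div_mul_le_self _ _

theorem lt_jumpBlock_add (i κ : ℕ) : i < jumpBlock i κ + 2 ^ κ := by
  have := Nat.div_add_mod' i (2 ^ κ)
  have := Nat.mod_lt i (Nat.two_pow_pos κ)
  unfold jumpBlock
  omega

variable {B : ℕ} (hB : 0 < B) {i j τ q κ : ℕ} (h : (stackAt ev (i * B))[j]? = some τ)
  (hq : q = (headLength ev B i - 1 - j) / B) (hκ : κ = Nat.log 2 q)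
include hB h hq hκ

-- Rounding `i` down to a multiple of `2 ^ κ` loses fewer than `2 ^ κ ≤ q` blocks, and `q` blocks do
-- not exceed the distance from the top to `j`. For `q = 0` the level is 0 and there is no rounding.
omit hB h in
theorem jump_distance : i * B ≤ jumpBlock i κ * B + (headLength ev B i - 1 - j) := by
  by_cases hq0 : q = 0
  · have : κ = 0 := by rw [hκ, hq0]; simp
    subst this
    simp [jumpBlock]
  · have h1 : 2 ^ κ ≤ q := hκ ▸ Nat.pow_log_le_self 2 hq0
    have h2 := lt_jumpBlock_add i κ
    have h3 : i ≤ jumpBlock i κ + q := by omega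
    have h4 : q * B ≤ headLength ev B i - 1 - j := hq ▸ Nat.div_mul_le_self _ _
    calc i * B ≤ (jumpBlock i κ + q) * B := Nat.mul_le_mul_right _ h3
      _ = jumpBlock i κ * B + q * B := by ring
      _ ≤ _ := by omega

-- After the push of `τ` the height was `j + 1`, so reaching `headLength ev B i` took at least
-- `headLength ev B i - 1 - j` further time units. By `jump_distance` the jump does not go back
-- beyond that push.
omit hB in
theorem getElem?_jump : (stackAt ev (jumpBlock i κ * B))[j]? = some τ := by
  refine getElem?_stackAt_of_le ev h ?_ (Nat.mul_le_mul_right _ (jumpBlock_le i κ))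
  have h1 := jump_distance ev hq hκ
  have h2 := length_stackAt_succ_of_getElem? ev h
  have h3 := length_stackAt_sub ev (k := τ + 1) (lt_of_getElem?_stackAt ev h)
  have h4 : j < headLength ev B i := (List.getElem?_eq_some_iff.1 h).1
  unfold headLength at *
  have := lt_of_getElem?_stackAt ev h
  omega

/-- The distance was below `(q + 1) * B ≤ 2 ^ (κ + 1) * B` and grows by at most `(2 ^ κ - 1) * B` on
the way back; hence the factor 3. -/
theorem jump_index_lt :
    (headLength ev B (jumpBlock i κ) - 1 - j) / B < 3 * 2 ^ κ := by
  have h1 := length_stackAt_sub ev (Nat.mul_le_mul_right B (jumpBlock_le i κ))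
  have h2 := lt_jumpBlock_add i κ
  have h3 : i * B ≤ (jumpBlock i κ + (2 ^ κ - 1)) * B := Nat.mul_le_mul_right _ (by omega)
  rw [add_mul] at h3
  have h5 : headLength ev B i - 1 - j < (q + 1) * B := by
    rw [hq]; exact Nat.lt_mul_of_div_lt (Nat.lt_succ_self _) hB
  have h6 : q + 1 ≤ 2 ^ (κ + 1) := hκ ▸ Nat.lt_pow_succ_log_self one_lt_two q
  have h7 : (q + 1) * B ≤ 2 ^ (κ + 1) * B := Nat.mul_le_mul_right _ h6
  rw [Nat.div_lt_iff_lt_mul hB]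
  have h8 : 3 * 2 ^ κ * B = 2 ^ (κ + 1) * B + (2 ^ κ - 1) * B + B := by
    have := Nat.two_pow_pos κ
    rw [← Nat.add_mul, ← Nat.succ_mul]
    congr 1
    rw [pow_succ]; omega
  have h9 : j < headLength ev B i := (List.getElem?_eq_some_iff.1 h).1
  unfold headLength at *
  omega

/-- The element to which a long jump goes. -/
theorem jump_target {e x : ℕ} (he : e = (headLength ev B (jumpBlock i κ) - 1 - j) / B)
    (hx : (stackAt ev (jumpBlock i κ * B))[headLength ev B (jumpBlock i κ) - 1 - e * B]? = some x) :
    (stackAt ev (x + 1))[j]? = some τ ∧ (stackAt ev (x + 1)).length ≤ j + B := by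
  have h0 := getElem?_jump ev h hq hκ
  have h1 := length_stackAt_succ_of_getElem? ev hx
  have hj : j < headLength ev B (jumpBlock i κ) := (List.getElem?_eq_some_iff.1 h0).1
  have h2 : e * B ≤ headLength ev B (jumpBlock i κ) - 1 - j := he ▸ Nat.div_mul_le_self _ _
  have h3 : headLength ev B (jumpBlock i κ) - 1 - j < (e + 1) * B := by
    rw [he]; exact Nat.lt_mul_of_div_lt (Nat.lt_succ_self _) hB
  rw [add_mul, one_mul] at h3
  refine ⟨?_, by omega⟩
  refine getElem?_stackAt_of_le ev h0 ?_ (lt_of_getElem?_stackAt ev hx)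
  -- Were the sampled element `x` older than `τ`, it would lie below `j`; but `e` is rounded down,
  -- so its height is at least `j`.
  by_contra hlt
  have := (getElem?_stackAt_lt_iff ev hx h0).1 (by omega)
  omega

-- Going back to the block start adds fewer than `B` to a distance that is less than `B`; hence `2 *
-- B` stored elements suffice.
omit h hq hκ in
theorem near_index_lt {t : ℕ}
    (hlen : (stackAt ev (t + 1)).length ≤ j + B) (ht : ev t = some false) :
    headLength ev B (t / B) - 1 - j < 2 * B := by
  have h1 := length_stackAt_sub ev (Nat.div_mul_le_self t B)
  rw [stackAt_push ev ht, List.length_append] at hlen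
  have h2 := Nat.div_add_mod' t B
  have h3 := Nat.mod_lt t hB
  unfold headLength
  simp at hlen
  omega

end query

/-! ### The stack of marked nodes during the Euler tour -/

namespace SuffixTree

variable {s : List ℕ} (T : SuffixTree s) (dir : Bool)

/-- Marked nodes are pushed when they are entered and popped when they are left. -/
noncomputable def stackEvent (k : ℕ) : Option Bool :=
  if T.Marked dir (T.event k).1 then some (T.event k).2 else none

/-- The stack before the given event of the Euler tour. -/
noncomputable def pathBefore (x : Fin T.size × Bool) : List (Fin T.size) :=
  if x.2 then T.markedPath dir x.1
  else if x.1 = T.root then [] else T.markedPath dir (T.parent x.1)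

theorem not_marked_root : ¬ T.Marked dir T.root := fun h => h.1 rfl

theorem markedPath_root : T.markedPath dir T.root = [] := by
  simp [markedPath, T.path_root, T.not_marked_root]

theorem markedPath_of_ne_root {v : Fin T.size} (hv : v ≠ T.root) :
    T.markedPath dir v =
      T.markedPath dir (T.parent v) ++ if T.Marked dir v then [v] else [] := by
  rw [markedPath, T.path_of_ne_root hv, List.filter_cons]
  by_cases h : T.Marked dir v <;> simp [h, markedPath]

theorem markedPath_eq (v : Fin T.size) :
    T.markedPath dir v =
      T.pathBefore dir (v, false) ++ if T.Marked dir v then [v] else [] := by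
  by_cases hv : v = T.root
  · subst hv
    simp [pathBefore, markedPath_root, T.not_marked_root]
  · simp [pathBefore, hv, T.markedPath_of_ne_root dir hv]

theorem followingSibling_eq_some {u c : Fin T.size} (h : T.followingSibling u = some c) :
    c ≠ T.root ∧ T.parent c = T.parent u ∧ u ≠ T.root := by
  have h1 : c ∈ (T.children (T.parent u)).dropWhile fun x => x ≠ u :=
    List.mem_of_mem_tail (List.mem_of_mem_head? h)
  have h2 := (T.mem_children _ _).1 ((List.dropWhile_suffix _).subset h1)
  refine ⟨h2.1, h2.2, ?_⟩
  rintro rfl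
  have : (T.children (T.parent T.root)).dropWhile (fun x => x ≠ T.root) = [] := by
    rw [List.dropWhile_eq_nil_iff]
    intro x hx
    simpa using ((T.mem_children _ _).1 hx).1
  rw [this] at h1
  simp at h1

theorem pathBefore_tourStep_enter (u : Fin T.size) :
    T.pathBefore dir (T.tourStep (u, false)) = T.markedPath dir u := by
  simp only [LabelledTree.tourStep, Bool.false_eq_true, if_false]
  cases h : (T.children u).head? with
  | none => simp [pathBefore]
  | some c =>
    obtain ⟨hc, hp⟩ := (T.mem_children _ _).1 (List.mem_of_mem_head? h)
    simp [pathBefore, hc, hp]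

theorem pathBefore_tourStep_leave (u : Fin T.size) :
    T.pathBefore dir (T.tourStep (u, true)) = T.pathBefore dir (u, false) := by
  simp only [LabelledTree.tourStep, if_true]
  cases h : T.followingSibling u with
  | none =>
    by_cases hu : u = T.root
    · subst hu
      simp [pathBefore, T.parent_root, markedPath_root]
    · simp [pathBefore, hu]
  | some c =>
    obtain ⟨hc, hp, hu⟩ := T.followingSibling_eq_some h
    simp [pathBefore, hc, hp, hu]

/-- Induction over the tour: every step changes `pathBefore` exactly by the push or pop of the
current node. The root is never marked, which covers the idle steps after the tour. -/
theorem map_stackAt (k : ℕ) :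
    (stackAt (T.stackEvent dir) k).map (fun t => (T.event t).1) =
      T.pathBefore dir (T.event k) := by
  induction k with
  | zero => simp [stackAt, pathBefore, LabelledTree.event]
  | succ k ih =>
    rw [T.event_succ]
    rcases he : T.event k with ⟨u, b⟩
    rw [he] at ih
    by_cases hm : T.Marked dir u
    · cases b with
      | false =>
        rw [stackAt_push _ (by simp [stackEvent, he, hm]), List.map_append, ih,
          pathBefore_tourStep_enter, markedPath_eq]
        simp [hm, he]
      | true =>
        rw [stackAt_pop _ (by simp [stackEvent, he, hm]), List.map_dropLast, ih,
          pathBefore_tourStep_leave]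
        have : T.pathBefore dir (u, true) = T.markedPath dir u := rfl
        rw [this, markedPath_eq]
        simp [hm]
    · rw [stackAt_none _ (by simp [stackEvent, he, hm]), ih]
      cases b with
      | false => rw [pathBefore_tourStep_enter, markedPath_eq]; simp [hm]
      | true =>
        rw [pathBefore_tourStep_leave]
        have : T.pathBefore dir (u, true) = T.markedPath dir u := rfl
        rw [this, markedPath_eq]
        simp [hm]

theorem map_stackAt_succ {k : ℕ} {v : Fin T.size} (h : T.event k = (v, false)) :
    (stackAt (T.stackEvent dir) (k + 1)).map (fun t => (T.event t).1) = T.markedPath dir v := by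
  rw [map_stackAt, T.event_succ, h, pathBefore_tourStep_enter]

/-- The marked ancestors of the node that is entered at time `k`, counted from that node. -/
noncomputable def nthMarked (k d : ℕ) : Option ℕ :=
  if (stackAt (T.stackEvent dir) (k + 1)).length < d then none
  else (stackAt (T.stackEvent dir) (k + 1))[(stackAt (T.stackEvent dir) (k + 1)).length - d]?

theorem getElem?_reverse_markedPath {k : ℕ} {v : Fin T.size} (h : T.event k = (v, false)) {d : ℕ}
    (hd : 1 ≤ d) : ((T.markedPath dir v).reverse.map T.parent)[d - 1]? =
      (T.nthMarked dir k d).map fun t => T.parent (T.event t).1 := by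
  rw [← T.map_stackAt_succ dir h, List.getElem?_map, nthMarked]
  split_ifs with hlt
  · rw [List.getElem?_eq_none (by simp; omega)]; rfl
  · rw [List.getElem?_reverse (by simp; omega), List.getElem?_map, Option.map_map, List.length_map]
    rw [show (stackAt (T.stackEvent dir) (k + 1)).length - 1 - (d - 1) =
      (stackAt (T.stackEvent dir) (k + 1)).length - d by omega]
    rfl

theorem nthLeftBranching_eq {k : ℕ} {v : Fin T.size} (h : T.event k = (v, false)) {d : ℕ}
    (hd : 1 ≤ d) : T.nthLeftBranching v d =
      (T.nthMarked false k d).map fun t => T.parent (T.event t).1 := by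
  rw [nthLeftBranching, filter_isLeftBranching, T.getElem?_reverse_markedPath false h hd]

theorem nthRightBranching_eq_of_leaf {k : ℕ} {v : Fin T.size} (h : T.event k = (v, false))
    (hv : T.children v = []) {d : ℕ} (hd : 1 ≤ d) : T.nthRightBranching v d =
      (T.nthMarked true k d).map fun t => T.parent (T.event t).1 := by
  rw [nthRightBranching, filter_isRightBranching, if_pos hv, List.nil_append,
    T.getElem?_reverse_markedPath true h hd]

theorem nthRightBranching_one {v : Fin T.size} (hv : T.children v ≠ []) :
    T.nthRightBranching v 1 = some v := by
  rw [nthRightBranching, filter_isRightBranching, if_neg hv]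
  rfl

theorem nthRightBranching_eq {k : ℕ} {v : Fin T.size} (h : T.event k = (v, false))
    (hv : T.children v ≠ []) {d : ℕ} (hd : 2 ≤ d) : T.nthRightBranching v d =
      (T.nthMarked true k (d - 1)).map fun t => T.parent (T.event t).1 := by
  rw [nthRightBranching, filter_isRightBranching, if_neg hv,
    ← T.getElem?_reverse_markedPath true h (by omega : 1 ≤ d - 1)]
  obtain ⟨e, rfl⟩ : ∃ e, d = e + 2 := ⟨d - 2, by omega⟩
  rfl

end SuffixTree

/-! ### The input of the programs -/

namespace SuffixTree

open WordRAM

variable {s : List ℕ} (T : SuffixTree s)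

theorem length_encode : T.encode.length = 3 + s.length + 5 * T.size := by
  simp [encode]; ring

/-- The environment of a computation on a suffix tree. -/
def env (w X : ℕ) (hX : 0 < X) (h : 3 + s.length + 5 * T.size + 32 * X ≤ 2 ^ w) : Env where
  w := w
  base := 3 + s.length + 5 * T.size
  size := X
  inp := fun a => T.encode.getD a 0
  base_eq := rfl
  size_pos := hX
  le_pow := h

theorem initState_encode {w X : ℕ} {hX : 0 < X}
    {h : 3 + s.length + 5 * T.size + 32 * X ≤ 2 ^ w} :
    initState T.encode = (T.env w X hX h).toState ⟨fun _ => 0, fun _ _ => 0⟩ := by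
  refine congrArg (State.mk _) (funext fun a => ?_)
  by_cases ha : a < 3 + s.length + 5 * T.size
  · exact (if_pos ha).symm
  · exact (List.getD_eq_default _ _ (by rw [length_encode]; omega)).trans (if_neg ha).symm

/-- What a program reads in the input. -/
structure Input (E : Env) : Prop where
  base_eq : E.base = 3 + s.length + 5 * T.size
  length : E.inp 0 = s.length
  size : E.inp 1 = T.size
  root : E.inp 2 = T.root
  letter : ∀ v, v ≠ T.root → E.inp (3 + T.start v) = T.letter v
  parent : ∀ v : Fin T.size, E.inp (3 + s.length + v) = T.parent v
  child : ∀ v : Fin T.size, E.inp (3 + s.length + T.size + v) = T.pointer (T.children v).head?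
  sibling : ∀ v : Fin T.size, E.inp (3 + s.length + 2 * T.size + v) =
    T.pointer (T.followingSibling v)
  start : ∀ v : Fin T.size, E.inp (3 + s.length + 3 * T.size + v) = T.start v
  pos : 0 < s.length
  le_size : 200 * s.length ≤ E.size

theorem getD_ofFn {m : ℕ} (f : Fin m → ℕ) (l : List ℕ) (i : ℕ) (hi : i < m) :
    (List.ofFn f ++ l).getD i 0 = f ⟨i, hi⟩ := by
  rw [List.getD_append _ _ _ _ (by simpa using hi), List.getD_eq_getElem _ _ (by simpa using hi)]
  simp

theorem getD_append_length {l l' : List ℕ} {i m : ℕ} (h : l.length = m) :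
    (l ++ l').getD (m + i) 0 = l'.getD i 0 := by
  rw [List.getD_append_right _ _ _ _ (by omega), h, Nat.add_sub_cancel_left]

theorem input_env {w X : ℕ} {hX : 0 < X} {h : 3 + s.length + 5 * T.size + 32 * X ≤ 2 ^ w}
    (hs : 0 < s.length) (hle : 200 * s.length ≤ X) : T.Input (T.env w X hX h) where
  base_eq := rfl
  length := rfl
  size := rfl
  root := rfl
  letter := fun v hv => by
    have hlt := T.start_lt hv
    change T.encode.getD _ 0 = _
    simp only [encode, List.append_assoc]
    rw [getD_append_length (by rfl), List.getD_append _ _ _ _ hlt, LabelledTree.letter]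
  parent := fun v => by
    change T.encode.getD _ 0 = _
    simp only [encode, List.append_assoc, add_assoc]
    rw [getD_append_length (by rfl), getD_append_length rfl, getD_ofFn _ _ _ v.2]
  child := fun v => by
    change T.encode.getD _ 0 = _
    simp only [encode, List.append_assoc, add_assoc]
    rw [getD_append_length (by rfl), getD_append_length rfl, getD_append_length (by simp),
      getD_ofFn _ _ _ v.2]
  sibling := fun v => by
    change T.encode.getD _ 0 = _
    simp only [encode, List.append_assoc, add_assoc, two_mul]
    rw [getD_append_length (by rfl), getD_append_length rfl, getD_append_length (by simp),
      getD_append_length (by simp), getD_ofFn _ _ _ v.2]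
    rfl
  start := fun v => by
    change T.encode.getD _ 0 = _
    rw [show 3 + s.length + 3 * T.size + v =
      3 + (s.length + (T.size + (T.size + (T.size + v)))) by ring]
    simp only [encode, List.append_assoc]
    rw [getD_append_length (by rfl), getD_append_length rfl, getD_append_length (by simp),
      getD_append_length (by simp), getD_append_length (by simp), getD_ofFn _ _ _ v.2]
  pos := hs
  le_size := hle

theorem Input.bounds {E : Env} (h : T.Input E) :
    0 < s.length ∧ T.size ≤ 2 * s.length ∧ 200 * s.length ≤ E.size ∧
      E.base = 3 + s.length + 5 * T.size ∧ E.base + 32 * E.size ≤ E.cap :=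
  ⟨h.pos, T.size_le, h.le_size, h.base_eq, E.le_pow⟩

end SuffixTree

namespace WordRAM

open HExpr HProg

/-! ### Expressions that read the input -/

namespace HExpr

def length : HExpr := inp 0
def nodes : HExpr := inp 1
def root : HExpr := inp 2
def parent (v : HExpr) : HExpr := inp (3 + length + v)
def child (v : HExpr) : HExpr := inp (3 + length + nodes + v)
def sibling (v : HExpr) : HExpr := inp (3 + length + 2 * nodes + v)
def letter (v : HExpr) : HExpr := inp (3 + inp (3 + length + 3 * nodes + v))
def before (dir : Bool) (a b : HExpr) : HExpr := if dir then op .lt b a else op .lt a b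

section

variable {s : List ℕ} {T : SuffixTree s} {E : Env} (h : T.Input E) {σ : HState} {e : HExpr}
  {v : Fin T.size}
include h

theorem val_length : length.val E σ = s.length := h.length
theorem ok_length : length.Ok E σ := by
  have := h.bounds; have : 0 < E.cap := by omega
  exact ⟨this, by change 0 < E.base; omega⟩
theorem val_nodes : nodes.val E σ = T.size := h.size
theorem ok_nodes : nodes.Ok E σ := by
  have := h.bounds; have : 1 < E.cap := by omega
  exact ⟨this, by change 1 < E.base; omega⟩
theorem val_root : root.val E σ = T.root := h.root
theorem ok_root : root.Ok E σ := by
  have := h.bounds; have : 2 < E.cap := by omega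
  exact ⟨this, by change 2 < E.base; omega⟩

theorem val_parent (he : e.val E σ = v) : (parent e).val E σ = T.parent v := by
  simp [parent, val_length h, he, h.parent]

theorem ok_parent (he : e.val E σ = v) (ho : e.Ok E σ) : (parent e).Ok E σ := by
  have := h.bounds; have := v.2
  simp [parent, val_length h, ok_length h, he, ho]
  omega

theorem val_child (he : e.val E σ = v) :
    (child e).val E σ = T.pointer (T.children v).head? := by
  simp [child, val_length h, val_nodes h, he, h.child]

theorem ok_child (he : e.val E σ = v) (ho : e.Ok E σ) : (child e).Ok E σ := by
  have := h.bounds; have := v.2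
  simp [child, val_length h, ok_length h, val_nodes h, ok_nodes h, he, ho]
  omega

theorem val_sibling (he : e.val E σ = v) :
    (sibling e).val E σ = T.pointer (T.followingSibling v) := by
  simp [sibling, val_length h, val_nodes h, he, h.sibling]

theorem ok_sibling (he : e.val E σ = v) (ho : e.Ok E σ) : (sibling e).Ok E σ := by
  have := h.bounds; have := v.2
  simp [sibling, val_length h, ok_length h, val_nodes h, ok_nodes h, he, ho]
  omega

theorem val_letter (he : e.val E σ = v) (hv : v ≠ T.root) :
    (letter e).val E σ = T.letter v := by
  simp [letter, val_length h, val_nodes h, he, h.start, h.letter v hv]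

theorem ok_letter (he : e.val E σ = v) (ho : e.Ok E σ) (hv : v ≠ T.root) :
    (letter e).Ok E σ := by
  have := h.bounds; have := v.2; have := T.start_lt hv
  simp [letter, val_length h, ok_length h, val_nodes h, ok_nodes h, he, ho, h.start]
  omega

end

theorem val_before_ne_zero {E : Env} {σ : HState} {dir : Bool} {a b : HExpr} :
    (before dir a b).val E σ ≠ 0 ↔ SuffixTree.Before dir (a.val E σ) (b.val E σ) := by
  cases dir <;> simp [before, SuffixTree.Before]

theorem ok_before {E : Env} {σ : HState} {dir : Bool} {a b : HExpr} (ha : a.Ok E σ)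
    (hb : b.Ok E σ) : (before dir a b).Ok E σ := by
  cases dir <;> simp [before, ha, hb]

end HExpr

end WordRAM

namespace WordRAM

open HExpr HProg

infixr:60 " ⨾ " => HProg.seq

/-! ### The parameters and the lookup tables -/

/-- The number of events in a block. -/
def blockSize (n : ℕ) : ℕ := Nat.log 4 n + 1

theorem blockSize_pos (n : ℕ) : 0 < blockSize n := Nat.succ_pos _

theorem lt_pow_blockSize (n : ℕ) : n < 4 ^ blockSize n := Nat.lt_pow_succ_log_self (by norm_num) n

theorem blockSize_le {n : ℕ} (hn : 0 < n) : blockSize n ≤ n := by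
  have h1 : 4 ^ Nat.log 4 n ≤ n := Nat.pow_log_le_self 4 hn.ne'
  have h2 : Nat.log 4 n < 4 ^ Nat.log 4 n := Nat.lt_pow_self (by norm_num)
  unfold blockSize
  omega

/-- The logarithm has base 4, so `2 ^ B` is only of the order of the square root of `n`, which
leaves room for the factor `B`. -/
theorem blockSize_mul_two_pow_le {n : ℕ} (hn : 0 < n) : blockSize n * 2 ^ blockSize n ≤ 2 * n := by
  have h1 : 4 ^ Nat.log 4 n ≤ n := Nat.pow_log_le_self 4 hn.ne'
  have h2 : Nat.log 4 n + 1 ≤ 2 ^ Nat.log 4 n := Nat.lt_two_pow_self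
  unfold blockSize
  calc (Nat.log 4 n + 1) * 2 ^ (Nat.log 4 n + 1)
      ≤ 2 ^ Nat.log 4 n * 2 ^ (Nat.log 4 n + 1) := Nat.mul_le_mul_right _ h2
    _ = 2 * 4 ^ Nat.log 4 n := by
      rw [pow_succ, show (4 : ℕ) = 2 * 2 by norm_num, mul_pow]; ring
    _ ≤ 2 * n := by omega

/-- A bound on the number of blocks of the Euler tour of a tree with `m` nodes. -/
def blockCount (n m : ℕ) : ℕ := 2 * m / blockSize n + 1

theorem blockCount_le (n m : ℕ) : blockCount n m ≤ 2 * m + 1 :=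
  Nat.succ_le_succ (Nat.div_le_self _ _)

/-- The memory reserved for the long jumps of a fixed level. -/
def jumpSize (n m : ℕ) : ℕ := 6 * blockCount n m + 1

/-- Conventions for one direction, with array offset `o`. Arrays: `o` extreme children, `o + 1`
selection table, `o + 2` logarithms, `o + 3` stack; `o + 4` entry time by node; by event time, `o +
5` stack height, `o + 6` low count, `o + 7` mask, `o + 8` node; for block starts, `o + 9` height, `o
+ 10` top elements, `o + 11` samples; `o + 12` the block size and the jump size. Preprocessing
registers: 0 node, 1 mode, 2 time, 3 height, 4 low count, 5 mask, 6 block size, 7 number of blocks,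
12 jump size; the others are scratch. -/
def params (o : ℕ) : HProg :=
  (.assign 6 1 ⨾ .assign 9 1) ⨾
  .loop (.op .lt (reg 9 * 4) (length + 1)) (.assign 9 (reg 9 * 4) ⨾ .assign 6 (reg 6 + 1)) ⨾
  .assign 7 (2 * nodes / reg 6 + 1) ⨾ .assign 12 (6 * reg 7 + 1) ⨾
  .store (o + 12) 0 (reg 6) ⨾ .store (o + 12) 1 (reg 12)

variable {s : List ℕ} {T : SuffixTree s} {E : Env} (hI : T.Input E) {o : ℕ} (ho : o ≤ 16)
  (dir : Bool)
include hI

theorem triple_params (ho : o ≤ 16) (σ : HState) :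
    Triple E (params o) σ (400 * s.length) fun τ =>
      τ.reg 6 = blockSize s.length ∧ τ.reg 7 = blockCount s.length T.size ∧
      τ.reg 12 = jumpSize s.length T.size ∧ τ.arr (o + 12) 0 = blockSize s.length ∧
      τ.arr (o + 12) 1 = jumpSize s.length T.size := by
  have hb := hI.bounds
  have vL := fun σ => val_length hI (σ := σ)
  have oL := fun σ => ok_length hI (σ := σ)
  have vN := fun σ => val_nodes hI (σ := σ)
  have oN := fun σ => ok_nodes hI (σ := σ)
  have hlog : Nat.log 4 s.length + 1 ≤ s.length := blockSize_le hI.pos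
  refine ((triple_of_wp (Q := fun τ => τ.reg 6 = 1 ∧ τ.reg 9 = 1) ?_).seq fun τ _ hτ =>
    -- Register 9 runs through the powers of 4; the test against `length + 1` expresses that the
    -- next power is still at most `n`.
    (triple_loop_const (Nat.log 4 s.length) 20
      (fun k τ => τ.reg 6 = k + 1 ∧ τ.reg 9 = 4 ^ k) ?_ ?_ ?_).seq fun ρ _ hρ =>
    triple_of_wp ?_).mono (u := 400 * s.length) ?_ fun _ _ => id
  · simp [wp]; omega
  · rintro k hk τ _ ⟨h6, h9⟩
    have h4 : 4 ^ k * 4 ≤ s.length := by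
      rw [← pow_succ]
      exact (Nat.pow_le_pow_right (by norm_num) hk).trans (Nat.pow_log_le_self 4 hI.pos.ne')
    refine ⟨?_, ?_, triple_of_wp_le (Nat.le_of_ble_eq_true rfl) ?_⟩
    · simp [vL, oL, h9]; omega
    · simp [vL, h9]; omega
    · simp [wp, h6, h9, pow_succ]; omega
  · rintro τ _ ⟨h6, h9⟩
    have h4 : s.length < 4 ^ Nat.log 4 s.length * 4 := by
      rw [← pow_succ]; exact Nat.lt_pow_succ_log_self (by norm_num) _
    have h5 : 4 ^ Nat.log 4 s.length ≤ s.length := Nat.pow_log_le_self 4 hI.pos.ne'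
    simp [vL, oL, h9]; omega
  · simpa using hτ
  · have h1 := blockCount_le s.length T.size
    have h2 : 2 * T.size / (Nat.log 4 s.length + 1) ≤ 2 * T.size := Nat.div_le_self _ _
    simp [wp, vN, oN, hρ.1, blockSize, blockCount, jumpSize]
    omega
  · have e1 : (HProg.assign 6 1 ⨾ .assign 9 1).time ≤ 10 := Nat.le_of_ble_eq_true rfl
    have e2 : (op .lt (reg 9 * 4) (length + 1)).cost ≤ 10 := Nat.le_of_ble_eq_true rfl
    have e3 : (HProg.assign 7 (2 * nodes / reg 6 + 1) ⨾ .assign 12 (6 * reg 7 + 1) ⨾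
      .store (o + 12) 0 (reg 6) ⨾ .store (o + 12) 1 (reg 12)).time ≤ 100 :=
      Nat.le_of_ble_eq_true rfl
    have e4 : (Nat.log 4 s.length + 1) * ((op .lt (reg 9 * 4) (length + 1)).cost + 1 + 20) ≤
      s.length * 31 := Nat.mul_le_mul hlog (by omega)
    omega

omit hI in
theorem log_two_eq (x : ℕ) (hx : 2 ≤ x) : Nat.log 2 x = Nat.log 2 (x / 2) + 1 :=
  Nat.log_of_one_lt_of_le one_lt_two hx

/-- Tabulates the logarithm. -/
def logTable (o : ℕ) : HProg :=
  .assign 11 0 ⨾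
  .loop (.op .lt (reg 11) (reg 7))
    ((.ite (.op .lt (reg 11) 2) (.store (o + 2) (reg 11) 0)
      (.store (o + 2) (reg 11) (arr (o + 2) (reg 11 / 2) + 1))) ⨾
    .assign 11 (reg 11 + 1))

/-- Entry `x` is one more than entry `x / 2`, which is already present. Entries 0 and 1 are zero, in
accordance with `Nat.log 2 0 = 0`; queries rely on this for `q = 0`. -/
theorem triple_logTable (ho : o ≤ 16) (σ : HState) (h7 : σ.reg 7 = blockCount s.length T.size) :
    Triple E (logTable o) σ (600 * s.length) fun τ =>
      ∀ x < blockCount s.length T.size, τ.arr (o + 2) x = Nat.log 2 x := by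
  have hb := hI.bounds
  have hH := blockCount_le s.length T.size
  refine ((triple_of_wp (Q := fun τ => τ.reg 11 = 0) ?_).seq fun τ hf hτ =>
    triple_loop_const (blockCount s.length T.size) 80
      (fun k τ => τ.reg 11 = k ∧ ∀ x < k, τ.arr (o + 2) x = Nat.log 2 x) ?_ ?_ ?_).mono ?_
      fun _ _ h => h.2
  · simp [wp]; omega
  · rintro k hk ρ hf' ⟨h11, hx⟩
    have r7 : ρ.reg 7 = blockCount s.length T.size := by
      rw [hf'.1 7 (by simp [regs]), hf.1 7 (by simp [regs]), h7]
    refine ⟨by simp, by simp [h11, r7, hk], triple_of_wp_le (Nat.le_of_ble_eq_true rfl) ?_⟩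
    have hfin : ∀ v, v = Nat.log 2 k → ∀ x < k + 1,
        (if x = k then v else ρ.arr (o + 2) x) = Nat.log 2 x := by
      intro v hv x hxk
      split_ifs with h
      · rw [hv, h]
      · exact hx x (by omega)
    have hlogk := Nat.log_le_self 2 (k / 2)
    simp only [wp, ok_lt, ok_reg, ok_ofNat, val_lt, val_reg, val_ofNat, h11, ok_add, ok_arr, ok_div,
      val_div, val_arr, val_add, HState.setReg_reg, HState.setArr_reg, HState.setReg_arr,
      HState.setArr_arr, true_and, if_true]
    refine ⟨by omega, fun h => ?_, fun h => ?_⟩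
    · have hk2 : k < 2 := by by_contra h'; simp [h'] at h
      refine ⟨by omega, by omega, by omega, by omega,
        hfin 0 (by interval_cases k <;> simp)⟩
    · have hk2 : 2 ≤ k := by by_contra h'; simp [show k < 2 by omega] at h
      rw [hx (k / 2) (by omega)]
      exact ⟨by omega, ⟨⟨by omega, by omega, by omega⟩, by omega, by omega⟩, by omega, by omega,
        hfin _ (log_two_eq k hk2).symm⟩
  · rintro ρ hf' ⟨h11, hx⟩
    have r7 : ρ.reg 7 = blockCount s.length T.size := by
      rw [hf'.1 7 (by simp [regs]), hf.1 7 (by simp [regs]), h7]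
    simp [h11, r7]
  · exact ⟨hτ, fun x hx => absurd hx (Nat.not_lt_zero x)⟩
  · have e1 : (HProg.assign 11 0).time ≤ 10 := Nat.le_of_ble_eq_true rfl
    have e2 : (op .lt (reg 11) (reg 7)).cost ≤ 3 := Nat.le_of_ble_eq_true rfl
    have e4 : (blockCount s.length T.size + 1) * ((op .lt (reg 11) (reg 7)).cost + 1 + 80) ≤
      (6 * s.length) * 84 := Nat.mul_le_mul (by omega) (by omega)
    omega

omit hI in
theorem bitSelect_zero (r : ℕ) : bitSelect 0 r = 0 := by rw [bitSelect]; simp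

omit hI in
theorem bitSelect_odd_zero {m : ℕ} (hm : m % 2 = 1) : bitSelect m 0 = 0 := by
  rw [bitSelect, dif_neg (by omega), if_pos hm, if_pos rfl]

omit hI in
theorem bitSelect_odd {m r : ℕ} (hm : m % 2 = 1) (hr : r ≠ 0) :
    bitSelect m r = bitSelect (m / 2) (r - 1) + 1 := by
  rw [bitSelect, dif_neg (by omega), if_pos hm, if_neg hr]

omit hI in
theorem bitSelect_even {m r : ℕ} (h0 : m ≠ 0) (hm : m % 2 ≠ 1) :
    bitSelect m r = bitSelect (m / 2) r + 1 := by
  rw [bitSelect, dif_neg h0, if_neg hm]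

/-- Tabulates `bitSelect`. -/
def selectTable (o : ℕ) : HProg :=
  .assign 11 0 ⨾
  .loop (.op .lt (reg 11) (.op .shl (reg 6) (reg 6)))
    ((.assign 13 (reg 11 / reg 6) ⨾ .assign 14 (reg 11 % reg 6) ⨾
      .ite (.op .eq (reg 13) 0) (.store (o + 1) (reg 11) 0)
        (.ite (.op .eq (reg 13 % 2) 1)
          (.ite (.op .eq (reg 14) 0) (.store (o + 1) (reg 11) 0)
            (.store (o + 1) (reg 11) (arr (o + 1) (reg 13 / 2 * reg 6 + (reg 14 - 1)) + 1)))
          (.store (o + 1) (reg 11) (arr (o + 1) (reg 13 / 2 * reg 6 + reg 14) + 1)))) ⨾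
    .assign 11 (reg 11 + 1))

/-- The pair `(m, r)` with `r < B` has index `m * B + r`. The recursion of `bitSelect` passes from a
nonzero `m` to `m / 2` without increasing `r`, so it reads an earlier entry. -/
theorem triple_selectTable (ho : o ≤ 16) (σ : HState) (h6 : σ.reg 6 = blockSize s.length) :
    Triple E (selectTable o) σ (1000 * s.length) fun τ =>
      ∀ y < blockSize s.length * 2 ^ blockSize s.length, τ.arr (o + 1) y =
        bitSelect (y / blockSize s.length) (y % blockSize s.length) := by
  have hb := hI.bounds
  have hB := blockSize_mul_two_pow_le hI.pos
  have hB0 := blockSize_pos s.length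
  have hBn := blockSize_le hI.pos
  generalize blockSize s.length = B at *
  refine ((triple_of_wp (Q := fun τ => τ.reg 11 = 0) ?_).seq fun τ hf hτ =>
    triple_loop_const (B * 2 ^ B) 200 (fun k τ => τ.reg 11 = k ∧
      ∀ y < k, τ.arr (o + 1) y = bitSelect (y / B) (y % B)) ?_ ?_ ?_).mono ?_ fun _ _ h => h.2
  · simp [wp]; omega
  · rintro k hk ρ hf' ⟨h11, hx⟩
    have r6 : ρ.reg 6 = B := by
      rw [hf'.1 6 (by simp [regs]), hf.1 6 (by simp [regs]), h6]
    refine ⟨by simp [r6]; omega, by simp [h11, r6, hk],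
      triple_of_wp_le (Nat.le_of_ble_eq_true rfl) ?_⟩
    have hfin : ∀ v, v = bitSelect (k / B) (k % B) → ∀ x < k + 1,
        (if x = k then v else ρ.arr (o + 1) x) = bitSelect (x / B) (x % B) := by
      intro v hv x hxk
      split_ifs with h
      · rw [hv, h]
      · exact hx x (by omega)
    have hr := Nat.mod_lt k hB0
    have hkB := Nat.div_add_mod' k B
    have hkB' : k / B ≤ k := Nat.div_le_self _ _
    generalize hq : k / B = q at *
    generalize hr' : k % B = r₀ at *
    have hidx : ∀ r < B, q ≠ 0 → (q / 2 * B + r < k + B ∧ q / 2 * B ≤ k) ∧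
        (q / 2 * B + r < k →
          ρ.arr (o + 1) (q / 2 * B + r) = bitSelect (q / 2) r) := by
      intro r hrB h0
      have h1 : q / 2 * B ≤ q * B := Nat.mul_le_mul_right _ (by omega)
      refine ⟨⟨by omega, by omega⟩, fun hlt => ?_⟩
      rw [hx _ hlt, Nat.add_comm, Nat.add_mul_div_right _ _ hB0, Nat.add_mul_mod_self_right,
        Nat.div_eq_of_lt hrB, Nat.mod_eq_of_lt hrB, Nat.zero_add]
    simp only [wp, ok_eq, ok_reg, ok_ofNat, val_eq, val_reg, val_ofNat, ok_add,
      ok_arr, ok_div, ok_mod, ok_mul, ok_sub, val_div, val_mod, val_mul, val_sub, val_arr, val_add,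
      HState.setReg_reg, HState.setArr_reg, HState.setReg_arr,
      HState.setArr_arr, true_and, if_true, Nat.reduceEqDiff, if_false, h11, r6, hq, hr',
      ite_eq_right_iff, one_ne_zero, imp_false, not_not, ne_eq]
    refine ⟨by omega, fun h0 => ?_, fun h0 => ⟨by omega, fun h1 =>
      ⟨by omega, fun h2 => ?_, fun h2 => ?_⟩, fun h1 => ?_⟩⟩
    · exact ⟨by omega, by omega, by omega, by omega,
        hfin _ (by rw [h0, bitSelect_zero])⟩
    · exact ⟨by omega, by omega, by omega, by omega,
        hfin _ (by rw [h2, bitSelect_odd_zero h1])⟩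
    · have h3 : q / 2 * B + (r₀ - 1) < k := by
        have : q / 2 * B ≤ q * B := Nat.mul_le_mul_right _ (by omega)
        omega
      have h4 := (hidx (r₀ - 1) (by omega) h0).2 h3
      have h5 := bitSelect_le (q / 2) (r₀ - 1)
      rw [h4]
      refine ⟨by omega, ⟨⟨by omega, ⟨by omega, by omega⟩, ?_⟩, by omega, by omega⟩, by omega,
        by omega, hfin _ (bitSelect_odd h1 h2).symm⟩
      omega
    · have h3 : q / 2 * B + r₀ < k := by
        have : (q / 2 + 1) * B ≤ q * B := Nat.mul_le_mul_right _ (by omega)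
        rw [add_mul] at this
        omega
      have h4 := (hidx (r₀) hr h0).2 h3
      have h5 := bitSelect_le (q / 2) (r₀)
      rw [h4]
      refine ⟨by omega, ⟨⟨by omega, by omega, by omega⟩, by omega, by omega⟩, by omega,
        by omega, hfin _ (bitSelect_even h0 h1).symm⟩
  · rintro ρ hf' ⟨h11, hx⟩
    have r6 : ρ.reg 6 = B := by
      rw [hf'.1 6 (by simp [regs]), hf.1 6 (by simp [regs]), h6]
    simp [h11, r6]; omega
  · exact ⟨hτ, fun x hx => absurd hx (Nat.not_lt_zero x)⟩
  · have e1 : (HProg.assign 11 0).time ≤ 10 := Nat.le_of_ble_eq_true rfl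
    have e2 : (op .lt (reg 11) (op .shl (reg 6) (reg 6))).cost ≤ 5 := Nat.le_of_ble_eq_true rfl
    have e4 : (B * 2 ^ B + 1) * ((op .lt (reg 11) (op .shl (reg 6) (reg 6))).cost + 1 + 200) ≤
      (3 * s.length) * 206 := Nat.mul_le_mul (by omega) (by omega)
    omega

end WordRAM

namespace WordRAM

open HExpr HProg

/-! ### The extreme children -/

/-- Computes the first (last) child of each node; array element `p` is one more than the child of
`p`, or zero if there is none. -/
def extremeChild (o : ℕ) (dir : Bool) : HProg :=
  .assign 11 0 ⨾
  .loop (.op .lt (reg 11) nodes)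
    (.ite (.op .eq (reg 11) root) .skip
      (.assign 13 (parent (reg 11)) ⨾ .assign 14 (arr o (reg 13)) ⨾
        .ite (.op .eq (reg 14) 0) (.store o (reg 13) (reg 11 + 1))
          (.ite (before dir (letter (reg 11)) (letter (reg 14 - 1)))
            (.store o (reg 13) (reg 11 + 1)) .skip)) ⨾
    .assign 11 (reg 11 + 1))

/-- The extreme child of `p` among the nodes less than `k`. -/
def IsExtreme {s : List ℕ} (T : SuffixTree s) (dir : Bool) (k : ℕ) (p : Fin T.size) (x : ℕ) :
    Prop :=
  (x = 0 ∧ ∀ c : Fin T.size, (c : ℕ) < k → c ≠ T.root → T.parent c ≠ p) ∨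
  ∃ b : Fin T.size, (b : ℕ) < k ∧ b ≠ T.root ∧ T.parent b = p ∧ x = b + 1 ∧
    ∀ c : Fin T.size, (c : ℕ) < k → c ≠ T.root → T.parent c = p →
      ¬ SuffixTree.Before dir (T.letter c) (T.letter b)

theorem before_trans {dir : Bool} {a b c : ℕ} (h : SuffixTree.Before dir a b)
    (h' : SuffixTree.Before dir b c) : SuffixTree.Before dir a c := by
  cases dir <;> simp only [SuffixTree.Before, if_true, Bool.false_eq_true, if_false] at * <;> omega

theorem before_of_not_before {dir : Bool} {a b : ℕ} (h : ¬ SuffixTree.Before dir a b)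
    (hne : a ≠ b) : SuffixTree.Before dir b a := by
  cases dir <;> simp only [SuffixTree.Before, if_true, Bool.false_eq_true, if_false] at * <;> omega

section

variable {s : List ℕ} {T : SuffixTree s} {dir : Bool}

/-- Siblings have distinct letters, so every child other than the extreme one has the extreme one
before it. -/
theorem IsExtreme.marked_iff {c : Fin T.size} {x : ℕ} (hc : c ≠ T.root)
    (h : IsExtreme T dir T.size (T.parent c) x) : x ≠ c + 1 ↔ T.Marked dir c := by
  rcases h with ⟨_, h⟩ | ⟨b, _, hb, hp, rfl, h⟩
  · exact absurd rfl (h c c.2 hc)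
  · constructor
    · intro hne
      have hbc : b ≠ c := by rintro rfl; exact hne rfl
      exact ⟨hc, b, hb, hp, before_of_not_before (h c c.2 hc rfl) (T.letter_ne hc hb hp.symm
        (Ne.symm hbc))⟩
    · rintro ⟨_, c', hc', hp', hlt⟩ he
      have : b = c := by ext; omega
      subst this
      exact h c' c'.2 hc' hp' hlt

theorem IsExtreme.of_ne {k : ℕ} {p : Fin T.size} {x : ℕ} (h : IsExtreme T dir k p x)
    (hk : ∀ c : Fin T.size, (c : ℕ) = k → c ≠ T.root → T.parent c ≠ p) :
    IsExtreme T dir (k + 1) p x := by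
  rcases h with ⟨hx, h⟩ | ⟨b, hbk, hb, hp, hx, h⟩
  · refine .inl ⟨hx, fun c hck hc => ?_⟩
    rcases Nat.lt_succ_iff_lt_or_eq.1 hck with h' | h'
    · exact h c h' hc
    · exact hk c h' hc
  · refine .inr ⟨b, by omega, hb, hp, hx, fun c hck hc hcp => ?_⟩
    rcases Nat.lt_succ_iff_lt_or_eq.1 hck with h' | h'
    · exact h c h' hc hcp
    · exact absurd hcp (hk c h' hc)

theorem IsExtreme.of_zero {k : Fin T.size} (hk : k ≠ T.root)
    (h : IsExtreme T dir k (T.parent k) 0) : IsExtreme T dir (k + 1) (T.parent k) (k + 1) := by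
  rcases h with ⟨_, h⟩ | ⟨_, _, _, _, h, _⟩
  · refine .inr ⟨k, by omega, hk, rfl, rfl, fun c hck hc hcp => ?_⟩
    rcases Nat.lt_succ_iff_lt_or_eq.1 hck with h' | h'
    · exact absurd hcp (h c h' hc)
    · rw [Fin.ext h']; exact SuffixTree.not_before_self _ _
  · omega

theorem IsExtreme.of_before {k b : Fin T.size} (hk : k ≠ T.root)
    (h : IsExtreme T dir k (T.parent k) (b + 1))
    (hlt : SuffixTree.Before dir (T.letter k) (T.letter b)) :
    IsExtreme T dir (k + 1) (T.parent k) (k + 1) := by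
  rcases h with ⟨h, _⟩ | ⟨b', _, hb, hp, hx, h⟩
  · omega
  · have : b = b' := by ext; omega
    subst this
    refine .inr ⟨k, by omega, hk, rfl, rfl, fun c hck hc hcp hlt' => ?_⟩
    rcases Nat.lt_succ_iff_lt_or_eq.1 hck with h' | h'
    · exact h c h' hc hcp (before_trans hlt' hlt)
    · rw [Fin.ext h'] at hlt'; exact SuffixTree.not_before_self _ _ hlt'

theorem IsExtreme.of_not_before {k b : Fin T.size}
    (h : IsExtreme T dir k (T.parent k) (b + 1))
    (hlt : ¬ SuffixTree.Before dir (T.letter k) (T.letter b)) :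
    IsExtreme T dir (k + 1) (T.parent k) (b + 1) := by
  rcases h with ⟨h, _⟩ | ⟨b', hbk, hb, hp, hx, h⟩
  · omega
  · have : b = b' := by ext; omega
    subst this
    refine .inr ⟨b, by omega, hb, hp, rfl, fun c hck hc hcp => ?_⟩
    rcases Nat.lt_succ_iff_lt_or_eq.1 hck with h' | h'
    · exact h c h' hc hcp
    · rwa [Fin.ext h']

end

variable {s : List ℕ} {T : SuffixTree s} {E : Env} (hI : T.Input E) {o : ℕ} (dir : Bool)
include hI

/-- A running minimum (maximum) for all parents at once, in the order of the node indices. The zero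
of the fresh array means that no child has been seen, which is why entries are shifted by one. -/
theorem triple_extremeChild (ho : o ≤ 16) (σ : HState) (h0 : ∀ x, σ.arr o x = 0) :
    Triple E (extremeChild o dir) σ (2000 * s.length) fun τ =>
      ∀ p : Fin T.size, IsExtreme T dir T.size p (τ.arr o p) := by
  have hb := hI.bounds
  have vN := fun σ => val_nodes hI (σ := σ)
  have oN := fun σ => ok_nodes hI (σ := σ)
  have vR := fun σ => val_root hI (σ := σ)
  have oR := fun σ => ok_root hI (σ := σ)
  refine ((triple_of_wp (Q := fun τ => τ.reg 11 = 0 ∧ ∀ x, τ.arr o x = 0) ?_).seq fun τ hf hτ =>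
    triple_loop_const T.size 500 (fun k τ => τ.reg 11 = k ∧
      ∀ p : Fin T.size, IsExtreme T dir k p (τ.arr o p)) ?_ ?_ ?_).mono ?_ fun _ _ h => h.2
  · simp [wp, h0]; omega
  · rintro k hk ρ hf' ⟨h11, hx⟩
    refine ⟨by simp [oN], by simp [vN, h11, hk], triple_of_wp_le ?_ ?_⟩
    · cases dir <;> exact Nat.le_of_ble_eq_true rfl
    obtain ⟨u, rfl⟩ : ∃ u : Fin T.size, (u : ℕ) = k := ⟨⟨k, hk⟩, rfl⟩
    simp only [wp, ok_eq, ok_reg, oR, and_true, true_and, val_eq, val_reg, h11, vR]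
    refine ⟨fun hr => ?_, fun hr => ?_⟩
    · have hur : u = T.root := by
        by_contra h
        have : ¬ (u : ℕ) = T.root := fun h' => h (Fin.ext h')
        simp [this] at hr
      refine ⟨by simp [h11]; omega, by simp [h11], fun p => ?_⟩
      exact (hx p).of_ne fun c hc hcr => absurd ((Fin.ext hc).trans hur) hcr
    · have hur : u ≠ T.root := by
        rintro h
        simp [h] at hr
      have hp := (T.parent u).2
      have hxu := hx (T.parent u)
      have key : ∀ v, IsExtreme T dir (u + 1) (T.parent u) v → ∀ p : Fin T.size,
          IsExtreme T dir (u + 1) p (if (p : ℕ) = T.parent u then v else ρ.arr o p) := by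
        intro v hv p
        split_ifs with h
        · rwa [Fin.ext h]
        · refine (hx p).of_ne fun c hc hcr hcp => h ?_
          rw [← hcp, Fin.ext hc]
      have vP : (parent (reg 11)).val E ρ = T.parent u := val_parent hI (by simpa using h11)
      have oP : (parent (reg 11)).Ok E ρ := ok_parent hI (v := u) (by simpa using h11) (by simp)
      refine ⟨oP, ?_, ?_, ?_, ?_⟩
      · simp [vP]; omega
      · simp; omega
      · intro hz
        have hz' : ρ.arr o (T.parent u) = 0 := by simpa [vP] using hz
        rw [hz'] at hxu
        have := key _ (hxu.of_zero hur)
        simp [vP, h11]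
        exact ⟨by omega, ⟨by omega, by omega⟩, by omega, ⟨by omega, by omega⟩, this⟩
      · intro hz
        have hz' : ρ.arr o (T.parent u) ≠ 0 := by simpa [vP] using hz
        obtain ⟨b, hbu, hbr, hbp, hbx, _⟩ :
            ∃ b : Fin T.size, (b : ℕ) < u ∧ b ≠ T.root ∧ T.parent b = T.parent u ∧
              ρ.arr o (T.parent u) = b + 1 ∧ True := by
          rcases hxu with ⟨h, _⟩ | ⟨b, h1, h2, h3, h4, _⟩
          · exact absurd h hz'
          · exact ⟨b, h1, h2, h3, h4, trivial⟩
        rw [hbx] at hxu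
        set ρ' := (ρ.setReg 13 (val E ρ (reg 11).parent)).setReg 14
          (val E (ρ.setReg 13 (val E ρ (reg 11).parent)) (HExpr.arr o (reg 13))) with hρ'
        have r11 : ρ'.reg 11 = u := by simp [hρ', h11]
        have r13 : ρ'.reg 13 = T.parent u := by simp [hρ', vP]
        have r14 : ρ'.reg 14 = b + 1 := by simp [hρ', vP, hbx]
        have harr : ρ'.arr = ρ.arr := rfl
        have vl : (letter (reg 11)).val E ρ' = T.letter u := val_letter hI (by simpa using r11) hur
        have ol : (letter (reg 11)).Ok E ρ' := ok_letter hI (v := u) (by simpa using r11)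
          (by simp) hur
        have vb : (letter (reg 14 - 1)).val E ρ' = T.letter b :=
          val_letter hI (by simp [r14]) hbr
        have ob : (letter (reg 14 - 1)).Ok E ρ' := ok_letter hI (v := b) (by simp [r14])
          (by simp [r14]; omega) hbr
        refine ⟨ok_before ol ob, fun hbef => ?_, fun hbef => ?_⟩
        · rw [val_before_ne_zero, vl, vb] at hbef
          have := key _ (hxu.of_before hur hbef)
          simp [r11, r13, harr]
          exact ⟨by omega, ⟨by omega, by omega⟩, by omega, ⟨by omega, by omega⟩, this⟩
        · have hbef' : ¬ SuffixTree.Before dir (T.letter u) (T.letter b) := by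
            rw [← vl, ← vb, ← val_before_ne_zero]; simpa using hbef
          have := key _ (hxu.of_not_before hbef')
          simp [r11, harr]
          refine ⟨⟨by omega, by omega⟩, fun p => ?_⟩
          have h := this p
          split_ifs at h with hpu
          · rwa [hpu, hbx]
          · exact h
  · rintro ρ hf' ⟨h11, hx⟩
    simp [h11, vN, oN]
  · refine ⟨hτ.1, fun p => .inl ⟨hτ.2 _, fun c hc => absurd hc (Nat.not_lt_zero _)⟩⟩
  · have e1 : (HProg.assign 11 0).time ≤ 10 := Nat.le_of_ble_eq_true rfl
    have e2 : (op .lt (reg 11) nodes).cost ≤ 5 := Nat.le_of_ble_eq_true rfl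
    generalize (op .lt (reg 11) nodes).cost = c at *
    have e4 : (T.size + 1) * (c + 1 + 500) ≤
      (3 * s.length) * 506 := Nat.mul_le_mul (by omega) (by omega)
    omega

end WordRAM

namespace WordRAM

open HExpr HProg

/-! ### Snapshots of the stack -/

/-- Copies every `stride`-th element of the stack, starting at the top. -/
def copyStack (o i : ℕ) (dst cnt stride : HExpr) : HProg :=
  .assign 8 0 ⨾
  .loop (.op .lt (reg 8) cnt * .op .lt (reg 8 * stride) (reg 3))
    (.store (o + i) (dst + reg 8) (arr (o + 3) (reg 3 - 1 - reg 8 * stride)) ⨾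
    .assign 8 (reg 8 + 1))

theorem cost_address (i : ℕ) (e : Expr) : (address i e).cost = e.cost + 14 := by
  simp only [address, Expr.cost]; omega

theorem cost_reg (r : ℕ) : (reg r).cost = 1 := rfl
theorem cost_ofNat (k : ℕ) : (ofNat(k) : HExpr).cost = 1 := rfl
theorem cost_add (a b : HExpr) : (a + b).cost = a.cost + b.cost + 1 := rfl
theorem cost_sub (a b : HExpr) : (a - b).cost = a.cost + b.cost + 1 := rfl
theorem cost_mul (a b : HExpr) : (a * b).cost = a.cost + b.cost + 1 := rfl
theorem cost_lt (a b : HExpr) : (op .lt a b).cost = a.cost + b.cost + 1 := rfl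
theorem cost_arr (i : ℕ) (e : HExpr) : (arr i e).cost = e.cost + 15 := by
  change (address i e.compile).cost + 1 = _
  rw [cost_address]; rfl

theorem lt_ceil_iff {e h S : ℕ} (hS : 0 < S) : e < (h + S - 1) / S ↔ e * S < h := by
  rw [← Nat.succ_le_iff, Nat.le_div_iff_mul_le hS, Nat.succ_mul]
  omega

theorem triple_copyStack {E : Env} {o i : ℕ} (hoi : o + i < 32) (hi : 3 < i)
    {dst cnt stride : HExpr} {σ : HState} {D C S h : ℕ} (hS : 0 < S)
    (hv : ∀ τ : HState, (∀ r, r ≠ 8 → τ.reg r = σ.reg r) →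
      dst.val E τ = D ∧ dst.Ok E τ ∧ cnt.val E τ = C ∧ cnt.Ok E τ ∧ stride.val E τ = S ∧
        stride.Ok E τ)
    (hc : dst.cost ≤ 20 ∧ cnt.cost ≤ 20 ∧ stride.cost ≤ 20)
    (h3 : σ.reg 3 = h) (hh : h ≤ E.size) (hD : D + C ≤ E.size) (hCS : C * S ≤ E.size) :
    Triple E (copyStack o i dst cnt stride) σ (200 * (C + 1)) fun τ =>
      (∀ e < C, e * S < h → τ.arr (o + i) (D + e) = σ.arr (o + 3) (h - 1 - e * S)) ∧
      ∀ x, x < D ∨ D + C ≤ x → τ.arr (o + i) x = σ.arr (o + i) x := by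
  have hp : E.base + 32 * E.size ≤ E.cap := E.le_pow
  have hp' := E.base_eq
  have hp'' := E.size_pos
  -- The loop stops when `C` elements are copied or the next one would lie below the bottom; `K` is
  -- the number of copies.
  set K := min C ((h + S - 1) / S) with hK
  have hlt : ∀ e, e < K ↔ e < C ∧ e * S < h := by
    intro e
    rw [hK, lt_min_iff, lt_ceil_iff hS]
  have hKC : K ≤ C := min_le_left _ _
  refine ((triple_of_wp (Q := fun τ => τ.reg 8 = 0 ∧ τ.arr = σ.arr) ?_).seq fun τ hf hτ =>
    triple_loop_const K 120 (fun k τ => τ.reg 8 = k ∧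
      (∀ e < k, τ.arr (o + i) (D + e) = σ.arr (o + 3) (h - 1 - e * S)) ∧
      ∀ x, x < D ∨ D + k ≤ x → τ.arr (o + i) x = σ.arr (o + i) x) ?_ ?_ ?_).mono ?_ ?_
  · simp [wp]; omega
  · rintro k hk ρ hf' ⟨h8, hx, hx'⟩
    obtain ⟨hk1, hk2⟩ := (hlt k).1 hk
    have hreg : ∀ r, r ≠ 8 → ρ.reg r = σ.reg r := fun r hr => by
      rw [hf'.1 r (by simp [regs, hr]), hf.1 r (by simp [regs, hr])]
    obtain ⟨v1, v2, v3, v4, v5, v6⟩ := hv ρ hreg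
    have r3 : ρ.reg 3 = h := by rw [hreg 3 (by decide), h3]
    have a3 : ρ.arr (o + 3) = σ.arr (o + 3) := by
      rw [hf'.2 (o + 3) (by simp [arrs]; omega), hτ.2]
    refine ⟨by simp [*]; omega, by simp [*], triple_of_wp_le ?_ ?_⟩
    · simp only [HProg.time, cost_address, cost_arr, cost_sub, cost_mul, cost_reg, cost_ofNat,
        cost_add, ← HExpr.cost.eq_def]
      omega
    · simp [wp, *]
      have hkS : k * S ≤ h - 1 := by omega
      refine ⟨by omega, ⟨by omega, ⟨⟨by omega, by omega, by omega⟩, by omega, by omega, by omega⟩,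
        by omega⟩, by omega, ⟨by omega, by omega⟩, ?_, fun x hxx => ?_⟩
      · intro e he
        split_ifs with hek
        · rw [hek]
        · exact hx e (by omega)
      · rw [if_neg (by omega)]
        exact hx' x (by omega)
  · rintro ρ hf' ⟨h8, hx, hx'⟩
    have hreg : ∀ r, r ≠ 8 → ρ.reg r = σ.reg r := fun r hr => by
      rw [hf'.1 r (by simp [regs, hr]), hf.1 r (by simp [regs, hr])]
    obtain ⟨v1, v2, v3, v4, v5, v6⟩ := hv ρ hreg
    have r3 : ρ.reg 3 = h := by rw [hreg 3 (by decide), h3]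
    have hKS : K * S ≤ C * S := Nat.mul_le_mul_right _ hKC
    have hKn : ¬ (K < C ∧ K * S < h) := fun h' => lt_irrefl _ ((hlt K).2 h')
    clear hlt hx hx' hK
    clear_value K
    simp [*]
    exact ⟨⟨by omega, by split_ifs <;> omega⟩, by omega⟩
  · exact ⟨hτ.1, fun e he => absurd he (Nat.not_lt_zero e), fun x _ => by rw [hτ.2]⟩
  · have e1 : (HProg.assign 8 0).time = 2 := rfl
    have e2 : (op .lt (reg 8) cnt * op .lt (reg 8 * stride) (reg 3)).cost ≤ 60 := by
      simp only [cost_mul, cost_lt, cost_reg]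
      omega
    generalize (op .lt (reg 8) cnt * op .lt (reg 8 * stride) (reg 3)).cost = c at *
    have e4 : (K + 1) * (c + 1 + 120) ≤ (C + 1) * 190 := Nat.mul_le_mul (by omega) (by omega)
    omega
  · rintro ρ _ ⟨h8, hx, hx'⟩
    exact ⟨fun e he1 he2 => hx e ((hlt e).2 ⟨he1, he2⟩), fun x hxx => hx' x (by omega)⟩
end WordRAM

namespace WordRAM

open HExpr HProg

/-- Snapshots of the stack at the start of a block. -/
def snapshot (o : ℕ) : HProg :=
  (.store (o + 9) (reg 2 / reg 6) (reg 3) ⨾ .assign 4 (reg 3) ⨾ .assign 5 0) ⨾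
  copyStack o 10 (2 * reg 6 * (reg 2 / reg 6)) (2 * reg 6) 1 ⨾
  (.assign 9 1 ⨾ .assign 10 0) ⨾
  .loop (.op .lt (reg 9) (reg 7 + 1) * .op .eq (reg 2 / reg 6 % reg 9) 0)
    (copyStack o 11 (reg 10 * reg 12 + 3 * (reg 2 / reg 6)) (3 * reg 9) (reg 6) ⨾
      .assign 10 (reg 10 + 1) ⨾ .assign 9 (reg 9 * 2))

/-- The array elements for jumps of level `κ` from the start of block `i` are correct. -/
def JumpOk (ev : ℕ → Option Bool) (B M o : ℕ) (arr : ℕ → ℕ → ℕ) (i κ : ℕ) : Prop :=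
  ∀ e < 3 * 2 ^ κ, e * B < headLength ev B i → ∀ t,
    (stackAt ev (i * B))[headLength ev B i - 1 - e * B]? = some t →
      arr (o + 11) (κ * M + 3 * i + e) = t

/-- The array elements for the start of block `i` are correct. -/
structure HeadOk (ev : ℕ → Option Bool) (B H M o : ℕ) (arr : ℕ → ℕ → ℕ) (i : ℕ) : Prop where
  length : arr (o + 9) i = headLength ev B i
  near : ∀ e < 2 * B, e < headLength ev B i → ∀ t,
    (stackAt ev (i * B))[headLength ev B i - 1 - e]? = some t → arr (o + 10) (2 * B * i + e) = t
  jump : ∀ κ, 2 ^ κ ∣ i → 2 ^ κ ≤ H → JumpOk ev B M o arr i κ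

/-- The time of the snapshots at the start of block `i`. -/
def snapshotTime (B H i : ℕ) : ℕ :=
  1000 * B + ∑ κ ∈ Finset.range (Nat.log 2 H + 1), if 2 ^ κ ∣ i then 2000 * 2 ^ κ else 0

/-- Writing for block `i` at level `κ` does not touch what was written for an earlier block. Levels
occupy separate intervals of length `M`, since `3 * i' + e < 6 * H`. Within a level, block indices
differ by at least `2 ^ κ`, so segments of length `3 * 2 ^ κ` starting at three times the index are
disjoint. -/
theorem lt_of_jump_index {H M i i' κ κ' e : ℕ} (hM : M = 6 * H + 1) (hi : i < H) (hi' : i' < i)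
    (hκ : 2 ^ κ ≤ H) (hκ' : 2 ^ κ' ≤ H) (hd : 2 ^ κ ∣ i) (hd' : 2 ^ κ' ∣ i') (he : e < 3 * 2 ^ κ') :
    κ' * M + 3 * i' + e < κ * M + 3 * i ∨
      κ * M + 3 * i + 3 * 2 ^ κ ≤ κ' * M + 3 * i' + e := by
  rcases lt_trichotomy κ' κ with h | rfl | h
  · have : (κ' + 1) * M ≤ κ * M := Nat.mul_le_mul_right _ h
    rw [add_mul] at this
    omega
  · have : i' + 2 ^ κ' ≤ i := by
      obtain ⟨a, rfl⟩ := hd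
      obtain ⟨b, rfl⟩ := hd'
      have : b < a := lt_of_mul_lt_mul_left hi' (Nat.zero_le _)
      calc 2 ^ κ' * b + 2 ^ κ' = 2 ^ κ' * (b + 1) := by ring
        _ ≤ _ := Nat.mul_le_mul_left _ this
    omega
  · have : (κ + 1) * M ≤ κ' * M := Nat.mul_le_mul_right _ h
    rw [add_mul] at this
    omega

theorem lt_of_jump_index' {H M i κ κ' e : ℕ} (hM : M = 6 * H + 1)
    (hκ' : 2 ^ κ' ≤ H) (hκ : κ' < κ) (he : e < 3 * 2 ^ κ') :
    κ' * M + 3 * i + e < κ * M + 3 * i := by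
  have : (κ' + 1) * M ≤ κ * M := Nat.mul_le_mul_right _ hκ
  rw [add_mul] at this
  omega

theorem triple_snapshot {E : Env} {ev : ℕ → Option Bool} {B H M o i : ℕ} (ho : o ≤ 16)
    (hB : 0 < B) (hM : M = 6 * H + 1) (hi : i < H) (hBH : 3 * B * H + 3 * B ≤ E.size)
    (hMX : ∀ κ, 2 ^ κ ≤ H → (κ + 1) * M ≤ E.size) {σ : HState}
    (h2 : σ.reg 2 = i * B) (h3 : σ.reg 3 = headLength ev B i) (h6 : σ.reg 6 = B)
    (h7 : σ.reg 7 = H) (h12 : σ.reg 12 = M)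
    (hst : ∀ j t, (stackAt ev (i * B))[j]? = some t → σ.arr (o + 3) j = t) :
    Triple E (snapshot o) σ (snapshotTime B H i) fun τ =>
      τ.reg 4 = headLength ev B i ∧ τ.reg 5 = 0 ∧ HeadOk ev B H M o τ.arr i ∧
        ∀ i' < i, HeadOk ev B H M o σ.arr i' → HeadOk ev B H M o τ.arr i' := by
  have hp : E.base + 32 * E.size ≤ E.cap := E.le_pow
  have hp' := E.base_eq
  have hp'' := E.size_pos
  have hdiv : i * B / B = i := Nat.mul_div_cancel _ hB
  have hlen : headLength ev B i ≤ i * B := length_stackAt_le ev _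
  have hiB : (i + 1) * B ≤ H * B := Nat.mul_le_mul_right _ hi
  rw [add_mul, one_mul] at hiB
  have hHB : 3 * B * H = 3 * (H * B) := by ring
  have hHle : H ≤ H * B := Nat.le_mul_of_pos_right _ hB
  -- the number of levels
  have hex : ∃ κ, ¬ (2 ^ κ ≤ H ∧ i % 2 ^ κ = 0) :=
    ⟨H, fun h => absurd h.1 (not_le.2 Nat.lt_two_pow_self)⟩
  classical
  -- The loop stops at the first level that is too large or does not divide `i`. Both conditions on
  -- a level are inherited by smaller levels, so all levels required by `HeadOk` lie below `K`.
  obtain ⟨K, hK1, hK2⟩ : ∃ K, ¬ (2 ^ K ≤ H ∧ i % 2 ^ K = 0) ∧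
      ∀ κ < K, 2 ^ κ ≤ H ∧ i % 2 ^ κ = 0 :=
    ⟨Nat.find hex, Nat.find_spec hex, fun κ hκ => not_not.1 (Nat.find_min hex hκ)⟩
  refine (((triple_of_wp (Q := fun τ => τ.reg 4 = headLength ev B i ∧ τ.reg 5 = 0 ∧
    τ.arr (o + 9) i = headLength ev B i ∧ ∀ x, x ≠ i → τ.arr (o + 9) x = σ.arr (o + 9) x) ?_).seq
    fun τ hf hτ => (triple_copyStack (D := 2 * B * i) (C := 2 * B) (S := 1)
      (h := headLength ev B i) (by omega) (by omega) one_pos ?_ ?_ ?_ ?_ ?_ ?_).seq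
    fun ρ hf' hρ => (triple_of_wp (Q := fun τ => τ.reg 9 = 1 ∧ τ.reg 10 = 0 ∧ τ.arr = ρ.arr)
      ?_).seq fun υ hf'' hυ =>
    (triple_loop K (fun κ => 200 * (3 * 2 ^ κ + 1) + 20) (fun κ τ => τ.reg 9 = 2 ^ κ ∧
      τ.reg 10 = κ ∧ (∀ κ' < κ, JumpOk ev B M o τ.arr i κ') ∧
      ∀ i' < i, ∀ κ', 2 ^ κ' ∣ i' → 2 ^ κ' ≤ H → JumpOk ev B M o σ.arr i' κ' →
        JumpOk ev B M o τ.arr i' κ') ?_ ?_ ?_).mono le_rfl (Q := fun τ =>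
      τ.reg 4 = headLength ev B i ∧ τ.reg 5 = 0 ∧ HeadOk ev B H M o τ.arr i ∧
        ∀ i' < i, HeadOk ev B H M o σ.arr i' → HeadOk ev B H M o τ.arr i') ?_)).mono ?_
    fun _ _ => id
  · simp only [wp, ok_div, ok_reg, val_div, val_reg, h2, h6, h3, hdiv]
    simp +contextual
    omega
  · intro υ hυ
    have r6 : υ.reg 6 = B := by rw [hυ 6 (by decide), hf.1 6 (by simp [regs]), h6]
    have r2 : υ.reg 2 = i * B := by rw [hυ 2 (by decide), hf.1 2 (by simp [regs]), h2]
    have : 2 * B * i = 2 * (i * B) := by ring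
    simp [r6, r2, hdiv]
    omega
  · exact ⟨Nat.le_of_ble_eq_true rfl, Nat.le_of_ble_eq_true rfl, Nat.le_of_ble_eq_true rfl⟩
  · rw [hf.1 3 (by simp [regs]), h3]
  · omega
  · have : 2 * B * i = 2 * (i * B) := by ring
    omega
  · omega
  · simp [wp]; omega
  · rintro κ hκ υ' hf3 ⟨h9, h10, hj, hj'⟩
    obtain ⟨hκ1, hκ2⟩ := hK2 κ hκ
    have hfr : ∀ r, r ≠ 4 → r ≠ 5 → r ≠ 8 → r ≠ 9 → r ≠ 10 → υ'.reg r = σ.reg r := by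
      intro r a1 a2 a3 a4 a5
      rw [hf3.1 r (by simp [regs, copyStack, *]), hf''.1 r (by simp [regs, *]),
        hf'.1 r (by simp [regs, copyStack, *]), hf.1 r (by simp [regs, *])]
    have r2 : υ'.reg 2 = i * B := by rw [hfr 2 (by decide) (by decide) (by decide) (by decide)
      (by decide), h2]
    have r3 : υ'.reg 3 = headLength ev B i := by
      rw [hfr 3 (by decide) (by decide) (by decide) (by decide) (by decide), h3]
    have r6 : υ'.reg 6 = B := by rw [hfr 6 (by decide) (by decide) (by decide) (by decide)
      (by decide), h6]
    have r7 : υ'.reg 7 = H := by rw [hfr 7 (by decide) (by decide) (by decide) (by decide)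
      (by decide), h7]
    have r12 : υ'.reg 12 = M := by rw [hfr 12 (by decide) (by decide) (by decide) (by decide)
      (by decide), h12]
    have a3 : υ'.arr (o + 3) = σ.arr (o + 3) := by
      rw [hf3.2 _ (by simp [arrs, copyStack]), hυ.2.2, hf'.2 _ (by simp [arrs, copyStack]),
        hf.2 _ (by simp [arrs])]
    have hMκ := hMX κ hκ1
    rw [add_mul, one_mul] at hMκ
    have hpB : 3 * 2 ^ κ * B ≤ 3 * (H * B) := by
      rw [mul_assoc]; exact Nat.mul_le_mul_left _ (Nat.mul_le_mul_right _ hκ1)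
    refine ⟨?_, ?_, ((triple_copyStack (D := κ * M + 3 * i) (C := 3 * 2 ^ κ) (S := B)
      (h := headLength ev B i) (by omega) (by omega) hB ?_ ?_ r3 ?_ ?_ ?_).seq
      fun ω hf4 hω => triple_of_wp_le (t := 20) (Nat.le_of_ble_eq_true rfl) ?_)⟩
    · simp [r2, r6, r7, h9, hdiv, hκ2]
      split_ifs <;> omega
    · simp [r2, r6, r7, h9, hdiv, hκ2]; omega
    · intro ω hω
      simp [hω 10 (by decide), hω 12 (by decide), hω 6 (by decide), hω 9 (by decide),
        hω 2 (by decide), r2, r6, h9, h10, hdiv, r12]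
      omega
    · exact ⟨Nat.le_of_ble_eq_true rfl, Nat.le_of_ble_eq_true rfl, Nat.le_of_ble_eq_true rfl⟩
    · omega
    · omega
    · omega
    · have ω9 : ω.reg 9 = 2 ^ κ := by rw [hf4.1 9 (by simp [regs, copyStack]), h9]
      have ω10 : ω.reg 10 = κ := by rw [hf4.1 10 (by simp [regs, copyStack]), h10]
      have hκ3 : κ < 2 ^ κ := Nat.lt_two_pow_self
      simp only [wp, ok_add, ok_mul, ok_reg, ok_ofNat, val_add, val_mul, val_reg, val_ofNat,
        HState.setReg_reg, HState.setReg_arr, ω9, ω10, true_and, if_true, Nat.reduceEqDiff,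
        if_false]
      refine ⟨by omega, by omega, by rw [pow_succ], ?_, ?_⟩
      · intro κ' hκ' e he heB t ht
        rcases Nat.lt_succ_iff_lt_or_eq.1 hκ' with h | rfl
        · have hb := lt_of_jump_index' (i := i) hM (hK2 κ' (h.trans hκ)).1 h he
          rw [hω.2 _ (.inl hb)]
          exact hj κ' h e he heB t ht
        · rw [hω.1 e he heB, a3]
          exact hst _ _ ht
      · intro i' hi' κ' hd hH hσ e he heB t ht
        rw [hω.2 _ (lt_of_jump_index hM hi hi' hκ1 hH (Nat.dvd_of_mod_eq_zero hκ2) hd he)]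
        exact hj' i' hi' κ' hd hH hσ e he heB t ht
  · rintro υ' hf3 ⟨h9, h10, hj, hj'⟩
    have hfr : ∀ r, r ≠ 4 → r ≠ 5 → r ≠ 8 → r ≠ 9 → r ≠ 10 → υ'.reg r = σ.reg r := by
      intro r a1 a2 a3 a4 a5
      rw [hf3.1 r (by simp [regs, copyStack, *]), hf''.1 r (by simp [regs, *]),
        hf'.1 r (by simp [regs, copyStack, *]), hf.1 r (by simp [regs, *])]
    have r2 : υ'.reg 2 = i * B := by rw [hfr 2 (by decide) (by decide) (by decide) (by decide)
      (by decide), h2]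
    have r6 : υ'.reg 6 = B := by rw [hfr 6 (by decide) (by decide) (by decide) (by decide)
      (by decide), h6]
    have r7 : υ'.reg 7 = H := by rw [hfr 7 (by decide) (by decide) (by decide) (by decide)
      (by decide), h7]
    simp [r2, r6, r7, h9, hdiv]
    refine ⟨⟨by omega, by split_ifs <;> omega⟩, fun h => ?_⟩
    by_contra h'
    exact hK1 ⟨by omega, h⟩
  · refine ⟨hυ.1, hυ.2.1, fun _ h => absurd h (Nat.not_lt_zero _), ?_⟩
    intro i' _ κ' _ _ hσ e he heB t ht
    rw [hυ.2.2, hf'.2 _ (by simp [arrs, copyStack]), hf.2 _ (by simp [arrs])]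
    exact hσ e he heB t ht
  · rintro υ' hf3 ⟨h9, h10, hj, hj'⟩
    have a9 : υ'.arr (o + 9) = τ.arr (o + 9) := by
      rw [hf3.2 _ (by simp [arrs, copyStack]), hf''.2 _ (by simp [arrs]),
        hf'.2 _ (by simp [arrs, copyStack])]
    have a10 : υ'.arr (o + 10) = ρ.arr (o + 10) := by
      rw [hf3.2 _ (by simp [arrs, copyStack]), hf''.2 _ (by simp [arrs])]
    refine ⟨?_, ?_, ⟨?_, ?_, ?_⟩, ?_⟩
    · rw [hf3.1 4 (by simp [regs, copyStack]), hf''.1 4 (by simp [regs]),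
        hf'.1 4 (by simp [regs, copyStack]), hτ.1]
    · rw [hf3.1 5 (by simp [regs, copyStack]), hf''.1 5 (by simp [regs]),
        hf'.1 5 (by simp [regs, copyStack]), hτ.2.1]
    · rw [a9, hτ.2.2.1]
    · intro e he heh t ht
      rw [a10, hρ.1 e he (by omega), mul_one, hf.2 (o + 3) (by simp [arrs])]
      exact hst _ _ ht
    · intro κ hκ hκH
      refine hj κ ?_
      by_contra hlt
      rcases (not_lt.1 hlt).lt_or_eq with h | h
      · refine hK1 ⟨(Nat.pow_le_pow_right two_pos h.le).trans hκH, ?_⟩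
        exact Nat.mod_eq_zero_of_dvd ((Nat.pow_dvd_pow 2 h.le).trans hκ)
      · exact hK1 ⟨h ▸ hκH, Nat.mod_eq_zero_of_dvd (h ▸ hκ)⟩
    · intro i' hi' hσ
      refine ⟨?_, ?_, fun κ hκ hκH => hj' i' hi' κ hκ hκH (hσ.jump κ hκ hκH)⟩
      · rw [a9, hτ.2.2.2 i' (by omega), hσ.length]
      · intro e he heh t ht
        have hle : 2 * B * i' + 2 * B ≤ 2 * B * i := by
          rw [← Nat.mul_succ]; exact Nat.mul_le_mul_left _ hi'
        rw [a10, hρ.2 _ (.inl (by omega)), hf.2 (o + 10) (by simp [arrs])]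
        exact hσ.near e he heh t ht
  · have e1 : (HProg.store (o + 9) (reg 2 / reg 6) (reg 3) ⨾ .assign 4 (reg 3) ⨾
      .assign 5 0).time ≤ 40 := Nat.le_of_ble_eq_true rfl
    have e2 : (HProg.assign 9 1 ⨾ .assign 10 0).time ≤ 10 := Nat.le_of_ble_eq_true rfl
    have e3 : (op .lt (reg 9) (reg 7 + 1) * op .eq (reg 2 / reg 6 % reg 9) 0).cost ≤ 20 :=
      Nat.le_of_ble_eq_true rfl
    generalize (op .lt (reg 9) (reg 7 + 1) * op .eq (reg 2 / reg 6 % reg 9) 0).cost = c at *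
    have hKle : K ≤ Nat.log 2 H + 1 := by
      by_contra hlt
      have h1 := (hK2 (Nat.log 2 H + 1) (by omega)).1
      have h2 : H < 2 ^ (Nat.log 2 H + 1) := Nat.lt_pow_succ_log_self one_lt_two H
      omega
    have h4 : ∑ κ ∈ Finset.range K, (c + 1 + (200 * (3 * 2 ^ κ + 1) + 20)) ≤
        ∑ κ ∈ Finset.range (Nat.log 2 H + 1), if 2 ^ κ ∣ i then 2000 * 2 ^ κ else 0 := by
      refine le_trans (Finset.sum_le_sum (g := fun κ => if 2 ^ κ ∣ i then 2000 * 2 ^ κ else 0)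
        fun κ hκ => ?_) (Finset.sum_le_sum_of_subset fun κ hκ => ?_)
      · rw [if_pos (Nat.dvd_of_mod_eq_zero (hK2 κ (Finset.mem_range.1 hκ)).2)]
        have := Nat.two_pow_pos κ
        omega
      · rw [Finset.mem_range] at *; omega
    unfold snapshotTime
    omega
end WordRAM

namespace WordRAM

open HExpr HProg

/-! ### The Euler tour -/

/-- Stores the current node and tests whether it is marked. -/
def testMark (o : ℕ) : HProg :=
  .store (o + 8) (reg 2) (reg 0) ⨾
  .ite (.op .eq (reg 0) root) (.assign 13 0)
    (.ite (.op .eq (arr o (parent (reg 0))) (reg 0 + 1)) (.assign 13 0) (.assign 13 1))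

/-- Updates the stack. -/
def updateStack (o : ℕ) : HProg :=
  .ite (.op .eq (reg 13) 0) .skip
    (.ite (.op .eq (reg 1) 0)
      (.store (o + 3) (reg 3) (reg 2) ⨾ .assign 3 (reg 3 + 1) ⨾
        .assign 5 (reg 5 + .op .shl 1 (reg 2 % reg 6)))
      (.assign 3 (reg 3 - 1) ⨾
        .ite (.op .lt (reg 3) (reg 4)) (.assign 4 (reg 3))
          (.assign 5 (reg 5 - .op .shl 1 (arr (o + 3) (reg 3) % reg 6)))))

/-- Proceeds to the next event. -/
def moveOn (o : ℕ) : HProg :=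
  .ite (.op .eq (reg 1) 0)
    (.store (o + 4) (reg 0) (reg 2) ⨾
      .ite (.op .eq (child (reg 0)) nodes) (.assign 1 1) (.assign 0 (child (reg 0))))
    (.ite (.op .eq (sibling (reg 0)) nodes) (.assign 0 (parent (reg 0)))
      (.assign 0 (sibling (reg 0)) ⨾ .assign 1 0))

/-- Records the state after the event. -/
def record (o : ℕ) : HProg :=
  .store (o + 5) (reg 2) (reg 3) ⨾ .store (o + 6) (reg 2) (reg 4) ⨾
  .store (o + 7) (reg 2) (reg 5) ⨾ .assign 2 (reg 2 + 1)

section stages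

variable {s : List ℕ} {T : SuffixTree s} {E : Env} (hI : T.Input E) {o : ℕ} {dir : Bool}
  (ho : o ≤ 16) {k : ℕ} (hk : k < 2 * T.size)
include hI ho hk

theorem triple_testMark {σ : HState} (hx : ∀ p : Fin T.size, IsExtreme T dir T.size p (σ.arr o p))
    (h0 : σ.reg 0 = (T.event k).1) (h2 : σ.reg 2 = k) :
    Triple E (testMark o) σ 200 fun τ =>
      (τ.reg 13 = 0 ↔ ¬ T.Marked dir (T.event k).1) ∧
      ∀ x, τ.arr (o + 8) x = if x = k then ((T.event k).1 : ℕ) else σ.arr (o + 8) x := by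
  have hb := hI.bounds
  have hu := (T.event k).1.2
  have hp := (T.parent (T.event k).1).2
  have hxu := hx (T.parent (T.event k).1)
  set u := (T.event k).1
  have vR := fun σ => val_root hI (σ := σ)
  have oR := fun σ => ok_root hI (σ := σ)
  have vP : ∀ v, (parent (reg 0)).val E (σ.setArr (o + 8) k v) = T.parent u := fun v =>
    val_parent hI (by simpa using h0)
  have oP : ∀ v, (parent (reg 0)).Ok E (σ.setArr (o + 8) k v) := fun v =>
    ok_parent hI (v := u) (by simpa using h0) (by simp)
  refine triple_of_wp_le (Nat.le_of_ble_eq_true rfl) ?_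
  simp only [testMark, wp, ok_reg, val_reg, h2, h0, ok_eq, val_eq, vR, oR, true_and, ok_ofNat,
    HState.setArr_reg, HState.setReg_reg, if_true, ok_arr, oP, vP, ok_add, val_arr, val_add,
    HState.setArr_arr, HState.setReg_arr, val_ofNat, ite_eq_right_iff, one_ne_zero, imp_false,
    ne_eq, not_not, show o ≠ o + 8 by omega, false_and, if_false]
  refine ⟨by omega, by omega, fun hr => ⟨by omega, ?_, fun _ => trivial⟩, fun hr => ⟨⟨⟨by omega, by omega⟩,
    by omega, by omega⟩, fun he => ⟨by omega, ?_, fun _ => trivial⟩, fun he => ⟨by omega, ?_, fun _ => trivial⟩⟩⟩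
  · have : u = T.root := Fin.ext hr
    simp [this, T.not_marked_root]
  · have hur : u ≠ T.root := fun h => hr (by rw [h])
    simp [← hxu.marked_iff hur, he]
  · have hur : u ≠ T.root := fun h => hr (by rw [h])
    simp [← hxu.marked_iff hur, he]

-- A marked node is still on its own marked path when it is left, so no pop meets an empty stack.
omit hI ho hk in
theorem stackAt_ne_nil (T : SuffixTree s) (dir : Bool) {k : ℕ} (hm : T.Marked dir (T.event k).1)
    (hl : (T.event k).2 = true) : stackAt (T.stackEvent dir) k ≠ [] := by
  intro h
  have h1 := T.map_stackAt dir k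
  rw [h, show T.event k = ((T.event k).1, true) from Prod.ext rfl hl] at h1
  change [] = T.markedPath dir (T.event k).1 at h1
  rw [T.markedPath_eq dir, if_pos hm] at h1
  simp at h1

theorem triple_updateStack {σ : HState} (h2 : σ.reg 2 = k)
    (h1 : σ.reg 1 = if (T.event k).2 then 1 else 0)
    (h13 : σ.reg 13 = 0 ↔ ¬ T.Marked dir (T.event k).1)
    (h6 : σ.reg 6 = blockSize s.length)
    (h3 : σ.reg 3 = (stackAt (T.stackEvent dir) k).length)
    (hst : ∀ j t, (stackAt (T.stackEvent dir) k)[j]? = some t → σ.arr (o + 3) j = t)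
    (h4 : σ.reg 4 = lowCount (k - k % blockSize s.length) (stackAt (T.stackEvent dir) k))
    (h5 : σ.reg 5 = highMask (k - k % blockSize s.length) (stackAt (T.stackEvent dir) k)) :
    Triple E (updateStack o) σ 200 fun τ =>
      τ.reg 3 = (stackAt (T.stackEvent dir) (k + 1)).length ∧
      (∀ j t, (stackAt (T.stackEvent dir) (k + 1))[j]? = some t → τ.arr (o + 3) j = t) ∧
      τ.reg 4 = blockLow (T.stackEvent dir) (blockSize s.length) k ∧
      τ.reg 5 = blockMask (T.stackEvent dir) (blockSize s.length) k := by
  have hb := hI.bounds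
  have hB := blockSize_mul_two_pow_le hI.pos
  have hB0 := blockSize_pos s.length
  have hBn := blockSize_le hI.pos
  unfold blockLow blockMask
  generalize blockSize s.length = B at *
  have hkB := Nat.mod_lt k hB0
  have hkle := Nat.mod_le k B
  have hpw : 2 ^ B ≤ 2 * s.length := (Nat.le_mul_of_pos_left _ hB0).trans hB
  -- The mask after the event has at most `B` bits; this excludes overflow when a bit is added.
  have hmask := highMask_lt (b := k - k % B) (B := B) (pairwise_stackAt (T.stackEvent dir) (k + 1))
    (fun t ht => by have := lt_of_mem_stackAt _ ht; omega)
  have hlen := length_stackAt_le (T.stackEvent dir) k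
  have hsort := pairwise_stackAt (T.stackEvent dir) k
  by_cases hm : T.Marked dir (T.event k).1
  · have hz : σ.reg 13 ≠ 0 := fun h => h13.1 h hm
    refine triple_of_wp_le (Nat.le_of_ble_eq_true rfl) ?_
    cases hl : (T.event k).2 with
    | false =>
      have hS := stackAt_push (T.stackEvent dir) (k := k) (by simp [SuffixTree.stackEvent, hm, hl])
      have hpk : 2 ^ (k % B) < 2 ^ B := Nat.pow_lt_pow_right one_lt_two hkB
      rw [hS, highMask_append_singleton _ (Nat.sub_le _ _), Nat.sub_sub_self hkle] at hmask
      rw [hS, lowCount_append_singleton _ (Nat.sub_le _ _),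
        highMask_append_singleton _ (Nat.sub_le _ _), Nat.sub_sub_self hkle]
      simp [updateStack, wp, hz, h1, hl, h3, h2, h6, h4, h5]
      and_intros
      all_goals try omega
      intro j t hj
      rw [List.getElem?_append] at hj
      split_ifs at hj with hlt
      · rw [if_neg (by omega)]
        exact hst j t hj
      · have hj1 := (List.getElem?_eq_some_iff.1 hj).1
        simp at hj1
        have hj0 : j - (stackAt (T.stackEvent dir) k).length = 0 := by omega
        rw [hj0] at hj
        rw [if_pos (by omega)]
        simpa using hj
    | true =>
      have hS := stackAt_pop (T.stackEvent dir) (k := k) (by simp [SuffixTree.stackEvent, hm, hl])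
      obtain ⟨l, t, hlt⟩ : ∃ l t, stackAt (T.stackEvent dir) k = l ++ [t] := by
        rcases List.eq_nil_or_concat (stackAt (T.stackEvent dir) k) with h | ⟨l, t, h⟩
        · exact absurd h (stackAt_ne_nil T dir hm hl)
        · exact ⟨l, t, by rw [h, List.concat_eq_append]⟩
      have htk : t < k := lt_of_mem_stackAt (T.stackEvent dir) (by rw [hlt]; simp)
      rw [hlt, List.dropLast_concat] at hS
      rw [hS] at hmask ⊢
      rw [hlt] at h3 h4 h5 hsort hlen hst
      have hat : σ.arr (o + 3) l.length = t := hst _ _ (by simp)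
      have hiff := lt_lowCount_iff (b := k - k % B) hsort (j := l.length) (t := t) (by simp)
      have hst' : ∀ j t, l[j]? = some t → σ.arr (o + 3) j = t := by
        intro j u hj
        refine hst j u ?_
        rw [List.getElem?_append_left (List.getElem?_eq_some_iff.1 hj).1, hj]
      rw [List.length_append, List.length_singleton] at h3 hlen
      -- If the popped element is older than the block, all remaining ones are too, and the low
      -- count drops by one. Otherwise one bit of the mask is cleared.
      by_cases htb : t < k - k % B
      · have hc := hiff.2 htb
        have hll := lowCount_le_length (k - k % B) l
        rw [highMask_append_singleton_of_lt _ htb] at h5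
        have hlc := lowCount_append_singleton_of_lt l htb
        rw [hlc] at h4 hc
        simp [updateStack, wp, hz, h1, hl, h3, h4, h5, hc]
        and_intros
        all_goals omega
      · have hc := fun h => htb (hiff.1 h)
        rw [lowCount_append_singleton _ (by omega)] at h4 hc
        rw [highMask_append_singleton _ (by omega)] at h5
        -- The program addresses the bit by `t % B`; this is the offset in the current block because
        -- `t` and `k` belong to the same block.
        have htB : t % B = t - (k - k % B) := by
          have e1 := Nat.div_add_mod' k B
          have e2 : t = (t - (k - k % B)) + k / B * B := by omega
          have e3 : t % B = ((t - (k - k % B)) + k / B * B) % B := by rw [← e2]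
          rw [e3, Nat.add_mul_mod_self_right, Nat.mod_eq_of_lt (by omega)]
        have hpt : 2 ^ (t - (k - k % B)) < 2 ^ B :=
          Nat.pow_lt_pow_right one_lt_two (by omega)
        simp [updateStack, wp, hz, h1, hl, h3, h4, h5, h6, hat, htB]
        exact ⟨by omega, ⟨by omega, by omega⟩, not_lt.1 hc, fun _ => ⟨⟨⟨by omega, ⟨by omega,
          by omega⟩, by omega⟩, by omega⟩, hst'⟩⟩
  · have hS := stackAt_none (T.stackEvent dir) (k := k) (by simp [SuffixTree.stackEvent, hm])
    refine triple_of_wp_le (Nat.le_of_ble_eq_true rfl) ?_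
    rw [hS]
    simp only [updateStack, wp, ok_eq, ok_reg, ok_ofNat, val_eq, val_reg, val_ofNat, h13.2 hm,
      if_true, ne_eq, one_ne_zero, not_false_eq_true, forall_const, true_and, IsEmpty.forall_iff,
      and_true]
    exact ⟨by omega, h3, hst, h4, h5⟩

theorem triple_moveOn {σ : HState} (h0 : σ.reg 0 = (T.event k).1) (h2 : σ.reg 2 = k)
    (h1 : σ.reg 1 = if (T.event k).2 then 1 else 0)
    (htin : ∀ l < k, ∀ v, T.event l = (v, false) → σ.arr (o + 4) v = l) :
    Triple E (moveOn o) σ 200 fun τ =>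
      τ.reg 0 = (T.event (k + 1)).1 ∧ (τ.reg 1 = if (T.event (k + 1)).2 then 1 else 0) ∧
      ∀ l < k + 1, ∀ v, T.event l = (v, false) → τ.arr (o + 4) v = l := by
  have hb := hI.bounds
  rw [T.event_succ]
  -- No event occurs twice, so an entry time once stored is never overwritten.
  have hev := fun l (hl : l < k) (h : T.event l = T.event k) => T.event_injOn (by omega) hk h
  rcases he : T.event k with ⟨u, b⟩
  rw [he] at h0 h1
  have hu := u.2
  have vN := fun σ => val_nodes hI (σ := σ)
  have oN := fun σ => ok_nodes hI (σ := σ)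
  refine triple_of_wp_le (Nat.le_of_ble_eq_true rfl) ?_
  cases b with
  | false =>
    have vC := val_child hI (σ := σ.setArr (o + 4) u k) (e := reg 0) (v := u) (by simpa using h0)
    have oC := ok_child hI (σ := σ.setArr (o + 4) u k) (e := reg 0) (v := u) (by simpa using h0)
      (by simp)
    have hfin : ∀ l < k + 1, ∀ v, T.event l = (v, false) →
        (if (v : ℕ) = u then k else σ.arr (o + 4) v) = l := by
      intro l hl v hv
      rcases Nat.lt_succ_iff_lt_or_eq.1 hl with h | rfl
      · rw [if_neg, htin l h v hv]
        intro hvu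
        rw [Fin.ext hvu, ← he] at hv
        have := hev l h hv
        omega
      · rw [he] at hv
        rw [if_pos (by rw [(Prod.mk.inj hv).1])]
    simp only [moveOn, wp, h0, h1, h2, ok_eq, val_eq, ok_reg, val_reg, val_ofNat, ok_ofNat, vN, oN,
      vC, oC, HState.setArr_reg, HState.setReg_reg, HState.setArr_arr, HState.setReg_arr, true_and,
      if_true, ite_eq_right_iff, one_ne_zero, imp_false, ne_eq, not_not, Bool.false_eq_true,
      if_false, Nat.reduceEqDiff, not_false_eq_true, IsEmpty.forall_iff, and_true, forall_const,
      LabelledTree.tourStep]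
    refine ⟨by omega, by omega, by omega, fun h => ⟨by omega, ?_⟩, fun h => ?_⟩
    · cases hc : (T.children u).head? with
      | none => exact ⟨rfl, by simp, hfin⟩
      | some c =>
        rw [hc] at h
        have := c.2
        simp only [SuffixTree.pointer] at h
        omega
    · cases hc : (T.children u).head? with
      | none => rw [hc] at h; exact absurd rfl h
      | some c => exact ⟨rfl, by simp, hfin⟩
  | true =>
    have vC := val_sibling hI (σ := σ) (e := reg 0) (v := u) h0
    have oC := ok_sibling hI (σ := σ) (e := reg 0) (v := u) h0 (by simp)
    have vP := val_parent hI (σ := σ) (e := reg 0) (v := u) h0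
    have oP := ok_parent hI (σ := σ) (e := reg 0) (v := u) h0 (by simp)
    have hfin : ∀ l < k + 1, ∀ v, T.event l = (v, false) → σ.arr (o + 4) v = l := by
      intro l hl v hv
      rcases Nat.lt_succ_iff_lt_or_eq.1 hl with h | rfl
      · exact htin l h v hv
      · rw [he] at hv
        simp at hv
    simp only [moveOn, wp, h1, ok_eq, val_eq, ok_reg, val_reg, val_ofNat, ok_ofNat, vN, oN,
      vC, oC, vP, oP, HState.setReg_reg, HState.setReg_arr, true_and,
      if_true, ite_eq_right_iff, one_ne_zero, imp_false, ne_eq, not_not,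
      if_false, Nat.reduceEqDiff, not_true, IsEmpty.forall_iff, and_true, forall_const,
      LabelledTree.tourStep]
    refine ⟨by omega, fun h => ?_, fun h => ⟨by omega, ?_⟩⟩
    · cases hc : T.followingSibling u with
      | none => exact ⟨rfl, by simp, hfin⟩
      | some c =>
        rw [hc] at h
        have := c.2
        simp only [SuffixTree.pointer] at h
        omega
    · cases hc : T.followingSibling u with
      | none => rw [hc] at h; exact absurd rfl h
      | some c => exact ⟨rfl, by simp, hfin⟩

omit hI hk in
theorem triple_record {σ : HState} (h2 : σ.reg 2 = k) (hkX : k + 1 < E.size) :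
    Triple E (record o) σ 200 fun τ =>
      τ.reg 2 = k + 1 ∧
      (∀ x, τ.arr (o + 5) x = if x = k then σ.reg 3 else σ.arr (o + 5) x) ∧
      (∀ x, τ.arr (o + 6) x = if x = k then σ.reg 4 else σ.arr (o + 6) x) ∧
      ∀ x, τ.arr (o + 7) x = if x = k then σ.reg 5 else σ.arr (o + 7) x := by
  have hp : E.base + 32 * E.size ≤ E.cap := E.le_pow
  refine triple_of_wp_le (Nat.le_of_ble_eq_true rfl) ?_
  simp [record, wp, h2]
  and_intros
  all_goals omega

end stages
end WordRAM

/-! ### The invariant of the Euler tour -/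

namespace WordRAM

open HExpr HProg

/-- One event of the Euler tour. -/
def walkStep (o : ℕ) : HProg :=
  .ite (.op .eq (reg 2 % reg 6) 0) (snapshot o) .skip ⨾
  testMark o ⨾ updateStack o ⨾ moveOn o ⨾ record o

/-- The Euler tour. -/
def walk (o : ℕ) : HProg :=
  (.assign 0 root ⨾ .assign 1 0 ⨾ .assign 2 0 ⨾ .assign 3 0) ⨾
  .loop (.op .lt (reg 2) (2 * nodes)) (walkStep o)

variable {s : List ℕ}

/-- What has been recorded about the first `k` events of the Euler tour. -/
structure Recorded (T : SuffixTree s) (dir : Bool) (o k : ℕ) (arr : ℕ → ℕ → ℕ) : Prop where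
  enter : ∀ l < k, ∀ v, T.event l = (v, false) → arr (o + 4) v = l
  length : ∀ l < k, arr (o + 5) l = (stackAt (T.stackEvent dir) (l + 1)).length
  low : ∀ l < k, arr (o + 6) l = blockLow (T.stackEvent dir) (blockSize s.length) l
  mask : ∀ l < k, arr (o + 7) l = blockMask (T.stackEvent dir) (blockSize s.length) l
  node : ∀ l < k, arr (o + 8) l = (T.event l).1

/-- The state before the `k`-th event of the Euler tour. -/
structure WalkInv (T : SuffixTree s) (dir : Bool) (o k : ℕ) (τ : HState) : Prop
    extends Recorded T dir o k τ.arr where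
  current : τ.reg 0 = (T.event k).1
  mode : τ.reg 1 = if (T.event k).2 then 1 else 0
  time : τ.reg 2 = k
  height : τ.reg 3 = (stackAt (T.stackEvent dir) k).length
  stack : ∀ j t, (stackAt (T.stackEvent dir) k)[j]? = some t → τ.arr (o + 3) j = t
  lowReg : k % blockSize s.length ≠ 0 →
    τ.reg 4 = lowCount (k - k % blockSize s.length) (stackAt (T.stackEvent dir) k)
  maskReg : k % blockSize s.length ≠ 0 →
    τ.reg 5 = highMask (k - k % blockSize s.length) (stackAt (T.stackEvent dir) k)
  heads : ∀ i, i * blockSize s.length < k → HeadOk (T.stackEvent dir) (blockSize s.length)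
    (blockCount s.length T.size) (jumpSize s.length T.size) o τ.arr i

theorem lowCount_eq_length {b : ℕ} {l : List ℕ} (h : ∀ t ∈ l, t < b) : lowCount b l = l.length := by
  rw [lowCount, List.filter_eq_self.2]
  simpa using h

theorem highMask_eq_zero {b : ℕ} {l : List ℕ} (h : ∀ t ∈ l, t < b) : highMask b l = 0 := by
  rw [highMask, List.filter_eq_nil_iff.2]
  · rfl
  · simpa using h

theorem sub_mod_eq {k B : ℕ} (h : (k + 1) % B ≠ 0) :
    (k + 1) - (k + 1) % B = k - k % B := by
  have h1 : (k + 1) / B = k / B := by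
    rw [Nat.succ_div, if_neg, Nat.add_zero]
    exact fun hd => h (Nat.mod_eq_zero_of_dvd hd)
  rw [block_start, block_start, h1]

section

variable {T : SuffixTree s} {E : Env} (hI : T.Input E)
include hI

theorem blockSize_mul_blockCount_le :
    blockSize s.length * blockCount s.length T.size ≤ 5 * s.length := by
  have hb := hI.bounds
  have hBn := blockSize_le hI.pos
  have h1 := Nat.mul_div_le (2 * T.size) (blockSize s.length)
  rw [blockCount, mul_add, mul_one]
  omega

/-- The number of blocks is at most `4n + 1`, which is below `16 * 4 ^ B`; hence `κ < 2 * B + 4`. -/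
theorem level_bound {κ : ℕ} (hκ : 2 ^ κ ≤ blockCount s.length T.size) :
    κ + 1 ≤ 6 * blockSize s.length := by
  have hb := hI.bounds
  have hB0 := blockSize_pos s.length
  have h1 := blockCount_le s.length T.size
  have h2 := lt_pow_blockSize s.length
  have h3 : 2 ^ κ < 2 ^ (2 * blockSize s.length + 4) := by
    rw [pow_add, pow_mul]
    norm_num
    omega
  have := (Nat.pow_lt_pow_iff_right one_lt_two).1 h3
  omega

theorem level_mul_jumpSize_le {κ : ℕ} (hκ : κ + 1 ≤ 6 * blockSize s.length) :
    (κ + 1) * jumpSize s.length T.size ≤ E.size := by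
  have hb := hI.bounds
  have hBn := blockSize_le hI.pos
  have h1 := blockSize_mul_blockCount_le hI
  -- With `B * H ≤ 5n` and `B ≤ n` all levels together need at most `186n` elements; this calls for
  -- arrays of length about `200n`.
  calc (κ + 1) * jumpSize s.length T.size
      ≤ 6 * blockSize s.length * jumpSize s.length T.size := Nat.mul_le_mul_right _ hκ
    _ = 36 * (blockSize s.length * blockCount s.length T.size) + 6 * blockSize s.length := by
      rw [jumpSize]; ring
    _ ≤ E.size := by omega

end

variable {T : SuffixTree s} {E : Env} (hI : T.Input E) {o : ℕ} {dir : Bool} (ho : o ≤ 16)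
include hI ho

theorem triple_walkStep {k : ℕ} (hk : k < 2 * T.size) {σ : HState}
    (hx : ∀ p : Fin T.size, IsExtreme T dir T.size p (σ.arr o p))
    (h6 : σ.reg 6 = blockSize s.length) (h7 : σ.reg 7 = blockCount s.length T.size)
    (h12 : σ.reg 12 = jumpSize s.length T.size) (h : WalkInv T dir o k σ) :
    Triple E (walkStep o) σ ((if blockSize s.length ∣ k then
      snapshotTime (blockSize s.length) (blockCount s.length T.size) (k / blockSize s.length)
      else 0) + 820) (WalkInv T dir o (k + 1)) := by
  have hb := hI.bounds
  have hB0 := blockSize_pos s.length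
  have hBn := blockSize_le hI.pos
  have hBH := blockSize_mul_blockCount_le hI
  have hstart := block_start (blockSize s.length) k
  have hnext := fun h => sub_mod_eq (k := k) (B := blockSize s.length) h
  have hM : jumpSize s.length T.size = 6 * blockCount s.length T.size + 1 := rfl
  have hiH : k / blockSize s.length < blockCount s.length T.size :=
    Nat.lt_succ_of_le (Nat.div_le_div_right (by omega))
  have hlev := fun κ hκ => level_mul_jumpSize_le hI (level_bound hI (κ := κ) hκ)
  have hA : Triple E (.ite (.op .eq (reg 2 % reg 6) 0) (snapshot o) .skip) σ
      ((if blockSize s.length ∣ k then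
        snapshotTime (blockSize s.length) (blockCount s.length T.size) (k / blockSize s.length) else 0) + 7) fun τ =>
      τ.reg 4 = lowCount (k - k % blockSize s.length) (stackAt (T.stackEvent dir) k) ∧
      τ.reg 5 = highMask (k - k % blockSize s.length) (stackAt (T.stackEvent dir) k) ∧
      ∀ i, i * blockSize s.length < k + 1 → HeadOk (T.stackEvent dir) (blockSize s.length)
        (blockCount s.length T.size) (jumpSize s.length T.size) o τ.arr i := by
    by_cases hkB : k % blockSize s.length = 0
    · have hkk : k / blockSize s.length * blockSize s.length = k := by omega
      have hlen : headLength (T.stackEvent dir) (blockSize s.length) (k / blockSize s.length) =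
          (stackAt (T.stackEvent dir) k).length := by rw [headLength, hkk]
      -- At a block start all elements are older than the block, so the low count is the height and
      -- the mask is empty. The snapshot sets the registers 4 and 5 accordingly, so the invariant
      -- may leave them unspecified there.
      have hmem : ∀ t ∈ stackAt (T.stackEvent dir) k, t < k - k % blockSize s.length := by
        intro t ht
        have := lt_of_mem_stackAt _ ht
        omega
      rw [if_pos (Nat.dvd_of_mod_eq_zero hkB), lowCount_eq_length hmem, highMask_eq_zero hmem]
      refine (Triple.ite (by simp; omega) (fun _ => triple_snapshot ho hB0 hM
        hiH ?_ hlev (by rw [h.time, hkk]) (by rw [h.height, hlen]) h6 h7 h12 ?_)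
        (fun h' => ?_)).mono ?_ ?_
      · rw [mul_assoc]; omega
      · rw [hkk]; exact h.stack
      · simp [h.time, h6, hkB] at h'
      · have : (op .eq (reg 2 % reg 6) 0).cost = 5 := rfl
        omega
      · rintro τ hf ⟨h1, h2, h3, h4⟩
        refine ⟨by rw [h1, hlen], h2, fun i hi => ?_⟩
        have hik : i ≤ k / blockSize s.length := by
          rw [Nat.le_div_iff_mul_le hB0]; omega
        rcases hik.lt_or_eq with hlt | rfl
        · refine h4 i hlt (h.heads i ?_)
          have : (i + 1) * blockSize s.length ≤ k / blockSize s.length * blockSize s.length :=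
            Nat.mul_le_mul_right _ hlt
          rw [add_mul] at this
          omega
        · exact h3
    · rw [if_neg fun hd => hkB (Nat.mod_eq_zero_of_dvd hd)]
      refine (Triple.ite (by simp; omega) (fun h' => ?_)
        (fun _ => triple_of_wp (p := .skip) ?_)).mono ?_ fun _ _ => id
      · simp [h.time, h6, hkB] at h'
      · refine ⟨h.lowReg hkB, h.maskReg hkB, fun i hi => h.heads i ?_⟩
        rcases Nat.lt_succ_iff_lt_or_eq.1 hi with h' | h'
        · exact h'
        · exact absurd (by rw [← h', Nat.mul_mod_left]) hkB
      · have : (op .eq (reg 2 % reg 6) 0).cost = 5 := rfl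
        change 5 + 1 + 1 ≤ _
        omega
  refine (hA.seq fun τ₁ f₁ q₁ => (triple_testMark hI ho hk (dir := dir) ?_ ?_ ?_).seq
    fun τ₂ f₂ q₂ => (triple_updateStack hI ho hk ?_ ?_ q₂.1 ?_ ?_ ?_ ?_ ?_).seq
    fun τ₃ f₃ q₃ => (triple_moveOn hI ho hk ?_ ?_ ?_ ?_).seq fun τ₄ f₄ q₄ =>
    (triple_record ho (k := k) ?_ ?_).mono le_rfl (Q := WalkInv T dir o (k + 1))
      ?_).mono ?_ fun _ _ => id
  · intro p
    rw [f₁.2 o (by simp [arrs, snapshot, copyStack])]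
    exact hx p
  · rw [f₁.1 0 (by simp [regs, snapshot, copyStack]), h.current]
  · rw [f₁.1 2 (by simp [regs, snapshot, copyStack]), h.time]
  · rw [f₂.1 2 (by simp [regs, testMark]), f₁.1 2 (by simp [regs, snapshot, copyStack]), h.time]
  · rw [f₂.1 1 (by simp [regs, testMark]), f₁.1 1 (by simp [regs, snapshot, copyStack]), h.mode]
  · rw [f₂.1 6 (by simp [regs, testMark]), f₁.1 6 (by simp [regs, snapshot, copyStack]), h6]
  · rw [f₂.1 3 (by simp [regs, testMark]), f₁.1 3 (by simp [regs, snapshot, copyStack]), h.height]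
  · intro j t hj
    rw [f₂.2 (o + 3) (by simp [arrs, testMark]), f₁.2 (o + 3) (by simp [arrs, snapshot, copyStack])]
    exact h.stack j t hj
  · rw [f₂.1 4 (by simp [regs, testMark]), q₁.1]
  · rw [f₂.1 5 (by simp [regs, testMark]), q₁.2.1]
  · rw [f₃.1 0 (by simp [regs, updateStack]), f₂.1 0 (by simp [regs, testMark]),
      f₁.1 0 (by simp [regs, snapshot, copyStack]), h.current]
  · rw [f₃.1 2 (by simp [regs, updateStack]), f₂.1 2 (by simp [regs, testMark]),
      f₁.1 2 (by simp [regs, snapshot, copyStack]), h.time]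
  · rw [f₃.1 1 (by simp [regs, updateStack]), f₂.1 1 (by simp [regs, testMark]),
      f₁.1 1 (by simp [regs, snapshot, copyStack]), h.mode]
  · rw [f₃.2 (o + 4) (by simp [arrs, updateStack]), f₂.2 (o + 4) (by simp [arrs, testMark]),
      f₁.2 (o + 4) (by simp [arrs, snapshot, copyStack])]
    exact h.enter
  · rw [f₄.1 2 (by simp [regs, moveOn]), f₃.1 2 (by simp [regs, updateStack]),
      f₂.1 2 (by simp [regs, testMark]), f₁.1 2 (by simp [regs, snapshot, copyStack]), h.time]
  · omega
  · rintro τ f₅ ⟨w2, w5, w6, w7⟩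
    have g5 : τ₄.arr (o + 5) = σ.arr (o + 5) := by
      rw [f₄.2 _ (by simp [arrs, moveOn]), f₃.2 _ (by simp [arrs, updateStack]),
        f₂.2 _ (by simp [arrs, testMark]), f₁.2 _ (by simp [arrs, snapshot, copyStack])]
    have g6 : τ₄.arr (o + 6) = σ.arr (o + 6) := by
      rw [f₄.2 _ (by simp [arrs, moveOn]), f₃.2 _ (by simp [arrs, updateStack]),
        f₂.2 _ (by simp [arrs, testMark]), f₁.2 _ (by simp [arrs, snapshot, copyStack])]
    have g7 : τ₄.arr (o + 7) = σ.arr (o + 7) := by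
      rw [f₄.2 _ (by simp [arrs, moveOn]), f₃.2 _ (by simp [arrs, updateStack]),
        f₂.2 _ (by simp [arrs, testMark]), f₁.2 _ (by simp [arrs, snapshot, copyStack])]
    have g8 : τ.arr (o + 8) = τ₂.arr (o + 8) := by
      rw [f₅.2 _ (by simp [arrs, record]), f₄.2 _ (by simp [arrs, moveOn]),
        f₃.2 _ (by simp [arrs, updateStack])]
    have g8' : τ₁.arr (o + 8) = σ.arr (o + 8) := f₁.2 _ (by simp [arrs, snapshot, copyStack])
    have g3 : τ.arr (o + 3) = τ₃.arr (o + 3) := by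
      rw [f₅.2 _ (by simp [arrs, record]), f₄.2 _ (by simp [arrs, moveOn])]
    have g4 : τ.arr (o + 4) = τ₄.arr (o + 4) := f₅.2 _ (by simp [arrs, record])
    have gh : ∀ a, 9 ≤ a → τ.arr (o + a) = τ₁.arr (o + a) := by
      intro a ha
      rw [f₅.2 _ (by simp [arrs, record]; omega), f₄.2 _ (by simp [arrs, moveOn]; omega),
        f₃.2 _ (by simp [arrs, updateStack]; omega), f₂.2 _ (by simp [arrs, testMark]; omega)]
    have r3 : τ₄.reg 3 = τ₃.reg 3 := f₄.1 _ (by simp [regs, moveOn])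
    have r4 : τ₄.reg 4 = τ₃.reg 4 := f₄.1 _ (by simp [regs, moveOn])
    have r5 : τ₄.reg 5 = τ₃.reg 5 := f₄.1 _ (by simp [regs, moveOn])
    have t3 : τ.reg 3 = τ₃.reg 3 := by rw [f₅.1 _ (by simp [regs, record]), r3]
    have t4 : τ.reg 4 = τ₃.reg 4 := by rw [f₅.1 _ (by simp [regs, record]), r4]
    have t5 : τ.reg 5 = τ₃.reg 5 := by rw [f₅.1 _ (by simp [regs, record]), r5]
    refine ⟨⟨?_, ?_, ?_, ?_, ?_⟩, ?_, ?_, w2, ?_, ?_, ?_, ?_, ?_⟩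
    · rw [g4]; exact q₄.2.2
    · intro l hl
      rw [w5, g5, r3, q₃.1]
      split_ifs with hlk
      · rw [hlk]
      · exact h.length l (by omega)
    · intro l hl
      rw [w6, g6, r4, q₃.2.2.1]
      split_ifs with hlk
      · rw [hlk]
      · exact h.low l (by omega)
    · intro l hl
      rw [w7, g7, r5, q₃.2.2.2]
      split_ifs with hlk
      · rw [hlk]
      · exact h.mask l (by omega)
    · intro l hl
      rw [g8, q₂.2, g8']
      split_ifs with hlk
      · rw [hlk]
      · exact h.node l (by omega)
    · rw [f₅.1 _ (by simp [regs, record]), q₄.1]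
    · rw [f₅.1 _ (by simp [regs, record]), q₄.2.1]
    · rw [t3, q₃.1]
    · rw [g3]; exact q₃.2.1
    · intro hk1
      rw [t4, q₃.2.2.1, hnext hk1, blockLow]
    · intro hk1
      rw [t5, q₃.2.2.2, hnext hk1, blockMask]
    · intro i hi
      have := q₁.2.2 i hi
      exact ⟨by rw [gh 9 (by omega)]; exact this.length, by rw [gh 10 (by omega)]; exact this.near,
        fun κ h1 h2 => by unfold JumpOk; rw [gh 11 (by omega)]; exact this.jump κ h1 h2⟩
  · omega

end WordRAM

/-! ### Total time of the preprocessing -/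

namespace WordRAM

open HExpr HProg

theorem sum_range_mul_dvd {B : ℕ} (hB : 0 < B) (f : ℕ → ℕ) (q : ℕ) :
    ∑ k ∈ Finset.range (q * B), (if B ∣ k then f (k / B) else 0) = ∑ i ∈ Finset.range q, f i := by
  induction q with
  | zero => simp
  | succ q ih =>
    rw [Nat.succ_mul, Finset.sum_range_add, ih, Finset.sum_range_succ,
      Finset.sum_eq_single_of_mem 0 (Finset.mem_range.2 hB)]
    · simp [Nat.mul_div_cancel _ hB]
    · intro x hx hx0
      rw [if_neg]
      rw [Nat.dvd_add_right (dvd_mul_left B q)]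
      exact fun h => hx0 (Nat.eq_zero_of_dvd_of_lt h (Finset.mem_range.1 hx))

theorem sum_range_dvd_le {B : ℕ} (hB : 0 < B) (f : ℕ → ℕ) {N q : ℕ} (h : N ≤ q * B) :
    ∑ k ∈ Finset.range N, (if B ∣ k then f (k / B) else 0) ≤ ∑ i ∈ Finset.range q, f i := by
  rw [← sum_range_mul_dvd hB f q]
  refine Finset.sum_le_sum_of_subset fun x hx =>
    Finset.mem_range.2 ((Finset.mem_range.1 hx).trans_le h)

/-- Level `κ` costs a multiple of `2 ^ κ`, but only at every `2 ^ κ`-th block, hence O(H) per level;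
there are at most `6 * B` levels. -/
theorem sum_snapshotTime_le {B H : ℕ} (hH : 0 < H) (hκ : Nat.log 2 H + 1 ≤ 6 * B) :
    ∑ i ∈ Finset.range H, snapshotTime B H i ≤ 25000 * (B * H) := by
  have h1 : ∀ κ ∈ Finset.range (Nat.log 2 H + 1),
      ∑ i ∈ Finset.range H, (if 2 ^ κ ∣ i then 2000 * 2 ^ κ else 0) ≤ 4000 * H := by
    intro κ hk
    have hp : 2 ^ κ ≤ H := (Nat.pow_le_pow_right two_pos
      (Nat.lt_succ_iff.1 (Finset.mem_range.1 hk))).trans (Nat.pow_log_le_self 2 hH.ne')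
    have h2 := Nat.div_mul_le_self H (2 ^ κ)
    have h3 := Nat.div_add_mod' H (2 ^ κ)
    have h4 := Nat.mod_lt H (Nat.two_pow_pos κ)
    refine (sum_range_dvd_le (Nat.two_pow_pos κ) (fun _ => 2000 * 2 ^ κ)
      (q := H / 2 ^ κ + 1) (by rw [add_mul, one_mul]; omega)).trans ?_
    rw [Finset.sum_const, Finset.card_range, smul_eq_mul]
    calc (H / 2 ^ κ + 1) * (2000 * 2 ^ κ) = 2000 * (H / 2 ^ κ * 2 ^ κ + 2 ^ κ) := by ring
      _ ≤ 4000 * H := by omega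
  have h2 := Finset.sum_le_sum h1
  rw [Finset.sum_const, Finset.card_range, smul_eq_mul] at h2
  have h3 : (Nat.log 2 H + 1) * (4000 * H) ≤ 6 * B * (4000 * H) := Nat.mul_le_mul_right _ hκ
  unfold snapshotTime
  rw [Finset.sum_add_distrib, Finset.sum_comm, Finset.sum_const, Finset.card_range, smul_eq_mul]
  calc _ ≤ H * (1000 * B) + 6 * B * (4000 * H) := Nat.add_le_add_left (h2.trans h3) _
    _ = 25000 * (B * H) := by ring

/-- The part of the preprocessing for the queries of one direction. -/
def buildFor (o : ℕ) (dir : Bool) : HProg :=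
  params o ⨾ extremeChild o dir ⨾ selectTable o ⨾ logTable o ⨾ walk o

variable {s : List ℕ}

/-- The data structure for the queries of one direction. -/
structure DataFor (T : SuffixTree s) (dir : Bool) (o : ℕ) (arr : ℕ → ℕ → ℕ) : Prop
    extends Recorded T dir o (2 * T.size) arr where
  heads : ∀ i, i * blockSize s.length < 2 * T.size →
    HeadOk (T.stackEvent dir) (blockSize s.length)
      (blockCount s.length T.size) (jumpSize s.length T.size) o arr i
  select : ∀ y < blockSize s.length * 2 ^ blockSize s.length,
    arr (o + 1) y = bitSelect (y / blockSize s.length) (y % blockSize s.length)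
  log : ∀ x < blockCount s.length T.size, arr (o + 2) x = Nat.log 2 x
  block : arr (o + 12) 0 = blockSize s.length
  jump : arr (o + 12) 1 = jumpSize s.length T.size

variable {T : SuffixTree s} {E : Env} (hI : T.Input E) {o : ℕ} {dir : Bool} (ho : o ≤ 16)
include hI ho

theorem triple_walk {σ : HState}
    (hx : ∀ p : Fin T.size, IsExtreme T dir T.size p (σ.arr o p))
    (h6 : σ.reg 6 = blockSize s.length) (h7 : σ.reg 7 = blockCount s.length T.size)
    (h12 : σ.reg 12 = jumpSize s.length T.size) :
    Triple E (walk o) σ (130000 * s.length) (WalkInv T dir o (2 * T.size)) := by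
  have hb := hI.bounds
  have hB0 := blockSize_pos s.length
  have hBH := blockSize_mul_blockCount_le hI
  have vR := fun σ => val_root hI (σ := σ)
  have oR := fun σ => ok_root hI (σ := σ)
  have vN := fun σ => val_nodes hI (σ := σ)
  have oN := fun σ => ok_nodes hI (σ := σ)
  refine ((triple_of_wp (Q := WalkInv T dir o 0) ?_).seq fun τ hf hτ =>
    triple_loop (2 * T.size) (fun k => (if blockSize s.length ∣ k then
      snapshotTime (blockSize s.length) (blockCount s.length T.size) (k / blockSize s.length)
      else 0) + 820) (WalkInv T dir o) ?_ ?_ hτ).mono ?_ fun _ _ => id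
  · simp only [wp, ok_ofNat, val_ofNat, oR, vR, true_and]
    refine ⟨by omega, by omega, by omega, ?_⟩
    constructor
    · exact ⟨by simp, by simp, by simp, by simp, by simp⟩
    all_goals simp [LabelledTree.event, stackAt]
  · intro k hk υ hf' hυ
    have hfr : ∀ r, r ≠ 0 → r ≠ 1 → r ≠ 2 → r ≠ 3 → r ≠ 4 → r ≠ 5 → r ≠ 8 → r ≠ 9 → r ≠ 10 →
        r ≠ 13 → υ.reg r = σ.reg r := by
      intro r a0 a1 a2 a3 a4 a5 a8 a9 a10 a13
      rw [hf'.1 r (by simp [regs, walkStep, snapshot, copyStack, testMark, updateStack, moveOn,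
        record, *]), hf.1 r (by simp [regs, *])]
    have hox : υ.arr o = σ.arr o := by
      rw [hf'.2 o (by simp [arrs, walkStep, snapshot, copyStack, testMark, updateStack, moveOn,
        record]), hf.2 o (by simp [arrs])]
    refine ⟨?_, ?_, triple_walkStep hI ho hk (by rw [hox]; exact hx) ?_ ?_ ?_ hυ⟩
    · simp [oN, vN]; omega
    · simp [vN, hυ.time, hk]
    · rw [hfr 6, h6] <;> decide
    · rw [hfr 7, h7] <;> decide
    · rw [hfr 12, h12] <;> decide
  · intro υ _ hυ
    simp [oN, vN, hυ.time]
    omega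
  · have e1 : (HProg.assign 0 root ⨾ .assign 1 0 ⨾ .assign 2 0 ⨾ .assign 3 0).time ≤ 50 :=
      Nat.le_of_ble_eq_true rfl
    have e2 : (op .lt (reg 2) (2 * nodes)).cost ≤ 20 := Nat.le_of_ble_eq_true rfl
    generalize (op .lt (reg 2) (2 * nodes)).cost = c at *
    -- The additional block in `blockCount` covers an incomplete last block.
    have hN : 2 * T.size ≤ blockCount s.length T.size * blockSize s.length := by
      have h1 := Nat.div_add_mod' (2 * T.size) (blockSize s.length)
      have h2 := Nat.mod_lt (2 * T.size) hB0
      rw [blockCount, add_mul, one_mul]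
      omega
    have hH : 0 < blockCount s.length T.size := Nat.succ_pos _
    have h3 := (sum_range_dvd_le hB0 (snapshotTime (blockSize s.length)
      (blockCount s.length T.size)) hN).trans
      (sum_snapshotTime_le hH (level_bound hI (Nat.pow_log_le_self 2 hH.ne')))
    simp only [Finset.sum_add_distrib, Finset.sum_const, Finset.card_range, smul_eq_mul]
    have h4 : 2 * T.size * c ≤ 2 * T.size * 20 := Nat.mul_le_mul_left _ e2
    generalize 2 * T.size * c = z at *
    omega

theorem triple_buildFor {σ : HState} (h0 : ∀ x, σ.arr o x = 0) :
    Triple E (buildFor o dir) σ (134000 * s.length) fun τ => DataFor T dir o τ.arr := by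
  refine ((triple_params hI ho σ).seq fun τ₁ f₁ q₁ =>
    (triple_extremeChild hI dir ho τ₁ ?_).seq fun τ₂ f₂ q₂ =>
    (triple_selectTable hI ho τ₂ ?_).seq fun τ₃ f₃ q₃ =>
    (triple_logTable hI ho τ₃ ?_).seq fun τ₄ f₄ q₄ =>
    (triple_walk hI ho (dir := dir) ?_ ?_ ?_ ?_).mono le_rfl
      (Q := fun τ => DataFor T dir o τ.arr) ?_).mono ?_ fun _ _ => id
  · intro x
    rw [f₁.2 o (by simp [arrs, params]), h0]
  · rw [f₂.1 6 (by simp [regs, extremeChild]), q₁.1]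
  · rw [f₃.1 7 (by simp [regs, selectTable]), f₂.1 7 (by simp [regs, extremeChild]), q₁.2.1]
  · intro p
    rw [f₄.2 o (by simp [arrs, logTable]), f₃.2 o (by simp [arrs, selectTable])]
    exact q₂ p
  · rw [f₄.1 6 (by simp [regs, logTable]), f₃.1 6 (by simp [regs, selectTable]),
      f₂.1 6 (by simp [regs, extremeChild]), q₁.1]
  · rw [f₄.1 7 (by simp [regs, logTable]), f₃.1 7 (by simp [regs, selectTable]),
      f₂.1 7 (by simp [regs, extremeChild]), q₁.2.1]
  · rw [f₄.1 12 (by simp [regs, logTable]), f₃.1 12 (by simp [regs, selectTable]),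
      f₂.1 12 (by simp [regs, extremeChild]), q₁.2.2.1]
  · intro τ f₅ h
    have w : ∀ a, a ≤ 2 ∨ a = 12 → τ.arr (o + a) = τ₄.arr (o + a) := by
      intro a ha
      refine f₅.2 _ ?_
      simp [arrs, walk, walkStep, snapshot, copyStack, testMark, updateStack, moveOn, record]
      omega
    refine ⟨h.toRecorded, h.heads, ?_, ?_, ?_, ?_⟩
    · rw [w 1 (by simp), f₄.2 _ (by simp [arrs, logTable])]
      exact q₃
    · rw [w 2 (by simp)]
      exact q₄
    · rw [w 12 (by simp), f₄.2 _ (by simp [arrs, logTable]), f₃.2 _ (by simp [arrs, selectTable]),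
        f₂.2 _ (by simp [arrs, extremeChild])]
      exact q₁.2.2.2.1
    · rw [w 12 (by simp), f₄.2 _ (by simp [arrs, logTable]), f₃.2 _ (by simp [arrs, selectTable]),
        f₂.2 _ (by simp [arrs, extremeChild])]
      exact q₁.2.2.2.2
  · omega

end WordRAM

namespace WordRAM

open HExpr HProg

/-! ### Queries -/

/-- Jumps to an element whose height on the stack is close to the wanted one. -/
def farJump (o : ℕ) : HProg :=
  .ite (.op .lt (reg 3) (arr (o + 6) (reg 2)))
    (.assign 4 (reg 2 / arr (o + 12) 0) ⨾
      .assign 5 (arr (o + 2) ((arr (o + 9) (reg 4) - 1 - reg 3) / arr (o + 12) 0)) ⨾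
      .assign 6 (.op .shl (.op .shr (reg 4) (reg 5)) (reg 5)) ⨾
      .assign 7 ((arr (o + 9) (reg 6) - 1 - reg 3) / arr (o + 12) 0) ⨾
      .assign 2 (arr (o + 11) (reg 5 * arr (o + 12) 1 + 3 * reg 6 + reg 7)))
    .skip

/-- Finds the element of the stack with the wanted height. -/
def nearJump (o : ℕ) : HProg :=
  .ite (.op .lt (reg 3) (arr (o + 6) (reg 2)))
    (.assign 4 (reg 2 / arr (o + 12) 0) ⨾
      .assign 2 (arr (o + 10) (2 * arr (o + 12) 0 * reg 4 + (arr (o + 9) (reg 4) - 1 - reg 3))))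
    (.assign 2 (reg 2 - reg 2 % arr (o + 12) 0 +
      arr (o + 1) (arr (o + 7) (reg 2) * arr (o + 12) 0 + (reg 3 - arr (o + 6) (reg 2)))))

/-- Finds a marked ancestor. -/
def findMarked (o : ℕ) : HProg :=
  .assign 2 (arr (o + 4) (reg 0)) ⨾
  .ite (.op .lt (arr (o + 5) (reg 2)) (reg 1)) (.assign 0 nodes)
    (.assign 3 (arr (o + 5) (reg 2) - reg 1) ⨾ farJump o ⨾ nearJump o ⨾
      .assign 0 (parent (arr (o + 8) (reg 2))))

/-- The elements that are at least `b` are distinct and lie in an interval of length `B`. This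
bounds the rank that is looked up in the selection table. -/
theorem length_le_lowCount_add {b B : ℕ} {l : List ℕ} (h : l.Pairwise (· < ·))
    (hl : ∀ t ∈ l, t < b + B) : l.length ≤ lowCount b l + B := by
  have h1 : (l.filter (b ≤ ·)).toFinset ⊆ Finset.Ico b (b + B) := by
    intro t ht
    simp only [List.mem_toFinset, List.mem_filter, decide_eq_true_eq] at ht
    exact Finset.mem_Ico.2 ⟨ht.2, hl t ht.1⟩
  have h2 := Finset.card_le_card h1
  rw [List.toFinset_card_of_nodup ((h.filter _).imp fun h => ne_of_lt h), Nat.card_Ico] at h2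
  have h3 := congrArg List.length (filter_append_filter (b := b) h)
  rw [List.length_append] at h3
  unfold lowCount
  omega

section

variable {s : List ℕ} {T : SuffixTree s} {E : Env} (hI : T.Input E) {o : ℕ} {dir : Bool}
  (ho : o ≤ 16) {σ : HState} (hD : DataFor T dir o σ.arr)
include hI ho hD

/-- If the element is in the current block, nothing is done. Otherwise the jump lands on a push time
whose stack still contains the element at height `j`, with at most `B` elements from `j` upwards;
this is the second alternative of the conclusion. -/
theorem triple_farJump {t j τ : ℕ} (ht : t < 2 * T.size) (h2 : σ.reg 2 = t) (h3 : σ.reg 3 = j)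
    (h : (stackAt (T.stackEvent dir) (t + 1))[j]? = some τ) :
    Triple E (farJump o) σ 500 fun ρ => ∃ t' < 2 * T.size, ρ.reg 2 = t' ∧
      (stackAt (T.stackEvent dir) (t' + 1))[j]? = some τ ∧
      (blockLow (T.stackEvent dir) (blockSize s.length) t' ≤ j ∨
        T.stackEvent dir t' = some false ∧
        (stackAt (T.stackEvent dir) (t' + 1)).length ≤ j + blockSize s.length) := by
  have hb := hI.bounds
  have hB0 := blockSize_pos s.length
  have hBn := blockSize_le hI.pos
  have a12 := hD.block
  have b12 := hD.jump
  have a6 := hD.low t ht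
  refine triple_of_wp_le (Nat.le_of_ble_eq_true rfl) ?_
  by_cases hlow : j < blockLow (T.stackEvent dir) (blockSize s.length) t
  · have hhead := getElem?_head_of_lt _ h hlow
    obtain ⟨i, hi⟩ : ∃ i, t / blockSize s.length = i := ⟨_, rfl⟩
    rw [hi] at hhead
    have hiB : i * blockSize s.length ≤ t := hi ▸ Nat.div_mul_le_self _ _
    have hjl : j < headLength (T.stackEvent dir) (blockSize s.length) i :=
      (List.getElem?_eq_some_iff.1 hhead).1
    have hlen : headLength (T.stackEvent dir) (blockSize s.length) i ≤ i * blockSize s.length :=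
      length_stackAt_le _ _
    have a9 := (hD.heads i (by omega)).length
    obtain ⟨q, hq⟩ : ∃ q, (headLength (T.stackEvent dir) (blockSize s.length) i - 1 - j) /
      blockSize s.length = q := ⟨_, rfl⟩
    have hiH : i < blockCount s.length T.size :=
      hi ▸ Nat.lt_succ_of_le (Nat.div_le_div_right (by omega))
    -- The height at the start of block `i` is at most `i * B`, so `q` is an admissible index of the
    -- logarithm table.
    have hqi : q ≤ i := by
      rw [← hq, Nat.div_le_iff_le_mul hB0]; omega
    obtain ⟨κ, hκ⟩ : ∃ κ, Nat.log 2 q = κ := ⟨_, rfl⟩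
    have a2 := hD.log q (by omega)
    rw [hκ] at a2
    have hκH : 2 ^ κ ≤ blockCount s.length T.size := by
      by_cases hq0 : q = 0
      · rw [hq0, Nat.log_zero_right] at hκ
        rw [← hκ, pow_zero]
        omega
      · exact (hκ ▸ Nat.pow_log_le_self 2 hq0).trans (by omega)
    have hjmp := getElem?_jump _ hhead hq.symm hκ.symm
    have hidx := jump_index_lt _ hB0 hhead hq.symm hκ.symm
    have htgt := fun e x he hx => jump_target _ hB0 hhead hq.symm hκ.symm (e := e) (x := x) he hx
    have hi' := jumpBlock_le i κ
    have hdvd : 2 ^ κ ∣ jumpBlock i κ := dvd_mul_left _ _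
    have hjb : i / 2 ^ κ * 2 ^ κ = jumpBlock i κ := rfl
    generalize jumpBlock i κ = i' at *
    have hiB' : i' * blockSize s.length ≤ i * blockSize s.length := Nat.mul_le_mul_right _ hi'
    have hO := hD.heads i' (by omega)
    have a9' := hO.length
    have hjl' : j < headLength (T.stackEvent dir) (blockSize s.length) i' :=
      (List.getElem?_eq_some_iff.1 hjmp).1
    have hlen' : headLength (T.stackEvent dir) (blockSize s.length) i' ≤
      i' * blockSize s.length := length_stackAt_le _ _
    obtain ⟨e, he⟩ : ∃ e, (headLength (T.stackEvent dir) (blockSize s.length) i' - 1 - j) /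
      blockSize s.length = e := ⟨_, rfl⟩
    rw [he] at hidx
    have heB : e * blockSize s.length ≤
      headLength (T.stackEvent dir) (blockSize s.length) i' - 1 - j := he ▸ Nat.div_mul_le_self _ _
    obtain ⟨x, hx⟩ : ∃ x, (stackAt (T.stackEvent dir) (i' * blockSize s.length))[headLength
        (T.stackEvent dir) (blockSize s.length) i' - 1 - e * blockSize s.length]? = some x :=
      ⟨_, List.getElem?_eq_getElem (by change _ < headLength _ _ _; omega)⟩
    have a11 := hO.jump κ hdvd hκH e hidx (by omega) x hx
    obtain ⟨g1, g2⟩ := htgt e x he.symm hx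
    have hxt := lt_of_getElem?_stackAt _ hx
    have hM : jumpSize s.length T.size = 6 * blockCount s.length T.size + 1 := rfl
    have hlev := level_mul_jumpSize_le hI (level_bound hI hκH)
    rw [add_mul, one_mul] at hlev
    simp [farJump, wp, h2, h3, a12, b12, a6, hlow, hi, a9, hq, a2, hjb, a9', he, a11]
    and_intros
    all_goals first | omega | skip
    exact .inr ⟨(stackAt_of_getElem? _ hx).1, g2⟩
  · simp [farJump, wp, h2, h3, a6, hlow]
    exact ⟨by omega, ht, h, .inl (not_lt.1 hlow)⟩

/-- Either the element belongs to the current block and is selected from the mask, or it was on the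
stack at the block start; then `near_index_lt` places it among the stored top elements. -/
theorem triple_nearJump {t j τ : ℕ} (ht : t < 2 * T.size) (h2 : σ.reg 2 = t) (h3 : σ.reg 3 = j)
    (h : (stackAt (T.stackEvent dir) (t + 1))[j]? = some τ)
    (hj : blockLow (T.stackEvent dir) (blockSize s.length) t ≤ j ∨
        T.stackEvent dir t = some false ∧
        (stackAt (T.stackEvent dir) (t + 1)).length ≤ j + blockSize s.length) :
    Triple E (nearJump o) σ 500 fun ρ => ρ.reg 2 = τ := by
  have hb := hI.bounds
  have hB0 := blockSize_pos s.length
  have hBn := blockSize_le hI.pos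
  have a12 := hD.block
  have a6 := hD.low t ht
  have a7 := hD.mask t ht
  have hτ := lt_of_getElem?_stackAt _ h
  refine triple_of_wp_le (Nat.le_of_ble_eq_true rfl) ?_
  by_cases hlow : j < blockLow (T.stackEvent dir) (blockSize s.length) t
  · obtain ⟨hev, hlenj⟩ := hj.resolve_left (not_le.2 hlow)
    have hnear := near_index_lt _ hB0 hlenj hev
    have hhead := getElem?_head_of_lt _ h hlow
    obtain ⟨i, hi⟩ : ∃ i, t / blockSize s.length = i := ⟨_, rfl⟩
    rw [hi] at hhead hnear
    have hiB : i * blockSize s.length ≤ t := hi ▸ Nat.div_mul_le_self _ _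
    have hjl : j < headLength (T.stackEvent dir) (blockSize s.length) i :=
      (List.getElem?_eq_some_iff.1 hhead).1
    have hlen : headLength (T.stackEvent dir) (blockSize s.length) i ≤ i * blockSize s.length :=
      length_stackAt_le _ _
    have hO := hD.heads i (by omega)
    have a9 := hO.length
    have a10 := hO.near _ hnear (by omega) τ (by rwa [show headLength (T.stackEvent dir)
      (blockSize s.length) i - 1 - (headLength (T.stackEvent dir) (blockSize s.length) i - 1 - j) =
      j by omega])
    have hcomm : 2 * blockSize s.length * i = 2 * (i * blockSize s.length) := by ring
    rw [hcomm] at a10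
    have : i ≤ i * blockSize s.length := Nat.le_mul_of_pos_right _ hB0
    simp [nearJump, wp, h2, h3, a12, a6, hlow, hi, a9, hcomm, a10]
    and_intros
    all_goals omega
  · have hbd : ∀ u ∈ stackAt (T.stackEvent dir) (t + 1),
        u < t - t % blockSize s.length + blockSize s.length := by
      intro u hu
      have := lt_of_mem_stackAt _ hu
      have := Nat.mod_lt t hB0
      have := Nat.mod_le t (blockSize s.length)
      omega
    have hmask := highMask_lt (pairwise_stackAt (T.stackEvent dir) (t + 1)) hbd
    have hlen := length_le_lowCount_add (pairwise_stackAt (T.stackEvent dir) (t + 1)) hbd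
    change _ ≤ blockLow (T.stackEvent dir) (blockSize s.length) t + _ at hlen
    change blockMask (T.stackEvent dir) (blockSize s.length) t < _ at hmask
    have hsel := add_bitSelect_blockMask _ h (not_lt.1 hlow)
    have htB := Nat.mod_lt t hB0
    have hjB : j - blockLow (T.stackEvent dir) (blockSize s.length) t < blockSize s.length := by
      have := (List.getElem?_eq_some_iff.1 h).1
      omega
    have hBB := blockSize_mul_two_pow_le hI.pos
    have hmB : (blockMask (T.stackEvent dir) (blockSize s.length) t + 1) * blockSize s.length ≤
        2 ^ blockSize s.length * blockSize s.length := Nat.mul_le_mul_right _ hmask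
    rw [add_mul, one_mul, mul_comm (2 ^ _)] at hmB
    have a1 := hD.select (blockMask (T.stackEvent dir) (blockSize s.length) t *
      blockSize s.length + (j - blockLow (T.stackEvent dir) (blockSize s.length) t)) (by omega)
    rw [Nat.mul_add_mod_of_lt hjB, mul_comm (blockMask _ _ _), Nat.mul_add_div hB0,
      Nat.div_eq_of_lt hjB, add_zero, mul_comm (blockSize s.length)] at a1
    have := Nat.mod_le t (blockSize s.length)
    have := length_stackAt_le (T.stackEvent dir) (t + 1)
    have := (List.getElem?_eq_some_iff.1 h).1
    simp [nearJump, wp, h2, h3, a12, a6, a7, hlow, a1]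
    and_intros
    all_goals omega

theorem triple_findMarked {v : Fin T.size} (hv : σ.reg 0 = v) (hd : 1 ≤ σ.reg 1)
    {k : ℕ} (hk : k < 2 * T.size) (hkv : T.event k = (v, false)) :
    Triple E (findMarked o) σ 2000 fun ρ => ρ.reg 0 =
      T.pointer ((T.nthMarked dir k (σ.reg 1)).map fun t => T.parent (T.event t).1) := by
  have hb := hI.bounds
  have a5 := hD.length k hk
  have hlen := length_stackAt_le (T.stackEvent dir) (k + 1)
  unfold SuffixTree.nthMarked
  refine ((triple_of_wp (Q := fun τ => τ.reg 2 = k ∧ τ.arr = σ.arr) ?_).seq fun τ₁ f₁ q₁ =>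
    Triple.ite (t := 1500) ?_ (fun h => ?_) (fun h => ?_)).mono ?_ fun _ _ => id
  · have := v.2
    simp [wp, hv, hD.enter k hk v hkv]
    omega
  · simp [q₁]
    omega
  · have r1 : τ₁.reg 1 = σ.reg 1 := f₁.1 1 (by simp [regs])
    simp only [val_lt, val_arr, val_reg, q₁, a5, r1] at h
    rw [if_pos (by by_contra hlt; simp [hlt] at h)]
    refine triple_of_wp_le (Nat.le_of_ble_eq_true rfl) ?_
    simp [wp, ok_nodes hI, val_nodes hI, SuffixTree.pointer]
  · have r1 : τ₁.reg 1 = σ.reg 1 := f₁.1 1 (by simp [regs])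
    simp only [val_lt, val_arr, val_reg, q₁, a5, r1] at h
    have hlt : ¬ (stackAt (T.stackEvent dir) (k + 1)).length < σ.reg 1 := by
      intro hlt; simp [hlt] at h
    rw [if_neg hlt]
    obtain ⟨x, hx⟩ : ∃ x, (stackAt (T.stackEvent dir) (k + 1))[
        (stackAt (T.stackEvent dir) (k + 1)).length - σ.reg 1]? = some x :=
      ⟨_, List.getElem?_eq_getElem (by omega)⟩
    have hxk := lt_of_getElem?_stackAt _ hx
    rw [hx]
    refine ((triple_of_wp (Q := fun τ => τ.reg 3 = (stackAt (T.stackEvent dir) (k + 1)).length -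
      σ.reg 1) ?_).seq fun τ₂ f₂ q₂ => (triple_farJump hI ho ?_ hk ?_ q₂ hx).seq
      fun τ₃ f₃ ⟨t, ht, q₃, ht', hj⟩ => (triple_nearJump hI ho ?_ ht q₃ ?_ ht' hj).seq
      fun τ₄ f₄ q₄ => triple_of_wp_le (t := 100) (Nat.le_of_ble_eq_true rfl) ?_).mono ?_
      fun _ _ => id
    · simp [wp, q₁, r1, a5]
      omega
    · rw [show τ₂.arr = σ.arr from (funext fun i => f₂.2 i (by simp [arrs])).trans q₁.2]
      exact hD
    · rw [f₂.1 2 (by simp [regs]), q₁.1]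
    · rw [show τ₃.arr = σ.arr from (funext fun i => (f₃.2 i (by simp [arrs, farJump])).trans
        (f₂.2 i (by simp [arrs]))).trans q₁.2]
      exact hD
    · rw [f₃.1 3 (by simp [regs, farJump]), q₂]
    · have hnode : (arr (o + 8) (reg 2)).val E τ₄ = (T.event x).1 := by
        rw [val_arr, val_reg, q₄, show τ₄.arr = σ.arr from
          (funext fun i => (f₄.2 i (by simp [arrs, nearJump])).trans
          ((f₃.2 i (by simp [arrs, farJump])).trans (f₂.2 i (by simp [arrs])))).trans q₁.2]
        exact hD.node x (by omega)
      refine ⟨ok_parent hI hnode ?_, ?_⟩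
      · simp [q₄]; omega
      · rw [val_parent hI hnode]
        simp [SuffixTree.pointer]
    · have : (HProg.assign 3 (arr (o + 5) (reg 2) - reg 1)).time ≤ 100 :=
        Nat.le_of_ble_eq_true rfl
      omega
  · have e1 : (HProg.assign 2 (arr (o + 4) (reg 0))).time ≤ 100 := Nat.le_of_ble_eq_true rfl
    have e2 : (op .lt (arr (o + 5) (reg 2)) (reg 1)).cost ≤ 100 := Nat.le_of_ble_eq_true rfl
    omega

end

end WordRAM

/-! ### The complete programs and the theorem -/

namespace WordRAM

open HExpr HProg

/-- The preprocessing. -/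
def buildAll : HProg := buildFor 0 false ⨾ buildFor 16 true

/-- Left queries. -/
def leftQuery : HProg := findMarked 0

/-- Right queries. -/
def rightQuery : HProg :=
  .ite (.op .eq (child (reg 0)) nodes) (findMarked 16)
    (.ite (.op .eq (reg 1) 1) .skip (.assign 1 (reg 1 - 1) ⨾ findMarked 16))

variable {s : List ℕ} {T : SuffixTree s} {E : Env} (hI : T.Input E)
include hI

theorem triple_buildAll : Triple E buildAll ⟨fun _ => 0, fun _ _ => 0⟩ (268000 * s.length)
    fun τ => DataFor T false 0 τ.arr ∧ DataFor T true 16 τ.arr := by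
  refine ((triple_buildFor hI (by omega) fun _ => rfl).seq fun τ f q =>
    (triple_buildFor hI le_rfl fun x => ?_).mono le_rfl fun ρ f' q' => ⟨?_, q'⟩).mono
    (by omega) fun _ _ => id
  · rw [f.2 16 (by decide)]
  -- The second direction uses arrays with numbers at least 16, so it leaves the first data
  -- structure intact.
  · have hfr : ∀ i < 16, ρ.arr i = τ.arr i := fun i hi => f'.2 i (by
      revert i; decide)
    obtain ⟨⟨h4, h5, h6, h7, h8⟩, hh, h1, h2, h12, h12'⟩ := q
    have e := fun i (hi : 0 + i < 16) => hfr (0 + i) hi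
    refine ⟨⟨?_, ?_, ?_, ?_, ?_⟩, fun i hi => ?_, ?_, ?_, ?_, ?_⟩
    · rwa [e 4 (by decide)]
    · rwa [e 5 (by decide)]
    · rwa [e 6 (by decide)]
    · rwa [e 7 (by decide)]
    · rwa [e 8 (by decide)]
    · obtain ⟨g1, g2, g3⟩ := hh i hi
      refine ⟨?_, ?_, fun κ hd hH => ?_⟩
      · rwa [e 9 (by decide)]
      · rwa [e 10 (by decide)]
      · have := g3 κ hd hH
        unfold JumpOk at *
        rwa [e 11 (by decide)]
    · rwa [e 1 (by decide)]
    · rwa [e 2 (by decide)]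
    · rwa [e 12 (by decide)]
    · rwa [e 12 (by decide)]

theorem triple_leftQuery {σ : HState} (hD : DataFor T false 0 σ.arr) {v : Fin T.size}
    (hv : σ.reg 0 = v) (hd : 1 ≤ σ.reg 1) :
    Triple E leftQuery σ 2000 fun ρ => ρ.reg 0 = T.pointer (T.nthLeftBranching v (σ.reg 1)) := by
  obtain ⟨k, hk, hkv⟩ := T.exists_event_eq (v, false)
  rw [T.nthLeftBranching_eq hkv hd]
  exact triple_findMarked hI (by omega) hD hv hd hk hkv

theorem triple_rightQuery {σ : HState} (hD : DataFor T true 16 σ.arr) {v : Fin T.size}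
    (hv : σ.reg 0 = v) (hd : 1 ≤ σ.reg 1) (hcap : σ.reg 1 < E.cap) :
    Triple E rightQuery σ 4000 fun ρ =>
      ρ.reg 0 = T.pointer (T.nthRightBranching v (σ.reg 1)) := by
  obtain ⟨k, hk, hkv⟩ := T.exists_event_eq (v, false)
  have hb := hI.bounds
  -- The nil pointer is the number of nodes, so the comparison recognises leaves.
  have hchild : (op .eq (child (reg 0)) nodes).val E σ = 0 ↔ T.children v ≠ [] := by
    rw [val_eq, val_child hI (σ := σ) (e := reg 0) (v := v) hv, val_nodes hI]
    rcases hc : T.children v with _ | ⟨c, l⟩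
    · simp [SuffixTree.pointer]
    · simp [SuffixTree.pointer, c.2.ne]
  refine (Triple.ite (t := 3000) ?_ (fun h => ?_) (fun h => Triple.ite (t := 2500) ?_ (fun h' => ?_)
    (fun h' => ?_)|>.mono ?_ fun _ _ => id)).mono ?_ fun _ _ => id
  · simp [ok_child hI (σ := σ) (e := reg 0) (v := v) hv, ok_nodes hI]
  · rw [T.nthRightBranching_eq_of_leaf hkv (not_not.1 (mt hchild.2 h)) hd]
    exact (triple_findMarked hI le_rfl hD hv hd hk hkv).mono (by omega) fun _ _ => id
  · simp; omega
  · have h1 : σ.reg 1 = 1 := by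
      by_contra h1
      simp [h1] at h'
    rw [h1, T.nthRightBranching_one (hchild.1 h)]
    -- At an inner node the first answer is `v` itself, which is already in register 0.
    exact triple_of_wp_le (Nat.le_of_ble_eq_true rfl) hv
  · have h1 : σ.reg 1 ≠ 1 := by
      intro h1
      simp [h1] at h'
    rw [T.nthRightBranching_eq hkv (hchild.1 h) (by omega)]
    refine ((triple_of_wp_le (t := 100) (Q := fun τ => τ.reg 1 = σ.reg 1 - 1)
      (Nat.le_of_ble_eq_true rfl) ?_).seq fun τ f q => ?_).mono (by omega : 100 + 2000 ≤ 2500)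
      fun _ _ => id
    · simp [wp]; omega
    · rw [← q]
      refine triple_findMarked hI le_rfl ?_ ?_ (by omega) hk hkv
      · rw [show τ.arr = σ.arr from funext fun i => f.2 i (by simp [arrs])]
        exact hD
      · rw [f.1 0 (by simp [regs]), hv]
  · have : (op .eq (reg 1) 1).cost ≤ 100 := Nat.le_of_ble_eq_true rfl
    generalize (op .eq (reg 1) 1).cost = c at *
    omega
  · have : (op .eq (child (reg 0)) nodes).cost ≤ 100 := Nat.le_of_ble_eq_true rfl
    generalize (op .eq (child (reg 0)) nodes).cost = c at *
    omega

omit hI in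
/-- The answer of a program that does not write to the memory. -/
theorem Triple.answers {p : HProg} {σ : HState} {x y z t : ℕ} (hs : Supported E σ)
    (hp : p.arrs = [])
    (h : Triple E p ⟨fun r => if r = 0 then x else if r = 1 then y else 0, σ.arr⟩ t
      fun τ => τ.reg 0 = z) :
    Answers E.w p.compile (E.toState σ).mem x y t z := by
  obtain ⟨t', ht, τ, -, hf, hz, hr⟩ := h hs
  have harr : τ.arr = σ.arr := funext fun i => hf.2 i (by simp [hp])
  refine ⟨t', E.toState τ, hr, ht, ?_, hz⟩
  simp only [Env.toState, harr]

end WordRAM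

theorem mainTheorem6 :
    ∃ (build queryLeft queryRight : WordRAM.Prog) (C : ℕ),
      ∀ (s : List ℕ), Terminated s → ∀ (T : SuffixTree s) (w : ℕ),
        C * s.length ≤ 2 ^ w → (∀ a ∈ s, a < 2 ^ w) →
        ∃ (t : ℕ) (σ : WordRAM.State),
          WordRAM.Runs w build (WordRAM.initState T.encode) t σ ∧
          t ≤ C * s.length ∧
          (∀ a, C * s.length ≤ a → σ.mem a = 0) ∧
          ∀ (v : Fin T.size) (d : ℕ), 1 ≤ d → d < 2 ^ w →
            WordRAM.Answers w queryLeft σ.mem v d C (T.pointer (T.nthLeftBranching v d)) ∧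
            WordRAM.Answers w queryRight σ.mem v d C (T.pointer (T.nthRightBranching v d)) := by
  -- The constant dominates the preprocessing time `268000n`, the query time 4000, and the memory,
  -- which consists of the input and 32 arrays of length `200n`.
  refine ⟨WordRAM.buildAll.compile, WordRAM.leftQuery.compile, WordRAM.rightQuery.compile, 300000,
    fun s hs T w hw _ => ?_⟩
  have hn : 0 < s.length := by
    obtain ⟨t, c, rfl, -⟩ := hs
    simp
  have hm := T.size_le
  have hX : 0 < 200 * s.length := by omega
  have hcap : 3 + s.length + 5 * T.size + 32 * (200 * s.length) ≤ 2 ^ w := by omega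
  have hI := T.input_env (w := w) (hX := hX) (h := hcap) hn le_rfl
  obtain ⟨t, ht, τ, hsup, -, ⟨hL, hR⟩, hrun⟩ := WordRAM.triple_buildAll hI fun _ _ _ => rfl
  refine ⟨t, _, by rw [T.initState_encode]; exact hrun, by omega, fun a ha => ?_,
    fun v d hd hdw => ⟨?_, ?_⟩⟩
  · have hbase : (T.env w (200 * s.length) hX hcap).base = 3 + s.length + 5 * T.size := rfl
    simp only [WordRAM.Env.toState]
    rw [if_neg (by omega)]
    -- A cell this far out belongs to an array index beyond `200n`, where `Supported` makes the
    -- arrays vanish.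
    refine hsup _ _ ?_
    change 200 * s.length ≤ _
    omega
  · exact WordRAM.Triple.answers hsup rfl ((WordRAM.triple_leftQuery hI (by exact hL) rfl hd).mono (by omega)
      fun _ _ => id)
  · exact WordRAM.Triple.answers hsup rfl ((WordRAM.triple_rightQuery hI (by exact hR) rfl hd hdw).mono (by omega)
      fun _ _ => id)
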